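/- **Setting.** All tensor products of $C^*$-algebras are minimal, $M(B)$ denotes the multiplier algebra of $B$, $A^*$ the dual space of $A$, and inner products are conjugate linear in the first variable. Let $A$ be a separable $C^*$-algebra and let $(A,\delta)$ be a proper $C^*$-bialgebra with the cancellation property. That is, $\delta:A\to M(A\otimes A)$ is a nondegenerate $*$-homomorphism (the linear span of $\delta(A)(A\otimes A)$ is dense in $A\otimes A$) with $(\delta\otimes\mathrm{id})\circ\delta=(\mathrm{id}\otimes\delta)\circ\delta$; the elements $\delta(a)(1\otimes b)$ and $(b\otimes 1)\delta(a)$ belong to $A\otimes A$ for all $a,b\in A$; and the linear span of the $\delta(a)(1\otimes b)$, and that of the $(b\otimes1)\delta(a)$, are dense in $A\otimes A$. For $\varphi\in A^*$ and $a\in A$ put $\varphi*a=(\mathrm{id}\otimes\varphi)\delta(a)$, where $\mathrm{id}\otimes\varphi$ is extended strictly continuously to $M(A\otimes A)$, and put $\varphi^*(a)=\overline{\varphi(a^*)}$. Let $h:A_+\to[0,\infty]$ be a faithful, locally finite, lower semicontinuous weight on $A$ which is right invariant. With $\mathfrak N_h=\{a\in A: h(a^*a)<\infty\}$, this means: $h(a^*a)=0$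 implies $a=0$; $\mathfrak N_h$ is dense in $A$; the sets $\{a\in A_+:h(a)\le t\}$ are norm closed; and $h(\varphi*a)=\varphi(1)h(a)$ for all $a\in A_+$ with $h(a)<\infty$ and all positive $\varphi\in A^*$ (where $\varphi(1)=\|\varphi\|$). Extend $h$ linearly to the linear span $\mathfrak M_h$ of $\{a\in A_+:h(a)<\infty\}$. Let $\mathcal H$ be the GNS Hilbert space of $h$ and $\eta:\mathfrak N_h\to\mathcal H$ the GNS map, so that $(\eta(a)|\eta(b))=h(a^*b)$ and $\eta(\mathfrak N_h)$ is dense in $\mathcal H$. Let $\kappa$ be a closed densely defined linear map acting on $A$, with domain $\mathcal D(\kappa)$, such that 1. $\kappa=R\circ\tau_{i/2}$, where $(\tau_t)_{t\in\mathbb R}$ is a pointwise norm continuous one-parameter group of $*$-automorphisms of $A$, $\tau_{i/2}$ is its analytic continuation to $i/2$ (that is, $a\in\mathcal D(\tau_{i/2})$ and $\tau_{i/2}(a)=b$ if and only if some $A$-valued function, continuous on $0\le\operatorname{Im}z\le\frac12$ and holomorphic in the interior, has the values $\tau_t(a)$ at all $t\in\mathbb R$ and $b$ at $i/2$), and $R$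 is an involutive ($*$-preserving, linear) antiautomorphism of $A$ commuting with all $\tau_t$; 2. there is $\lambda>0$ with $h\circ\tau_t=\lambda^t h$ for all $t\in\mathbb R$. For $\varphi\in A^*$ we write $\varphi\circ\kappa\in A^*$ if there is $\psi\in A^*$ with $\psi(a)=\varphi(\kappa(a))$ for all $a\in\mathcal D(\kappa)$; this unique $\psi$ is denoted by $\varphi\circ\kappa$. **Theorem.** For all $\varphi\in A^*$ and $a\in A$ the element $\varphi*a$ is a well defined element of $A$. For every $\varphi\in A^*$ one has $\varphi*a\in\mathfrak N_h$ for all $a\in\mathfrak N_h$, and there is a unique bounded operator $W_\varphi$ on $\mathcal H$ with $W_\varphi\eta(a)=\eta(\varphi*a)$ for all $a\in\mathfrak N_h$. For all $x,y\in\mathcal H$ there is a unique $W(x,y)\in A$ with $\varphi(W(x,y))=(x|W_\varphi y)$ for all $\varphi\in A^*$. Moreover, the following statements are equivalent: 1. (Strong right invariance) For every $\varphi\in A^*$ with $\varphi\circ\kappa\in A^*$ and all $a,b\in\mathfrak N_h$, the elements $(\varphi*a^*)b$ and $a^*((\varphi\circ\kappa)*b)$ belong to $\mathfrak M_h$ and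 $h((\varphi*a^*)b)=h(a^*((\varphi\circ\kappa)*b))$. 2. $W_{\varphi^*}=(W_{\varphi\circ\kappa})^*$ for all $\varphi\in A^*$ such that $\varphi\circ\kappa\in A^*$. 3. There is a weak* dense subset $\mathcal D_0$ of $A^*$ such that $\psi\circ\tau_t\in\mathcal D_0$ for all $\psi\in\mathcal D_0$ and $t\in\mathbb R$, and such that $\varphi\circ\kappa\in A^*$ and $W_{\varphi^*}=(W_{\varphi\circ\kappa})^*$ for all $\varphi\in\mathcal D_0$. 4. For all $x,y\in\mathcal H$ the element $W(x,y)$ is in $\mathcal D(\kappa)$ and $\kappa(W(x,y))=W(y,x)^*$. -/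

import Mathlib

open scoped TensorProduct ComplexOrder ENNReal MultiplierAlgebra Topology
open Filter

noncomputable section

namespace QG

section HilbertTensor

variable {E F : Type*} [NormedAddCommGroup E] [InnerProductSpace ℂ E]
  [NormedAddCommGroup F] [InnerProductSpace ℂ F]

/-- The Hilbert space tensor product of `E` and `F`. -/
abbrev HilbertTensor (E F : Type*) [NormedAddCommGroup E] [InnerProductSpace ℂ E]
    [NormedAddCommGroup F] [InnerProductSpace ℂ F] : Type _ :=
  UniformSpace.Completion (E ⊗[ℂ] F)

/-- The operator `S ⊗ T` on the Hilbert space tensor product. -/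
def opTensor (S : E →L[ℂ] E) (T : F →L[ℂ] F) : HilbertTensor E F →L[ℂ] HilbertTensor E F :=
  (TensorProduct.mapL S T).completion

theorem opTensor_coe (S : E →L[ℂ] E) (T : F →L[ℂ] F) (x : E ⊗[ℂ] F) :
    opTensor S T (x : HilbertTensor E F) =
      ((TensorProduct.mapL S T x : E ⊗[ℂ] F) : HilbertTensor E F) :=
  ContinuousLinearMap.completion_apply_coe _ _

theorem opTensor_mul (S S' : E →L[ℂ] E) (T T' : F →L[ℂ] F) :
    opTensor S T * opTensor S' T' = opTensor (S * S') (T * T') := by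
  ext x
  induction x using UniformSpace.Completion.induction_on with
  | hp => exact isClosed_eq (ContinuousLinearMap.continuous _) (ContinuousLinearMap.continuous _)
  | ih x =>
    rw [mul_apply_eq_comp, opTensor_coe, opTensor_coe, opTensor_coe,
      TensorProduct.mapL_mul, mul_apply_eq_comp]

theorem norm_opTensor_le (S : E →L[ℂ] E) (T : F →L[ℂ] F) : ‖opTensor S T‖ ≤ ‖S‖ * ‖T‖ := by
  refine ContinuousLinearMap.opNorm_le_bound _ (by positivity) fun x => ?_
  induction x using UniformSpace.Completion.induction_on with
  | hp => exact isClosed_le (by fun_prop) (by fun_prop)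
  | ih x =>
    rw [opTensor_coe, UniformSpace.Completion.norm_coe, UniformSpace.Completion.norm_coe]
    exact ((TensorProduct.mapL S T).le_opNorm x).trans
      (mul_le_mul_of_nonneg_right (TensorProduct.norm_mapL_le S T) (norm_nonneg _))

theorem star_opTensor [CompleteSpace E] [CompleteSpace F] (S : E →L[ℂ] E) (T : F →L[ℂ] F) :
    star (opTensor S T) = opTensor (star S) (star T) := by
  rw [ContinuousLinearMap.star_eq_adjoint, eq_comm, ContinuousLinearMap.eq_adjoint_iff]
  intro x y
  induction x, y using UniformSpace.Completion.induction_on₂ with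
  | hp => exact isClosed_eq (by fun_prop) (by fun_prop)
  | ih x y =>
    rw [opTensor_coe, opTensor_coe, UniformSpace.Completion.inner_coe,
      UniformSpace.Completion.inner_coe]
    induction x using TensorProduct.induction_on with
    | zero => simp
    | add a b ha hb => rw [map_add, inner_add_left, inner_add_left, ha, hb]
    | tmul a b =>
      induction y using TensorProduct.induction_on with
      | zero => simp
      | add c d hc hd => rw [map_add, inner_add_right, inner_add_right, hc, hd]
      | tmul c d =>
        rw [TensorProduct.mapL_tmul, TensorProduct.mapL_tmul, TensorProduct.inner_tmul,
          TensorProduct.inner_tmul, ContinuousLinearMap.star_eq_adjoint,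
          ContinuousLinearMap.star_eq_adjoint, ContinuousLinearMap.adjoint_inner_left,
          ContinuousLinearMap.adjoint_inner_left]

end HilbertTensor

section MinTensor

variable (A B : Type*) [NonUnitalCStarAlgebra A] [PartialOrder A] [StarOrderedRing A]
  [NonUnitalCStarAlgebra B] [PartialOrder B] [StarOrderedRing B]

variable {A B} in
/-- The C⋆-algebra of bounded operators on `H_f ⊗ H_g`, where `H_f` and `H_g` are the GNS spaces
of the positive functionals `f` on `A` and `g` on `B`. -/
def OpAlg (p : (A →ₚ[ℂ] ℂ) × (B →ₚ[ℂ] ℂ)) : Type _ :=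
  HilbertTensor p.1.GNS p.2.GNS →L[ℂ] HilbertTensor p.1.GNS p.2.GNS

instance (p : (A →ₚ[ℂ] ℂ) × (B →ₚ[ℂ] ℂ)) : CStarAlgebra (OpAlg p) :=
  inferInstanceAs
    (CStarAlgebra (HilbertTensor p.1.GNS p.2.GNS →L[ℂ] HilbertTensor p.1.GNS p.2.GNS))

/-- The C⋆-algebra of bounded families of operators on the Hilbert spaces `H_f ⊗ H_g`, where
`f` and `g` run over all positive functionals on `A` and `B`. -/
abbrev TensorAmbient : Type _ :=
  lp (fun p : (A →ₚ[ℂ] ℂ) × (B →ₚ[ℂ] ℂ) => OpAlg p) ∞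

variable {A B}

/-- The family `(π_f(a) ⊗ π_g(b))` for `f`, `g` positive functionals with GNS representations
`π_f`, `π_g`. -/
def ambientTmul (a : A) (b : B) : TensorAmbient A B :=
  ⟨fun p => opTensor (p.1.gnsNonUnitalStarAlgHom a) (p.2.gnsNonUnitalStarAlgHom b), by
    refine memℓp_infty ⟨‖a‖ * ‖b‖, ?_⟩
    rintro _ ⟨p, rfl⟩
    refine (norm_opTensor_le _ _).trans ?_
    gcongr
    · exact NonUnitalStarAlgHom.norm_apply_le _ _
    · exact NonUnitalStarAlgHom.norm_apply_le _ _⟩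

/-- The family `(π_f(a) ⊗ 1)`. -/
def ambientLeft (a : A) : TensorAmbient A B :=
  ⟨fun p => opTensor (p.1.gnsNonUnitalStarAlgHom a) 1, by
    refine memℓp_infty ⟨‖a‖ * 1, ?_⟩
    rintro _ ⟨p, rfl⟩
    refine (norm_opTensor_le _ _).trans ?_
    gcongr
    · exact NonUnitalStarAlgHom.norm_apply_le _ _
    · exact ContinuousLinearMap.norm_id_le⟩

/-- The family `(1 ⊗ π_g(b))`. -/
def ambientRight (b : B) : TensorAmbient A B :=
  ⟨fun p => opTensor 1 (p.2.gnsNonUnitalStarAlgHom b), by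
    refine memℓp_infty ⟨1 * ‖b‖, ?_⟩
    rintro _ ⟨p, rfl⟩
    refine (norm_opTensor_le _ _).trans ?_
    gcongr
    · exact ContinuousLinearMap.norm_id_le
    · exact NonUnitalStarAlgHom.norm_apply_le _ _⟩

theorem ambientTmul_mul (a a' : A) (b b' : B) :
    (ambientTmul a b * ambientTmul a' b' : TensorAmbient A B) =
      ambientTmul (a * a') (b * b') := by
  apply lp.ext
  funext p
  exact (opTensor_mul _ _ _ _).trans (by rw [← map_mul, ← map_mul]; rfl)

theorem star_ambientTmul (a : A) (b : B) :
    star (ambientTmul a b : TensorAmbient A B) = ambientTmul (star a) (star b) := by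
  apply lp.ext
  funext p
  exact (star_opTensor _ _).trans (by rw [← map_star, ← map_star]; rfl)

theorem ambientLeft_mul (a a' : A) (b : B) :
    (ambientLeft a : TensorAmbient A B) * ambientTmul a' b = ambientTmul (a * a') b := by
  apply lp.ext
  funext p
  exact (opTensor_mul _ _ _ _).trans (by rw [← map_mul, one_mul]; rfl)

theorem mul_ambientLeft (a a' : A) (b : B) :
    (ambientTmul a' b : TensorAmbient A B) * ambientLeft a = ambientTmul (a' * a) b := by
  apply lp.ext
  funext p
  exact (opTensor_mul _ _ _ _).trans (by rw [← map_mul, mul_one]; rfl)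

theorem ambientRight_mul (a : A) (b b' : B) :
    (ambientRight b : TensorAmbient A B) * ambientTmul a b' = ambientTmul a (b * b') := by
  apply lp.ext
  funext p
  exact (opTensor_mul _ _ _ _).trans (by rw [← map_mul, one_mul]; rfl)

theorem mul_ambientRight (a : A) (b b' : B) :
    (ambientTmul a b' : TensorAmbient A B) * ambientRight b = ambientTmul a (b' * b) := by
  apply lp.ext
  funext p
  exact (opTensor_mul _ _ _ _).trans (by rw [← map_mul, mul_one]; rfl)

variable (A B) in
/-- The image of the algebraic tensor product: the linear span of the `(π_f(a) ⊗ π_g(b))`. -/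
def algTensor : NonUnitalStarSubalgebra ℂ (TensorAmbient A B) :=
  { Submodule.span ℂ (Set.range fun p : A × B => ambientTmul p.1 p.2) with
    mul_mem' := by
      intro x y hx hy
      induction hx, hy using Submodule.span_induction₂ with
      | mem_mem x y hx hy =>
        obtain ⟨p, rfl⟩ := hx
        obtain ⟨q, rfl⟩ := hy
        exact Submodule.subset_span ⟨(p.1 * q.1, p.2 * q.2), (ambientTmul_mul _ _ _ _).symm⟩
      | zero_left y _ => rw [zero_mul]; exact Submodule.zero_mem _
      | zero_right x _ => rw [mul_zero]; exact Submodule.zero_mem _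
      | add_left x y z _ _ _ h1 h2 => rw [add_mul]; exact Submodule.add_mem _ h1 h2
      | add_right x y z _ _ _ h1 h2 => rw [mul_add]; exact Submodule.add_mem _ h1 h2
      | smul_left r x y _ _ h => rw [smul_mul_assoc]; exact Submodule.smul_mem _ _ h
      | smul_right r x y _ _ h => rw [mul_smul_comm]; exact Submodule.smul_mem _ _ h
    star_mem' := by
      intro x hx
      induction hx using Submodule.span_induction with
      | mem x hx =>
        obtain ⟨p, rfl⟩ := hx
        exact Submodule.subset_span ⟨(star p.1, star p.2), (star_ambientTmul _ _).symm⟩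
      | zero => rw [star_zero]; exact Submodule.zero_mem _
      | add x y _ _ h1 h2 => rw [star_add]; exact Submodule.add_mem _ h1 h2
      | smul r x _ h => rw [star_smul]; exact Submodule.smul_mem _ _ h }

variable (A B) in
/-- The closure of the image of the algebraic tensor product. -/
def minTensorSubalgebra : NonUnitalStarSubalgebra ℂ (TensorAmbient A B) :=
  (algTensor A B).topologicalClosure

variable (A B) in
/-- The minimal (spatial) C⋆-tensor product `A ⊗ B`: the completion of the algebraic tensor
product in the norm `‖t‖ = sup ‖(π_f ⊗ π_g)(t)‖`, over all GNS representations. -/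
def MinTensor : Type _ := minTensorSubalgebra A B

instance : NonUnitalCStarAlgebra (MinTensor A B) :=
  NonUnitalStarSubalgebra.nonUnitalCStarAlgebra (minTensorSubalgebra A B)
    (h_closed := NonUnitalStarSubalgebra.isClosed_topologicalClosure (algTensor A B))

instance : PartialOrder (MinTensor A B) := CStarAlgebra.spectralOrder _

instance : StarOrderedRing (MinTensor A B) := CStarAlgebra.spectralOrderedRing _

/-- The inclusion of `A ⊗ B` in the ambient C⋆-algebra. -/
def MinTensor.incl : MinTensor A B →L[ℂ] TensorAmbient A B :=
  (minTensorSubalgebra A B).toNonUnitalSubalgebra.toSubmodule.subtypeL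

/-- The elementary tensor `a ⊗ b` in `A ⊗ B`. -/
def tmul (a : A) (b : B) : MinTensor A B :=
  ⟨ambientTmul a b, NonUnitalStarSubalgebra.le_topologicalClosure _
    (Submodule.subset_span ⟨(a, b), rfl⟩)⟩


theorem mul_mem_minTensor (u : TensorAmbient A B)
    (hl : ∀ a b, u * ambientTmul a b ∈ algTensor A B) (t : TensorAmbient A B)
    (ht : t ∈ minTensorSubalgebra A B) : u * t ∈ minTensorSubalgebra A B :=
  map_mem_closure (continuous_const_mul u) ht (fun x (hx : x ∈ Submodule.span ℂ _) => by
    induction hx using Submodule.span_induction with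
    | mem x hx => obtain ⟨p, rfl⟩ := hx; exact hl _ _
    | zero => rw [mul_zero]; exact zero_mem (algTensor A B)
    | add x y _ _ h1 h2 => rw [mul_add]; exact (algTensor A B).add_mem h1 h2
    | smul r x _ h => rw [mul_smul_comm]; exact (algTensor A B).toSubmodule.smul_mem r h)

theorem minTensor_mul_mem (u : TensorAmbient A B)
    (hr : ∀ a b, ambientTmul a b * u ∈ algTensor A B) (t : TensorAmbient A B)
    (ht : t ∈ minTensorSubalgebra A B) : t * u ∈ minTensorSubalgebra A B :=
  map_mem_closure (f := fun s => s * u) (continuous_mul_const u) ht (fun x (hx : x ∈ Submodule.span ℂ _) => by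
    induction hx using Submodule.span_induction with
    | mem x hx => obtain ⟨p, rfl⟩ := hx; exact hr _ _
    | zero => beta_reduce; rw [zero_mul]; exact zero_mem (algTensor A B)
    | add x y _ _ h1 h2 => beta_reduce; rw [add_mul]; exact (algTensor A B).add_mem h1 h2
    | smul r x _ h => beta_reduce; rw [smul_mul_assoc]; exact (algTensor A B).toSubmodule.smul_mem r h)

/-- An element `u` of the ambient C⋆-algebra with `u(a ⊗ b), (a ⊗ b)u ∈ A ⊗ B` defines a
multiplier of `A ⊗ B`. -/
def ambientMultiplier (u : TensorAmbient A B)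
    (hl : ∀ a b, u * ambientTmul a b ∈ algTensor A B)
    (hr : ∀ a b, ambientTmul a b * u ∈ algTensor A B) : 𝓜(ℂ, MinTensor A B) where
  fst := ((ContinuousLinearMap.mul ℂ (TensorAmbient A B) u).comp MinTensor.incl).codRestrict
    (minTensorSubalgebra A B).toNonUnitalSubalgebra.toSubmodule
    (fun t => mul_mem_minTensor u hl t.1 t.2)
  snd := (((ContinuousLinearMap.mul ℂ (TensorAmbient A B)).flip u).comp
    MinTensor.incl).codRestrict
    (minTensorSubalgebra A B).toNonUnitalSubalgebra.toSubmodule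
    (fun t => minTensor_mul_mem u hr t.1 t.2)
  central x y := Subtype.ext (mul_assoc (x.1 : TensorAmbient A B) u y.1)

theorem ambientTmul_mem (a : A) (b : B) : ambientTmul a b ∈ algTensor A B :=
  Submodule.subset_span ⟨(a, b), rfl⟩

variable (B) in
/-- The multiplier `a ⊗ 1` of `A ⊗ B`. -/
def tmulOne (a : A) : 𝓜(ℂ, MinTensor A B) :=
  ambientMultiplier (ambientLeft a)
    (fun a' b => by rw [ambientLeft_mul]; exact ambientTmul_mem _ _)
    (fun a' b => by rw [mul_ambientLeft]; exact ambientTmul_mem _ _)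

variable (A) in
/-- The multiplier `1 ⊗ b` of `A ⊗ B`. -/
def oneTmul (b : B) : 𝓜(ℂ, MinTensor A B) :=
  ambientMultiplier (ambientRight b)
    (fun a b' => by rw [ambientRight_mul]; exact ambientTmul_mem _ _)
    (fun a b' => by rw [mul_ambientRight]; exact ambientTmul_mem _ _)

theorem tmul_mul (a a' : A) (b b' : B) : tmul a b * tmul a' b' = tmul (a * a') (b * b') :=
  Subtype.ext (ambientTmul_mul a a' b b')

theorem star_tmul (a : A) (b : B) : star (tmul a b) = tmul (star a) (star b) :=
  Subtype.ext (star_ambientTmul a b)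

theorem tmulOne_fst (a a' : A) (b : B) : (tmulOne B a).fst (tmul a' b) = tmul (a * a') b :=
  Subtype.ext (ambientLeft_mul a a' b)

theorem tmulOne_snd (a a' : A) (b : B) : (tmulOne B a).snd (tmul a' b) = tmul (a' * a) b :=
  Subtype.ext (mul_ambientLeft a a' b)

theorem oneTmul_fst (a : A) (b b' : B) : (oneTmul A b).fst (tmul a b') = tmul a (b * b') :=
  Subtype.ext (ambientRight_mul a b b')

theorem oneTmul_snd (a : A) (b b' : B) : (oneTmul A b).snd (tmul a b') = tmul a (b' * b) :=
  Subtype.ext (mul_ambientRight a b b')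

/-- The linear span of the elementary tensors is dense in `A ⊗ B`. -/
theorem dense_span_tmul :
    Dense (Submodule.span ℂ {t : MinTensor A B | ∃ a b, t = tmul a b} : Set (MinTensor A B)) := by
  have key : ∀ x ∈ algTensor A B, ∃ t : MinTensor A B,
      t ∈ Submodule.span ℂ {t : MinTensor A B | ∃ a b, t = tmul a b} ∧ t.1 = x := by
    intro x (hx : x ∈ Submodule.span ℂ _)
    induction hx using Submodule.span_induction with
    | mem x hx =>
      obtain ⟨p, rfl⟩ := hx
      exact ⟨tmul p.1 p.2, Submodule.subset_span ⟨_, _, rfl⟩, rfl⟩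
    | zero => exact ⟨0, Submodule.zero_mem _, rfl⟩
    | add x y _ _ h1 h2 =>
      obtain ⟨u, hu, rfl⟩ := h1
      obtain ⟨v, hv, rfl⟩ := h2
      exact ⟨u + v, Submodule.add_mem _ hu hv, rfl⟩
    | smul r x _ h =>
      obtain ⟨u, hu, rfl⟩ := h
      exact ⟨r • u, Submodule.smul_mem _ r hu, rfl⟩
  intro t
  refine (closure_subtype (p := fun x => x ∈ minTensorSubalgebra A B)).2 ?_
  exact closure_mono (fun x hx => key x hx) t.2

end MinTensor

/-- A weight on the C⋆-algebra `A`: an additive, positively homogeneous map from the positive cone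
`A₊` to `[0, ∞]`.  Outside of `A₊` it is given the value `∞`. -/
structure CStarWeight (A : Type*) [NonUnitalCStarAlgebra A] [PartialOrder A] where
  toFun : A → ℝ≥0∞
  map_add : ∀ a b, 0 ≤ a → 0 ≤ b → toFun (a + b) = toFun a + toFun b
  map_smul : ∀ (r : ℝ) (a : A), 0 ≤ r → 0 ≤ a → toFun ((r : ℂ) • a) = ENNReal.ofReal r * toFun a
  map_of_not_nonneg : ∀ a, ¬ 0 ≤ a → toFun a = ∞

namespace CStarWeight

variable {A : Type*} [NonUnitalCStarAlgebra A] [PartialOrder A] (h : CStarWeight A)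

instance : CoeFun (CStarWeight A) (fun _ => A → ℝ≥0∞) := ⟨CStarWeight.toFun⟩

theorem map_zero : h 0 = 0 := by
  have := h.map_smul 0 0 le_rfl le_rfl
  simpa using this

variable [StarOrderedRing A]

theorem mono {a b : A} (ha : 0 ≤ a) (hab : a ≤ b) : h a ≤ h b := by
  have := h.map_add a (b - a) ha (sub_nonneg.2 hab)
  rw [add_sub_cancel] at this
  rw [this]
  exact le_self_add

/-- The left ideal `𝔑_h` of all `a` with `h(a⋆a) < ∞`. -/
def nIdeal : Submodule ℂ A where
  carrier := {a | h (star a * a) < ∞}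
  zero_mem' := by simp [h.map_zero]
  add_mem' := by
    intro a b ha hb
    have h1 : star (a + b) * (a + b) + star (a - b) * (a - b) =
        ((2 : ℝ) : ℂ) • (star a * a + star b * b) := by
      simp only [star_add, star_sub, add_mul, mul_add, sub_mul, mul_sub, Complex.ofReal_ofNat,
        two_smul]
      abel
    have h2 : h (star (a + b) * (a + b)) ≤ h (((2 : ℝ) : ℂ) • (star a * a + star b * b)) :=
      h.mono (star_mul_self_nonneg _) (by
        rw [← h1]; exact le_add_of_nonneg_right (star_mul_self_nonneg _))
    refine lt_of_le_of_lt h2 ?_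
    rw [h.map_smul _ _ (by norm_num) (add_nonneg (star_mul_self_nonneg _)
      (star_mul_self_nonneg _)), h.map_add _ _ (star_mul_self_nonneg _) (star_mul_self_nonneg _)]
    exact ENNReal.mul_lt_top ENNReal.ofReal_lt_top (ENNReal.add_lt_top.2 ⟨ha, hb⟩)
  smul_mem' := by
    intro c a ha
    have h1 : star (c • a) * (c • a) = ((Complex.normSq c : ℝ) : ℂ) • (star a * a) := by
      rw [star_smul, smul_mul_assoc, mul_smul_comm, smul_smul, Complex.normSq_eq_conj_mul_self]
      rfl
    change h (star (c • a) * (c • a)) < ∞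
    rw [h1, h.map_smul _ _ (Complex.normSq_nonneg c) (star_mul_self_nonneg _)]
    exact ENNReal.mul_lt_top ENNReal.ofReal_lt_top ha

/-- The linear span `𝔐_h` of all `a ∈ A₊` with `h(a) < ∞`. -/
def mSpan : Submodule ℂ A := Submodule.span ℂ {a | 0 ≤ a ∧ h a < ∞}

theorem nonneg_smul {r : ℝ} {a : A} (hr : 0 ≤ r) (ha : 0 ≤ a) : 0 ≤ (r : ℂ) • a := by
  rw [Complex.coe_smul]
  exact smul_nonneg hr ha

theorem map_sum {ι : Type*} (s : Finset ι) (f : ι → A) (hf : ∀ i ∈ s, 0 ≤ f i) :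
    h (∑ i ∈ s, f i) = ∑ i ∈ s, h (f i) := by
  classical
  induction s using Finset.induction_on with
  | empty => simp [h.map_zero]
  | insert i s hi ih =>
    rw [Finset.sum_insert hi, Finset.sum_insert hi, h.map_add _ _ (hf i (by simp))
      (Finset.sum_nonneg fun j hj => hf j (by simp [hj])), ih fun j hj => hf j (by simp [hj])]

theorem map_real_sum (s : Finset {a : A // 0 ≤ a ∧ h a < ∞})
    (r : {a : A // 0 ≤ a ∧ h a < ∞} → ℝ) (hr : ∀ c, 0 ≤ r c) :
    (h (∑ c ∈ s, (r c : ℂ) • c.1)).toReal = ∑ c ∈ s, r c * (h c.1).toReal := by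
  rw [h.map_sum _ _ fun c _ => nonneg_smul (hr c) c.2.1, ENNReal.toReal_sum]
  · refine Finset.sum_congr rfl fun c _ => ?_
    rw [h.map_smul _ _ (hr c) c.2.1, ENNReal.toReal_mul, ENNReal.toReal_ofReal (hr c)]
  · intro c _
    rw [h.map_smul _ _ (hr c) c.2.1]
    exact (ENNReal.mul_lt_top ENNReal.ofReal_lt_top c.2.2).ne

theorem real_sum_eq_zero (s : Finset {a : A // 0 ≤ a ∧ h a < ∞})
    (r : {a : A // 0 ≤ a ∧ h a < ∞} → ℝ) (h0 : ∑ c ∈ s, (r c : ℂ) • c.1 = 0) :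
    ∑ c ∈ s, r c * (h c.1).toReal = 0 := by
  have h1 : ∑ c ∈ s, ((max (r c) 0 : ℝ) : ℂ) • c.1 = ∑ c ∈ s, ((max (-r c) 0 : ℝ) : ℂ) • c.1 := by
    rw [← sub_eq_zero, ← Finset.sum_sub_distrib]
    refine Eq.trans (Finset.sum_congr rfl fun c _ => ?_) h0
    rw [← sub_smul, ← Complex.ofReal_sub, 
      max_zero_sub_max_neg_zero_eq_self]
  have h2 := h.map_real_sum s (fun c => max (r c) 0) fun c => le_max_right _ _
  have h3 := h.map_real_sum s (fun c => max (-r c) 0) fun c => le_max_right _ _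
  rw [h1] at h2
  have h4 := h2.symm.trans h3
  rw [← sub_eq_zero, ← Finset.sum_sub_distrib] at h4
  rw [← h4]
  refine Finset.sum_congr rfl fun c _ => ?_
  rw [← sub_mul, max_zero_sub_max_neg_zero_eq_self]

theorem exists_linear :
    ∃ L : A →ₗ[ℂ] ℂ, ∀ a, 0 ≤ a → h a < ∞ → L a = ((h a).toReal : ℂ) := by
  let P : ({a : A // 0 ≤ a ∧ h a < ∞} →₀ ℂ) →ₗ[ℂ] A := Finsupp.linearCombination ℂ Subtype.val
  let L₀ : ({a : A // 0 ≤ a ∧ h a < ∞} →₀ ℂ) →ₗ[ℂ] ℂ :=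
    Finsupp.linearCombination ℂ fun c => ((h c.1).toReal : ℂ)
  have hker : LinearMap.ker P ≤ LinearMap.ker L₀ := by
    intro f hf
    rw [LinearMap.mem_ker] at hf ⊢
    simp only [P, L₀, Finsupp.linearCombination_apply, Finsupp.sum] at hf ⊢
    have hstar : ∑ c ∈ f.support, (starRingEnd ℂ (f c)) • c.1 = 0 := by
      have := congrArg star hf
      rw [star_sum, star_zero] at this
      refine Eq.trans (Finset.sum_congr rfl fun c _ => ?_) this
      rw [star_smul, (IsSelfAdjoint.of_nonneg c.2.1).star_eq]
      rfl
    have hre : ∑ c ∈ f.support, (((f c).re : ℝ) : ℂ) • c.1 = 0 := by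
      have : ∑ c ∈ f.support, (((f c).re : ℝ) : ℂ) • c.1 = (1 / 2 : ℂ) •
          (∑ c ∈ f.support, f c • c.1 + ∑ c ∈ f.support, (starRingEnd ℂ (f c)) • c.1) := by
        rw [← Finset.sum_add_distrib, Finset.smul_sum]
        refine Finset.sum_congr rfl fun c _ => ?_
        rw [← add_smul, smul_smul, Complex.add_conj]
        congr 1
        push_cast
        ring
      rw [this, hf, hstar, add_zero, smul_zero]
    have him : ∑ c ∈ f.support, (((f c).im : ℝ) : ℂ) • c.1 = 0 := by
      have : ∑ c ∈ f.support, (((f c).im : ℝ) : ℂ) • c.1 = (1 / (2 * Complex.I) : ℂ) •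
          (∑ c ∈ f.support, f c • c.1 - ∑ c ∈ f.support, (starRingEnd ℂ (f c)) • c.1) := by
        rw [← Finset.sum_sub_distrib, Finset.smul_sum]
        refine Finset.sum_congr rfl fun c _ => ?_
        rw [← sub_smul, smul_smul, Complex.sub_conj]
        congr 1
        push_cast
        field_simp
      rw [this, hf, hstar, sub_zero, smul_zero]
    have e1 := h.real_sum_eq_zero _ _ hre
    have e2 := h.real_sum_eq_zero _ _ him
    have : ∑ c ∈ f.support, f c • ((h c.1).toReal : ℂ) =
        ((∑ c ∈ f.support, (f c).re * (h c.1).toReal : ℝ) : ℂ) +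
        ((∑ c ∈ f.support, (f c).im * (h c.1).toReal : ℝ) : ℂ) * Complex.I := by
      push_cast
      rw [Finset.sum_mul, ← Finset.sum_add_distrib]
      refine Finset.sum_congr rfl fun c _ => ?_
      conv_lhs => rw [← Complex.re_add_im (f c)]
      rw [smul_eq_mul]
      ring
    rw [this, e1, e2]
    simp
  obtain ⟨L, hL⟩ := LinearMap.exists_extend
    (((LinearMap.ker P).liftQ L₀ hker).comp P.quotKerEquivRange.symm.toLinearMap)
  refine ⟨L, fun a ha hfin => ?_⟩
  have hP : P (Finsupp.single ⟨a, ha, hfin⟩ 1) = a := by simp [P]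
  have h1 := LinearMap.congr_fun hL ⟨P (Finsupp.single ⟨a, ha, hfin⟩ 1), LinearMap.mem_range_self _ _⟩
  have h2 : P.quotKerEquivRange.symm ⟨P (Finsupp.single ⟨a, ha, hfin⟩ 1),
      LinearMap.mem_range_self _ _⟩ = (LinearMap.ker P).mkQ (Finsupp.single ⟨a, ha, hfin⟩ 1) :=
    P.quotKerEquivRange_symm_apply_image _ _
  simp only [LinearMap.comp_apply, Submodule.subtype_apply, LinearEquiv.coe_coe, h2] at h1
  rw [hP] at h1
  rw [h1]
  simp [L₀]

/-- The (unique) linear extension of the weight `h` to `𝔐_h`. -/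
def ext : h.mSpan →ₗ[ℂ] ℂ := h.exists_linear.choose.domRestrict h.mSpan

theorem ext_apply (a : A) (ha : 0 ≤ a) (hfin : h a < ∞) :
    h.ext ⟨a, Submodule.subset_span ⟨ha, hfin⟩⟩ = ((h a).toReal : ℂ) :=
  h.exists_linear.choose_spec a ha hfin

theorem star_mul_mem {a b : A} (ha : a ∈ h.nIdeal) (hb : b ∈ h.nIdeal) :
    star a * b ∈ h.mSpan := by
  have key : star a * b = (1 / 4 : ℂ) • (star (b + a) * (b + a) - star (b - a) * (b - a)
      + Complex.I • (star (b + Complex.I • a) * (b + Complex.I • a))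
      - Complex.I • (star (b - Complex.I • a) * (b - Complex.I • a))) := by
    have hI : star Complex.I = - Complex.I := Complex.conj_I
    simp only [star_add, star_sub, add_mul, mul_add, sub_mul, mul_sub, star_smul, smul_mul_assoc,
      mul_smul_comm, smul_add, smul_sub, smul_smul, hI]
    match_scalars <;> ring_nf <;> norm_num [Complex.I_sq]
  have hm : ∀ x ∈ h.nIdeal, star x * x ∈ h.mSpan := fun x hx =>
    Submodule.subset_span ⟨star_mul_self_nonneg _, hx⟩
  rw [key]
  refine Submodule.smul_mem _ _ (Submodule.sub_mem _ (Submodule.add_mem _ (Submodule.sub_mem _ ?_ ?_)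
    (Submodule.smul_mem _ _ ?_)) (Submodule.smul_mem _ _ ?_))
  · exact hm _ (Submodule.add_mem _ hb ha)
  · exact hm _ (Submodule.sub_mem _ hb ha)
  · exact hm _ (Submodule.add_mem _ hb (Submodule.smul_mem _ _ ha))
  · exact hm _ (Submodule.sub_mem _ hb (Submodule.smul_mem _ _ ha))

theorem ext_star (x y : h.mSpan) (hxy : (y : A) = star (x : A)) :
    h.ext y = starRingEnd ℂ (h.ext x) := by
  obtain ⟨x, hx⟩ := x
  obtain ⟨y, hy⟩ := y
  simp only at hxy
  subst hxy
  suffices ∀ (z : A) (_ : z ∈ h.mSpan), star z ∈ h.mSpan ∧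
      h.exists_linear.choose (star z) = starRingEnd ℂ (h.exists_linear.choose z) from
    (this x hx).2
  intro z hz
  induction hz using Submodule.span_induction with
  | mem z hz =>
    rw [(IsSelfAdjoint.of_nonneg hz.1).star_eq]
    refine ⟨Submodule.subset_span hz, ?_⟩
    rw [h.exists_linear.choose_spec z hz.1 hz.2, Complex.conj_ofReal]
  | zero => simp
  | add u v _ _ h1 h2 =>
    rw [star_add]
    exact ⟨Submodule.add_mem _ h1.1 h2.1, by rw [_root_.map_add, _root_.map_add, _root_.map_add, h1.2, h2.2]⟩
  | smul c u _ h1 =>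
    rw [star_smul]
    refine ⟨Submodule.smul_mem _ _ h1.1, ?_⟩
    rw [_root_.map_smul, _root_.map_smul, h1.2, smul_eq_mul, smul_eq_mul, map_mul]
    rfl

set_option linter.unusedVariables false in
/-- The space `𝔑_h`, with the scalar product `(a|b) = h(a⋆b)`. -/
@[nolint unusedArguments]
def PreGNS (h : CStarWeight A) : Type _ := h.nIdeal

instance : AddCommGroup h.PreGNS := inferInstanceAs (AddCommGroup h.nIdeal)
instance : Module ℂ h.PreGNS := inferInstanceAs (Module ℂ h.nIdeal)

/-- The identity map from `𝔑_h` to `𝔑_h` with the scalar product `(a|b) = h(a⋆b)`. -/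
def toPreGNS : h.nIdeal ≃ₗ[ℂ] h.PreGNS := LinearEquiv.refl ℂ _

/-- The scalar product `(a|b) = h(a⋆b)` on `𝔑_h`. -/
abbrev preGNSCore : PreInnerProductSpace.Core ℂ h.PreGNS where
  inner a b := h.ext ⟨star (h.toPreGNS.symm a : A) * (h.toPreGNS.symm b : A),
    h.star_mul_mem (h.toPreGNS.symm a).2 (h.toPreGNS.symm b).2⟩
  conj_inner_symm a b := (h.ext_star _ _ (by simp)).symm
  re_inner_nonneg a := by
    rw [h.ext_apply _ (star_mul_self_nonneg _) (h.toPreGNS.symm a).2]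
    simp
  add_left a b c := by
    rw [← _root_.map_add]
    congr 1
    apply Subtype.ext
    simp [add_mul]
  smul_left a b r := by
    refine Eq.trans ?_ ((_root_.map_smul h.ext _ _).trans (smul_eq_mul _ _))
    congr 1
    apply Subtype.ext
    simp [smul_mul_assoc]

instance : SeminormedAddCommGroup h.PreGNS :=
  InnerProductSpace.Core.toSeminormedAddCommGroup (c := h.preGNSCore)
instance : InnerProductSpace ℂ h.PreGNS := InnerProductSpace.ofCore h.preGNSCore

/-- The GNS Hilbert space of the weight `h`. -/
abbrev GNS : Type _ := UniformSpace.Completion h.PreGNS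

/-- The GNS map `η : 𝔑_h → H`. -/
def eta : h.nIdeal →ₗ[ℂ] h.GNS :=
  (UniformSpace.Completion.toComplL : h.PreGNS →L[ℂ] h.GNS).toLinearMap.comp
    h.toPreGNS.toLinearMap

theorem inner_eta (a b : h.nIdeal) :
    inner ℂ (h.eta a) (h.eta b) = h.ext ⟨star (a : A) * (b : A), h.star_mul_mem a.2 b.2⟩ :=
  UniformSpace.Completion.inner_coe _ _

/-- `h` is faithful. -/
def IsFaithful : Prop := ∀ a, h (star a * a) = 0 → a = 0

/-- `h` is locally finite: `𝔑_h` is dense in `A`. -/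
def IsLocallyFinite : Prop := Dense (h.nIdeal : Set A)

/-- `h` is lower semicontinuous: the sets `{a ∈ A₊ | h(a) ≤ t}` are norm closed. -/
def IsLowerSemicontinuous : Prop :=
  ∀ t : ℝ, 0 ≤ t → IsClosed {a : A | 0 ≤ a ∧ h a ≤ ENNReal.ofReal t}

end CStarWeight

section Functionals

variable {A : Type*} [NonUnitalCStarAlgebra A] [PartialOrder A] [StarOrderedRing A]

/-- `φ` is a positive functional: `φ ∈ A*₊`. -/
def IsPositiveFunctional (φ : StrongDual ℂ A) : Prop := ∀ a, 0 ≤ a → 0 ≤ φ a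

/-- The adjoint functional `φ*(a) = conj (φ(a⋆))`. -/
def starFunctional (φ : StrongDual ℂ A) : StrongDual ℂ A where
  toFun a := starRingEnd ℂ (φ (star a))
  map_add' a b := by simp
  map_smul' c a := by simp [star_smul]
  cont := by fun_prop

/-- The canonical extension of a positive functional `φ` to the multiplier algebra takes at the
unit the value `φ(1) = lim φ(e) = ‖φ‖`, where `e` runs over the approximate unit of `A`. -/
theorem tendsto_approximateUnit_norm (φ : StrongDual ℂ A) (hφ : IsPositiveFunctional φ) :
    Tendsto φ (CStarAlgebra.approximateUnit A) (𝓝 ((‖φ‖ : ℝ) : ℂ)) := by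
  have hl := CStarAlgebra.increasingApproximateUnit A
  let f : A →ₚ[ℂ] ℂ := PositiveLinearMap.mk₀ φ.toLinearMap hφ
  have hf : ∀ a, f a = φ a := fun a => rfl
  have CS : ∀ x y : A, ‖φ (star x * y)‖ ^ 2 ≤ ‖φ (star x * x)‖ * ‖φ (star y * y)‖ := by
    intro x y
    have h1 := norm_inner_le_norm (𝕜 := ℂ) (f.toPreGNS x) (f.toPreGNS y)
    have h2 : ∀ z : A, ‖f.toPreGNS z‖ ^ 2 = ‖φ (star z * z)‖ := by
      intro z
      have := congrArg norm (f.preGNS_norm_sq (f.toPreGNS z))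
      simpa [hf] using this
    rw [← h2, ← h2, ← mul_pow]
    exact pow_le_pow_left₀ (norm_nonneg _) h1 2
  have hpos : ∀ᶠ e in CStarAlgebra.approximateUnit A, φ e = ((‖φ e‖ : ℝ) : ℂ) := by
    filter_upwards [hl.eventually_nonneg] with e he
    exact (Complex.norm_of_nonneg' (hφ e he)).symm
  suffices Tendsto (fun e => ‖φ e‖) (CStarAlgebra.approximateUnit A) (𝓝 ‖φ‖) from
    ((Complex.continuous_ofReal.tendsto _).comp this).congr' (hpos.mono fun e he => he.symm)
  have hup : ∀ᶠ e in CStarAlgebra.approximateUnit A, ‖φ e‖ ≤ ‖φ‖ := by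
    filter_upwards [hl.eventually_norm] with e he
    exact φ.le_of_opNorm_le_of_le le_rfl he |>.trans (by simp)
  rcases eq_or_ne φ 0 with rfl | h0
  · simp
  have hφ0 : 0 < ‖φ‖ := norm_pos_iff.2 h0
  refine tendsto_order.2 ⟨fun c hc => ?_, fun c hc => hup.mono fun e he => he.trans_lt hc⟩
  rcases lt_or_ge c 0 with hc0 | hc0
  · exact .of_forall fun e => hc0.trans_le (norm_nonneg _)
  have hlt : Real.sqrt (c * ‖φ‖) < ‖φ‖ := by
    rw [Real.sqrt_lt' hφ0, sq]
    exact mul_lt_mul_of_pos_right hc hφ0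
  obtain ⟨x, hx1, hx⟩ := φ.exists_lt_apply_of_lt_opNorm hlt
  have hlim : Tendsto (fun e => ‖φ (e * x)‖) (CStarAlgebra.approximateUnit A) (𝓝 ‖φ x‖) :=
    ((φ.continuous.norm).tendsto x).comp (hl.tendsto_mul_right x)
  filter_upwards [hlim.eventually (lt_mem_nhds hx), hl.eventually_nonneg, hl.eventually_norm]
    with e h1 h2 h3
  have h4 := CS e x
  rw [(IsSelfAdjoint.of_nonneg h2).star_eq] at h4
  have h5 : e * e ≤ e := by
    have := CStarAlgebra.star_left_conjugate_le_norm_smul (a := CFC.sqrt e) (b := e)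
      (IsSelfAdjoint.of_nonneg h2)
    have hs : CFC.sqrt e * CFC.sqrt e = e := CFC.sqrt_mul_sqrt_self e h2
    have hss : star (CFC.sqrt e) = CFC.sqrt e :=
      (IsSelfAdjoint.of_nonneg (CFC.sqrt_nonneg e)).star_eq
    rw [hss, hs] at this
    have h6 : CFC.sqrt e * e * CFC.sqrt e = e * e := by
      calc CFC.sqrt e * e * CFC.sqrt e
          = CFC.sqrt e * (CFC.sqrt e * CFC.sqrt e) * CFC.sqrt e := by rw [hs]
        _ = (CFC.sqrt e * CFC.sqrt e) * (CFC.sqrt e * CFC.sqrt e) := by simp only [mul_assoc]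
        _ = e * e := by rw [hs]
    rw [h6] at this
    exact this.trans (by
      calc ‖e‖ • e ≤ (1 : ℝ) • e := smul_le_smul_of_nonneg_right h3 h2
        _ = e := one_smul _ _)
  have h6 : ‖φ (e * e)‖ ≤ ‖φ e‖ := by
    refine CStarAlgebra.norm_le_norm_of_nonneg_of_le (hφ _ ?_) ?_
    · simpa [(IsSelfAdjoint.of_nonneg h2).star_eq] using star_mul_self_nonneg e
    · have := hφ _ (sub_nonneg.2 h5)
      rwa [map_sub, sub_nonneg] at this
  have h7 : ‖φ (star x * x)‖ ≤ ‖φ‖ := by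
    refine (φ.le_opNorm _).trans ?_
    rw [CStarRing.norm_star_mul_self]
    exact mul_le_of_le_one_right (norm_nonneg _) (by nlinarith [norm_nonneg x])
  have h8 : c * ‖φ‖ < ‖φ (e * x)‖ ^ 2 := by
    have := (Real.sqrt_lt' (lt_of_le_of_lt (Real.sqrt_nonneg _) h1)).1 h1
    exact this
  have h9 : c * ‖φ‖ < ‖φ e‖ * ‖φ‖ :=
    h8.trans_le (h4.trans (mul_le_mul h6 h7 (norm_nonneg _) (norm_nonneg _)))
  exact lt_of_mul_lt_mul_right h9 hφ0.le

end Functionals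

section Morphisms

variable {A B C D : Type*}
  [NonUnitalCStarAlgebra A] [PartialOrder A] [StarOrderedRing A]
  [NonUnitalCStarAlgebra B] [PartialOrder B] [StarOrderedRing B]
  [NonUnitalCStarAlgebra C] [PartialOrder C] [StarOrderedRing C]
  [NonUnitalCStarAlgebra D] [PartialOrder D] [StarOrderedRing D]

/-- `f ∈ Mor(A, B)`: the ⋆-homomorphism `f : A → M(B)` is nondegenerate, i.e. `f(A)B` is linearly
dense in `B`. -/
def IsMor (f : A →⋆ₙₐ[ℂ] 𝓜(ℂ, B)) : Prop :=
  Dense (Submodule.span ℂ {y : B | ∃ a b, y = (f a).fst b} : Set B)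

/-- `n ∈ M(B)` is the value at `m ∈ M(A)` of the canonical extension of the morphism
`f ∈ Mor(A, B)` to `M(A)`, i.e. `n f(a) = f(m a)` for all `a ∈ A`. -/
def IsExtendedValue (f : A →⋆ₙₐ[ℂ] 𝓜(ℂ, B)) (m : 𝓜(ℂ, A)) (n : 𝓜(ℂ, B)) : Prop :=
  ∀ a, n * f a = f (m.fst a)

/-- `Φ = f ⊗ g` as a morphism from `A ⊗ B` to `C ⊗ D`, for morphisms `f` from `A` to `C` and `g`
from `B` to `D`. -/
def IsTensorMor (f : A →⋆ₙₐ[ℂ] 𝓜(ℂ, C)) (g : B →⋆ₙₐ[ℂ] 𝓜(ℂ, D))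
    (Φ : MinTensor A B →⋆ₙₐ[ℂ] 𝓜(ℂ, MinTensor C D)) : Prop :=
  ∀ a b c d, (Φ (tmul a b)).fst (tmul c d) = tmul ((f a).fst c) ((g b).fst d)

variable (A) in
/-- The identity morphism of `A`. -/
def idMor : A →⋆ₙₐ[ℂ] 𝓜(ℂ, A) := DoubleCentralizer.coeHom

/-- Coassociativity `(δ ⊗ id) ∘ δ = (id ⊗ δ) ∘ δ`, where `(A ⊗ A) ⊗ A` and `A ⊗ (A ⊗ A)` are
identified by the canonical isomorphism `α`, and where the morphisms `Φ = δ ⊗ id` and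
`Ψ = id ⊗ δ` are extended to `M(A ⊗ A)`. -/
def IsCoassociative (δ : A →⋆ₙₐ[ℂ] 𝓜(ℂ, MinTensor A A)) : Prop :=
  ∃ (Φ : MinTensor A A →⋆ₙₐ[ℂ] 𝓜(ℂ, MinTensor (MinTensor A A) A))
    (Ψ : MinTensor A A →⋆ₙₐ[ℂ] 𝓜(ℂ, MinTensor A (MinTensor A A)))
    (α : MinTensor (MinTensor A A) A ≃⋆ₐ[ℂ] MinTensor A (MinTensor A A)),
    IsTensorMor δ (idMor A) Φ ∧ IsTensorMor (idMor A) δ Ψ ∧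
    (∀ a b c, α (tmul (tmul a b) c) = tmul a (tmul b c)) ∧
    ∀ a, ∃ m n, IsExtendedValue Φ (δ a) m ∧ IsExtendedValue Ψ (δ a) n ∧
      ∀ t, α (m.fst t) = n.fst (α t)

/-- `(A, δ)` is a C⋆-bialgebra: `δ ∈ Mor(A, A ⊗ A)` is coassociative. -/
structure IsCStarBialgebra (δ : A →⋆ₙₐ[ℂ] 𝓜(ℂ, MinTensor A A)) : Prop where
  isMor : IsMor δ
  coassociative : IsCoassociative δ

/-- `(A, δ)` is proper: `δ(a)(1 ⊗ b)` and `(b ⊗ 1)δ(a)` belong to `A ⊗ A`. -/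
def IsProper (δ : A →⋆ₙₐ[ℂ] 𝓜(ℂ, MinTensor A A)) : Prop :=
  ∀ a b : A, (∃ t : MinTensor A A, (t : 𝓜(ℂ, MinTensor A A)) = δ a * oneTmul A b) ∧
    (∃ t : MinTensor A A, (t : 𝓜(ℂ, MinTensor A A)) = tmulOne A b * δ a)

/-- The cancellation property: the `δ(a)(1 ⊗ b)` are linearly dense in `A ⊗ A`, and so are the
`(b ⊗ 1)δ(a)`. -/
def HasCancellation (δ : A →⋆ₙₐ[ℂ] 𝓜(ℂ, MinTensor A A)) : Prop :=
  Dense (Submodule.span ℂ {t : MinTensor A A | ∃ a b : A,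
    (t : 𝓜(ℂ, MinTensor A A)) = δ a * oneTmul A b} : Set (MinTensor A A)) ∧
  Dense (Submodule.span ℂ {t : MinTensor A A | ∃ a b : A,
    (t : 𝓜(ℂ, MinTensor A A)) = tmulOne A b * δ a} : Set (MinTensor A A))

/-- `S` is the slice map `id ⊗ φ : A ⊗ B → A`. -/
def IsSlice (φ : StrongDual ℂ B) (S : MinTensor A B →L[ℂ] A) : Prop :=
  ∀ a b, S (tmul a b) = φ b • a

/-- `n = (id ⊗ φ)(m)` for the strictly continuous extension of the slice map `id ⊗ φ` to a map
from `M(A ⊗ B)` to `M(A)`: one has `n x = lim (id ⊗ φ)(m (x ⊗ e))` for `x ∈ A`, where `e` runs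
over the approximate unit of `B`. -/
def IsMultiplierSlice (φ : StrongDual ℂ B) (m : 𝓜(ℂ, MinTensor A B)) (n : 𝓜(ℂ, A)) : Prop :=
  ∃ S : MinTensor A B →L[ℂ] A, IsSlice φ S ∧ ∀ x : A,
    Tendsto (fun e => S (m.fst (tmul x e))) (CStarAlgebra.approximateUnit B) (𝓝 (n.fst x))

/-- `c = φ * a`, i.e. `c ∈ A` and `c = (id ⊗ φ)(δ(a))`. -/
def IsConv (δ : A →⋆ₙₐ[ℂ] 𝓜(ℂ, MinTensor A A)) (φ : StrongDual ℂ A) (a c : A) : Prop :=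
  IsMultiplierSlice φ (δ a) (c : 𝓜(ℂ, A))

/-- The convolution product `φ * a = (id ⊗ φ)(δ(a))`. -/
def conv (δ : A →⋆ₙₐ[ℂ] 𝓜(ℂ, MinTensor A A)) (φ : StrongDual ℂ A) (a : A) : A :=
  Classical.epsilon (IsConv δ φ a)

/-- `h` is right invariant: `h(φ * a) = φ(1) h(a)` for all `a ∈ A₊` with `h(a) < ∞` and all
`φ ∈ A*₊`; here `φ(1) = ‖φ‖`. -/
def CStarWeight.IsRightInvariant (h : CStarWeight A)
    (δ : A →⋆ₙₐ[ℂ] 𝓜(ℂ, MinTensor A A)) : Prop :=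
  ∀ a, 0 ≤ a → h a < ∞ → ∀ φ : StrongDual ℂ A, IsPositiveFunctional φ →
    h (conv δ φ a) = ENNReal.ofReal ‖φ‖ * h a

end Morphisms

section Antipode

variable {A : Type*} [NonUnitalCStarAlgebra A]

/-- `τ` is a pointwise norm continuous one-parameter group of automorphisms of `A`. -/
structure IsOneParameterGroup (τ : ℝ → A ≃⋆ₐ[ℂ] A) : Prop where
  map_zero : ∀ a, τ 0 a = a
  map_add : ∀ s t a, τ (s + t) a = τ s (τ t a)
  tendsto : ∀ a, Tendsto (fun t => τ t a) (𝓝 0) (𝓝 a)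

/-- `a` is in the domain of `τ_{is}` and `b = τ_{is}(a)` (for `s > 0`): there is a map into `A`,
continuous on the strip `0 ≤ Im z ≤ s` and holomorphic in its interior, with value `τ_t(a)` at all
real `t` and value `b` at `is`. -/
def IsAnalyticValue (τ : ℝ → A ≃⋆ₐ[ℂ] A) (s : ℝ) (a b : A) : Prop :=
  ∃ F : ℂ → A, ContinuousOn F {z | 0 ≤ z.im ∧ z.im ≤ s} ∧
    DifferentiableOn ℂ F {z | 0 < z.im ∧ z.im < s} ∧
    (∀ t : ℝ, F t = τ t a) ∧ F (s * Complex.I) = b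

/-- `R` is an involutive antiautomorphism of the C⋆-algebra `A`. -/
structure IsInvolutiveAntiautomorphism (R : A →ₗ[ℂ] A) : Prop where
  map_mul : ∀ a b, R (a * b) = R b * R a
  map_star : ∀ a, R (star a) = star (R a)
  involutive : ∀ a, R (R a) = a

/-- The polar decomposition `κ = R ∘ τ_{i/2}`, where `R` is an involutive antiautomorphism of `A`
commuting with all automorphisms of the one-parameter group `τ`. -/
structure IsPolarDecomposition (κ : A →ₗ.[ℂ] A) (R : A →ₗ[ℂ] A) (τ : ℝ → A ≃⋆ₐ[ℂ] A) :
    Prop where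
  group : IsOneParameterGroup τ
  antiautomorphism : IsInvolutiveAntiautomorphism R
  commute : ∀ t a, R (τ t a) = τ t (R a)
  graph : ∀ a c, (a, c) ∈ κ.graph ↔ ∃ b, IsAnalyticValue τ (1 / 2) a b ∧ c = R b

/-- `φ ∘ κ ∈ A*`, and `ψ = φ ∘ κ`. -/
def IsCompAntipode (κ : A →ₗ.[ℂ] A) (φ ψ : StrongDual ℂ A) : Prop :=
  ∀ a : κ.domain, ψ a = φ (κ a)

end Antipode

section Main

variable {A : Type*} [NonUnitalCStarAlgebra A] [PartialOrder A] [StarOrderedRing A]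
  (δ : A →⋆ₙₐ[ℂ] 𝓜(ℂ, MinTensor A A)) (h : CStarWeight A)

/-- `h` is relatively invariant under `τ`: `h ∘ τ_t = λ^t h` on `A₊`, for some `λ > 0`. -/
def CStarWeight.IsRelativelyInvariant (h : CStarWeight A) (τ : ℝ → A ≃⋆ₐ[ℂ] A) : Prop :=
  ∃ l : ℝ, 0 < l ∧ ∀ (t : ℝ) (a : A), 0 ≤ a → h (τ t a) = ENNReal.ofReal (l ^ t) * h a

/-- `T` is the bounded operator `W_φ` on the GNS space of `h`: `W_φ η(a) = η(φ * a)` for all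
`a ∈ 𝔑_h` (in particular `φ * a ∈ 𝔑_h`). -/
def IsConvOp (φ : StrongDual ℂ A) (T : h.GNS →L[ℂ] h.GNS) : Prop :=
  ∀ a : h.nIdeal, ∃ ha : conv δ φ a ∈ h.nIdeal, T (h.eta a) = h.eta ⟨conv δ φ a, ha⟩

/-- The bounded operator `W_φ`. -/
def convOp (φ : StrongDual ℂ A) : h.GNS →L[ℂ] h.GNS := Classical.epsilon (IsConvOp δ h φ)

/-- `w ∈ A` is the matrix element `W(x, y)`: `φ(w) = (x|W_φ y)` for all `φ ∈ A*`. -/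
def IsMatrixElement (x y : h.GNS) (w : A) : Prop :=
  ∀ φ : StrongDual ℂ A, φ w = inner ℂ x (convOp δ h φ y)

/-- The matrix element `W(x, y) ∈ A`. -/
def matrixElement (x y : h.GNS) : A := Classical.epsilon (IsMatrixElement δ h x y)

/-- Strong right invariance: `h((φ * a⋆) b) = h(a⋆ ((φ ∘ κ) * b))` for all `a, b ∈ 𝔑_h` and all
`φ ∈ A*` with `φ ∘ κ ∈ A*`.  The two arguments of `h` lie in `𝔐_h`. -/
def StrongRightInvariance (κ : A →ₗ.[ℂ] A) : Prop :=
  ∀ φ ψ : StrongDual ℂ A, IsCompAntipode κ φ ψ → ∀ a ∈ h.nIdeal, ∀ b ∈ h.nIdeal,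
    ∃ (h₁ : conv δ φ (star a) * b ∈ h.mSpan) (h₂ : star a * conv δ ψ b ∈ h.mSpan),
      h.ext ⟨_, h₁⟩ = h.ext ⟨_, h₂⟩

end Main

end QG

end

noncomputable section

set_option linter.unusedSectionVars false

namespace QG

section Functionals

variable {A : Type*} [NonUnitalCStarAlgebra A] [PartialOrder A] [StarOrderedRing A]

/-- Every bounded functional is dominated on `A₊` by a bounded positive real functional. -/
theorem exists_real_dominating (φ : StrongDual ℂ A) :
    ∃ F : A →ₗ[ℝ] ℝ, (∀ x, |F x| ≤ ‖φ‖ * ‖x‖) ∧ ∀ a, 0 ≤ a → 0 ≤ F a ∧ (φ a).re ≤ F a := by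
  let s : PointedCone ℝ (A × ℝ) :=
    { carrier := {p | ∃ b y : A, 0 ≤ y ∧ p.1 ≤ b - y ∧ ‖φ‖ * ‖b‖ - (φ y).re ≤ p.2}
      zero_mem' := ⟨0, 0, le_rfl, by simp, by simp⟩
      add_mem' := by
        rintro p q ⟨b, y, hy, h1, h2⟩ ⟨b', y', hy', h1', h2'⟩
        refine ⟨b + b', y + y', add_nonneg hy hy', ?_, ?_⟩
        · have := add_le_add h1 h1'
          rwa [sub_add_sub_comm] at this
        · have := norm_add_le b b'
          have h3 := mul_le_mul_of_nonneg_left this (norm_nonneg φ)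
          simp only [map_add, Complex.add_re, Prod.snd_add]
          linarith
      smul_mem' := by
        rintro ⟨c, hc⟩ p ⟨b, y, hy, h1, h2⟩
        refine ⟨c • b, c • y, smul_nonneg hc hy, ?_, ?_⟩
        · rw [← smul_sub]
          exact smul_le_smul_of_nonneg_left h1 hc
        · have h3 : φ (c • y) = c • φ y := by
            rw [← Complex.coe_smul, map_smul, Complex.coe_smul]
          rw [norm_smul, h3, Real.norm_of_nonneg hc, Complex.smul_re, smul_eq_mul]
          have := mul_le_mul_of_nonneg_left h2 hc
          change _ ≤ c * p.2
          linarith }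
  let f : (A × ℝ) →ₗ.[ℝ] ℝ :=
    ⟨LinearMap.range (LinearMap.inr ℝ A ℝ), (LinearMap.snd ℝ A ℝ).domRestrict _⟩
  obtain ⟨g, hg1, hg2⟩ := riesz_extension s f (by
    rintro ⟨_, r, rfl⟩ ⟨b, y, hy, h1, h2⟩
    have h1' : y ≤ b := sub_nonneg.1 h1
    have h3 : (φ y).re ≤ ‖φ‖ * ‖b‖ :=
      (Complex.re_le_norm _).trans ((φ.le_opNorm y).trans (by
        gcongr
        exact CStarAlgebra.norm_le_norm_of_nonneg_of_le hy h1'))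
    change 0 ≤ r
    exact (sub_nonneg.2 h3).trans h2) (by
    rintro ⟨x, t⟩
    refine ⟨⟨(0, ‖φ‖ * ‖x‖ - t), ⟨_, rfl⟩⟩, x, 0, le_rfl, by simp, by simp⟩)
  have hg : ∀ x r, g (x, r) = r + g (x, 0) := by
    intro x r
    have : ((x, r) : A × ℝ) = (0, r) + (x, 0) := by simp
    rw [this, map_add]
    congr 1
    exact hg1 ⟨(0, r), ⟨r, rfl⟩⟩
  have hF : ∀ x r, (x, r) ∈ s → -(g (x, 0)) ≤ r := by
    intro x r hs
    have := hg2 _ hs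
    rw [hg] at this
    linarith
  have hx : ∀ x, -(g (x, 0)) ≤ ‖φ‖ * ‖x‖ := fun x => hF x _ ⟨x, 0, le_rfl, by simp, by simp⟩
  have hneg : ∀ x, g (-x, 0) = -g (x, 0) := fun x => by
    rw [← map_neg, Prod.neg_mk, neg_zero]
  refine ⟨-(g.comp (LinearMap.inl ℝ A ℝ)), fun x => abs_le.2 ⟨?_, hx x⟩, fun a ha => ⟨?_, ?_⟩⟩
  · have := hx (-x)
    rw [hneg, norm_neg] at this
    change _ ≤ -(g (x, 0))
    linarith
  · have := hF (-a) 0 ⟨0, 0, le_rfl, by simpa using ha, by simp⟩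
    rw [hneg] at this
    change _ ≤ -(g (a, 0))
    linarith
  · have := hF (-a) (-(φ a).re) ⟨0, a, ha, by simp, by simp⟩
    rw [hneg] at this
    change _ ≤ -(g (a, 0))
    linarith

@[simp]
theorem starFunctional_apply (φ : StrongDual ℂ A) (a : A) :
    starFunctional φ a = starRingEnd ℂ (φ (star a)) := rfl

theorem norm_starFunctional_le (φ : StrongDual ℂ A) : ‖starFunctional φ‖ ≤ ‖φ‖ :=
  ContinuousLinearMap.opNorm_le_bound _ (norm_nonneg _) fun a => by
    rw [starFunctional_apply, RCLike.norm_conj]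
    simpa using φ.le_opNorm (star a)

/-- The selfadjoint part of a functional. -/
def selfAdjointPart (φ : StrongDual ℂ A) : StrongDual ℂ A := (1 / 2 : ℂ) • (φ + starFunctional φ)

theorem norm_selfAdjointPart_le (φ : StrongDual ℂ A) : ‖selfAdjointPart φ‖ ≤ ‖φ‖ := by
  have h1 := norm_add_le φ (starFunctional φ)
  have h2 := norm_starFunctional_le φ
  rw [selfAdjointPart, norm_smul]
  norm_num
  linarith

theorem selfAdjointPart_apply (φ : StrongDual ℂ A) {a : A} (ha : IsSelfAdjoint a) :
    selfAdjointPart φ a = (((φ a).re : ℝ) : ℂ) := by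
  simp only [selfAdjointPart, smul_apply, add_apply,
    starFunctional_apply, ha.star_eq, Complex.add_conj, smul_eq_mul]
  push_cast
  ring

/-- A bounded real functional that is positive on `A₊` defines a positive functional. -/
theorem exists_positive_of_real (F : A →ₗ[ℝ] ℝ) {C : ℝ} (hC : 0 ≤ C) (hF : ∀ x, |F x| ≤ C * ‖x‖)
    (hpos : ∀ a, 0 ≤ a → 0 ≤ F a) :
    ∃ f : StrongDual ℂ A, IsPositiveFunctional f ∧ ‖f‖ ≤ C ∧
      ∀ a, IsSelfAdjoint a → f a = ((F a : ℝ) : ℂ) := by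
  let G : StrongDual ℝ A := F.mkContinuous C hF
  let g : StrongDual ℂ A := StrongDual.extendRCLike G
  have hg : ‖g‖ ≤ C := by
    rw [StrongDual.norm_extendRCLike]
    exact F.mkContinuous_norm_le hC hF
  have hre : ∀ a, (g a).re = F a := fun a => Module.Dual.re_extendRCLike_apply (𝕜 := ℂ) F a
  refine ⟨selfAdjointPart g, fun a ha => ?_, (norm_selfAdjointPart_le g).trans hg, fun a ha => ?_⟩
  · rw [selfAdjointPart_apply g (IsSelfAdjoint.of_nonneg ha), hre]
    exact_mod_cast hpos a ha
  · rw [selfAdjointPart_apply g ha, hre]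

theorem exists_positive_sub (φ : StrongDual ℂ A) :
    ∃ f g : StrongDual ℂ A, IsPositiveFunctional f ∧ IsPositiveFunctional g ∧
      ‖f‖ ≤ ‖φ‖ ∧ ‖g‖ ≤ 2 * ‖φ‖ ∧ selfAdjointPart φ = f - g := by
  obtain ⟨F, h1, h2⟩ := exists_real_dominating φ
  obtain ⟨f, hf, hfn, hfF⟩ := exists_positive_of_real F (norm_nonneg φ) h1 fun a ha => (h2 a ha).1
  refine ⟨f, f - selfAdjointPart φ, hf, fun a ha => ?_, hfn, ?_, by simp⟩
  · have hs := IsSelfAdjoint.of_nonneg ha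
    rw [sub_apply, selfAdjointPart_apply φ hs, hfF a hs, sub_nonneg]
    exact_mod_cast (h2 a ha).2
  · have := norm_sub_le f (selfAdjointPart φ)
    have := norm_selfAdjointPart_le φ
    linarith

/-- Every bounded functional is a linear combination of four positive functionals. -/
theorem exists_positive_decomposition (φ : StrongDual ℂ A) :
    ∃ f : Fin 4 → StrongDual ℂ A, ∃ c : Fin 4 → ℂ, (∀ i, IsPositiveFunctional (f i)) ∧
      (∀ i, ‖f i‖ ≤ 2 * ‖φ‖) ∧ (∀ i, ‖c i‖ = 1) ∧ φ = ∑ i, c i • f i := by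
  obtain ⟨f₀, f₁, h0, h1, n0, n1, h01⟩ := exists_positive_sub φ
  obtain ⟨f₂, f₃, h2, h3, n2, n3, h23⟩ := exists_positive_sub (-Complex.I • φ)
  have hn : ‖-Complex.I • φ‖ = ‖φ‖ := by rw [norm_smul]; simp
  rw [hn] at n2 n3
  have hp := norm_nonneg φ
  refine ⟨![f₀, f₁, f₂, f₃], ![1, -1, Complex.I, -Complex.I], ?_, ?_, ?_, ?_⟩
  · intro i; fin_cases i <;> assumption
  · intro i; fin_cases i
    · change ‖f₀‖ ≤ _; linarith
    · exact n1
    · change ‖f₂‖ ≤ _; linarith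
    · exact n3
  · intro i; fin_cases i <;> simp
  · have h4 : φ = selfAdjointPart φ + Complex.I • selfAdjointPart (-Complex.I • φ) := by
      ext a
      simp only [selfAdjointPart, add_apply, smul_apply,
        starFunctional_apply, smul_eq_mul, map_mul, map_neg, Complex.conj_I]
      ring_nf
      rw [Complex.I_sq]
      ring
    rw [h4, h01, h23]
    simp only [Fin.sum_univ_four, Matrix.cons_val]
    module

/-- A property of functionals that holds for the positive ones and is stable under linear
combinations holds for all functionals. -/
theorem functional_induction {p : StrongDual ℂ A → Prop} (φ : StrongDual ℂ A)
    (hpos : ∀ f, IsPositiveFunctional f → p f) (hadd : ∀ f g, p f → p g → p (f + g))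
    (hsmul : ∀ (c : ℂ) f, p f → p (c • f)) : p φ := by
  obtain ⟨f, c, hf, -, -, rfl⟩ := exists_positive_decomposition φ
  rw [Fin.sum_univ_four]
  exact hadd _ _ (hadd _ _ (hadd _ _ (hsmul _ _ (hpos _ (hf 0))) (hsmul _ _ (hpos _ (hf 1))))
    (hsmul _ _ (hpos _ (hf 2)))) (hsmul _ _ (hpos _ (hf 3)))

/-- A bounded positive functional as a bundled positive linear map. -/
def IsPositiveFunctional.toPositiveLinearMap {φ : StrongDual ℂ A} (hφ : IsPositiveFunctional φ) :
    A →ₚ[ℂ] ℂ := PositiveLinearMap.mk₀ φ.toLinearMap hφ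

@[simp]
theorem IsPositiveFunctional.toPositiveLinearMap_apply {φ : StrongDual ℂ A}
    (hφ : IsPositiveFunctional φ) (a : A) : hφ.toPositiveLinearMap a = φ a := rfl

theorem IsPositiveFunctional.cauchy_schwarz {φ : StrongDual ℂ A} (hφ : IsPositiveFunctional φ)
    (x y : A) : ‖φ (star x * y)‖ ^ 2 ≤ ‖φ (star x * x)‖ * ‖φ (star y * y)‖ := by
  let f := hφ.toPositiveLinearMap
  have h1 := norm_inner_le_norm (𝕜 := ℂ) (f.toPreGNS x) (f.toPreGNS y)
  have h2 : ∀ z : A, ‖f.toPreGNS z‖ ^ 2 = ‖φ (star z * z)‖ := by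
    intro z
    have := congrArg norm (f.preGNS_norm_sq (f.toPreGNS z))
    simpa [f] using this
  rw [← h2, ← h2, ← mul_pow]
  exact pow_le_pow_left₀ (norm_nonneg _) h1 2

theorem IsPositiveFunctional.norm_sq_le {φ : StrongDual ℂ A} (hφ : IsPositiveFunctional φ)
    (b : A) : ‖φ b‖ ^ 2 ≤ ‖φ‖ * ‖φ (star b * b)‖ := by
  have hl := CStarAlgebra.increasingApproximateUnit A
  have hlim : Tendsto (fun e => ‖φ (e * b)‖ ^ 2) (CStarAlgebra.approximateUnit A) (𝓝 (‖φ b‖ ^ 2)) :=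
    (((φ.continuous.norm).tendsto b).comp (hl.tendsto_mul_right b)).pow 2
  refine le_of_tendsto hlim ?_
  filter_upwards [hl.eventually_star_eq, hl.eventually_norm] with e he hn
  have := hφ.cauchy_schwarz e b
  rw [he] at this
  refine this.trans (mul_le_mul_of_nonneg_right ?_ (norm_nonneg _))
  refine (φ.le_opNorm _).trans (mul_le_of_le_one_right (norm_nonneg _) ?_)
  exact (norm_mul_le _ _).trans (mul_le_one₀ hn (norm_nonneg _) hn)

theorem IsPositiveFunctional.apply_eq_re {φ : StrongDual ℂ A} (hφ : IsPositiveFunctional φ)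
    {a : A} (ha : 0 ≤ a) : φ a = (((φ a).re : ℝ) : ℂ) := by
  have := hφ a ha
  rw [Complex.le_def] at this
  exact Complex.ext rfl (by simpa using this.2.symm)

theorem IsPositiveFunctional.norm_apply_eq_re {φ : StrongDual ℂ A} (hφ : IsPositiveFunctional φ)
    {a : A} (ha : 0 ≤ a) : ‖φ a‖ = (φ a).re := by
  have h1 := hφ a ha
  rw [Complex.le_def] at h1
  rw [hφ.apply_eq_re ha, Complex.norm_of_nonneg (by simpa using h1.1)]
  simp

/-- The functional `c ↦ φ(c b)`. -/
def dualMulRight (φ : StrongDual ℂ A) (b : A) : StrongDual ℂ A :=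
  φ.comp ((ContinuousLinearMap.mul ℂ A).flip b)

/-- The functional `c ↦ φ(b c)`. -/
def dualMulLeft (φ : StrongDual ℂ A) (b : A) : StrongDual ℂ A :=
  φ.comp (ContinuousLinearMap.mul ℂ A b)

@[simp]
theorem dualMulRight_apply (φ : StrongDual ℂ A) (b c : A) : dualMulRight φ b c = φ (c * b) := rfl

@[simp]
theorem dualMulLeft_apply (φ : StrongDual ℂ A) (b c : A) : dualMulLeft φ b c = φ (b * c) := rfl

theorem IsPositiveFunctional.norm_sub_dualMulRight_sq_le {φ : StrongDual ℂ A}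
    (hφ : IsPositiveFunctional φ) {e : A} (he : 0 ≤ e) (hn : ‖e‖ ≤ 1) (c : A) :
    ‖φ c - φ (c * e)‖ ^ 2 ≤ ‖φ‖ * ‖c‖ ^ 2 * (2 * ‖φ‖ - 2 * (φ e).re) := by
  have hl := CStarAlgebra.increasingApproximateUnit A
  have hes : star e = e := (IsSelfAdjoint.of_nonneg he).star_eq
  have hre : Continuous fun x : A => (φ x).re := Complex.continuous_re.comp φ.continuous
  have hsq : ∀ x : A, ‖x‖ ≤ 1 → (φ (x * x)).re ≤ ‖φ‖ := fun x hx =>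
    (Complex.re_le_norm _).trans ((φ.le_opNorm _).trans (mul_le_of_le_one_right (norm_nonneg _)
      ((norm_mul_le _ _).trans (mul_le_one₀ hx (norm_nonneg _) hx))))
  have lim1 : Tendsto (fun u => ‖φ (c * u) - φ (c * e)‖ ^ 2) (CStarAlgebra.approximateUnit A)
      (𝓝 (‖φ c - φ (c * e)‖ ^ 2)) :=
    ((((φ.continuous.tendsto c).comp (hl.tendsto_mul_left c)).sub_const _).norm).pow 2
  have lim2 : Tendsto (fun u => ‖φ‖ * ‖c‖ ^ 2 *
      (2 * ‖φ‖ - (φ (e * u)).re - (φ (u * e)).re)) (CStarAlgebra.approximateUnit A)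
      (𝓝 (‖φ‖ * ‖c‖ ^ 2 * (2 * ‖φ‖ - (φ e).re - (φ e).re))) :=
    ((((hre.tendsto e).comp (hl.tendsto_mul_left e)).const_sub _).sub
      ((hre.tendsto e).comp (hl.tendsto_mul_right e))).const_mul _
  have := le_of_tendsto_of_tendsto lim1 lim2 (by
    filter_upwards [hl.eventually_star_eq, hl.eventually_norm] with u hu hun
    have h1 := hφ.cauchy_schwarz (star c) (u - e)
    have hpos : (0 : A) ≤ star (u - e) * (u - e) := star_mul_self_nonneg _
    rw [star_star, mul_sub, map_sub] at h1
    refine h1.trans (mul_le_mul ?_ ?_ (norm_nonneg _) (by positivity))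
    · refine (φ.le_opNorm _).trans (mul_le_mul_of_nonneg_left ?_ (norm_nonneg _))
      rw [CStarRing.norm_self_mul_star, sq]
    · rw [hφ.norm_apply_eq_re hpos, star_sub, hu, hes, mul_sub, sub_mul, sub_mul]
      simp only [map_sub, Complex.sub_re]
      have := hsq u hun
      have := hsq e hn
      linarith)
  refine this.trans (le_of_eq ?_)
  ring

theorem tendsto_dualMulRight (φ : StrongDual ℂ A) :
    Tendsto (dualMulRight φ) (CStarAlgebra.approximateUnit A) (𝓝 φ) := by
  induction φ using functional_induction with
  | hpos φ hφ =>
    have hl := CStarAlgebra.increasingApproximateUnit A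
    rw [tendsto_iff_norm_sub_tendsto_zero]
    have h1 : Tendsto (fun e => √(‖φ‖ * (2 * ‖φ‖ - 2 * (φ e).re)))
        (CStarAlgebra.approximateUnit A) (𝓝 0) := by
      have h2 := ((Complex.continuous_re.tendsto _).comp (tendsto_approximateUnit_norm φ hφ))
      have h3 := ((h2.const_mul 2).const_sub (2 * ‖φ‖)).const_mul ‖φ‖
      have h4 := (Real.continuous_sqrt.tendsto _).comp h3
      simpa only [Function.comp_def, sub_self, mul_zero, Real.sqrt_zero, Complex.ofReal_re] using h4
    refine squeeze_zero' (.of_forall fun e => norm_nonneg _) ?_ h1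
    filter_upwards [hl.eventually_nonneg, hl.eventually_norm] with e he hn
    refine ContinuousLinearMap.opNorm_le_bound _ (Real.sqrt_nonneg _) fun c => ?_
    rw [sub_apply, dualMulRight_apply, norm_sub_rev]
    have h2 := hφ.norm_sub_dualMulRight_sq_le he hn c
    have h3 : ‖φ c - φ (c * e)‖ ≤ √(‖φ‖ * ‖c‖ ^ 2 * (2 * ‖φ‖ - 2 * (φ e).re)) :=
      Real.le_sqrt_of_sq_le h2
    rw [mul_right_comm, Real.sqrt_mul' _ (sq_nonneg _), Real.sqrt_sq (norm_nonneg _)] at h3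
    exact h3
  | hadd f g hf hg => exact hf.add hg
  | hsmul c f hf => exact hf.const_smul c

theorem tendsto_dualMulLeft (φ : StrongDual ℂ A) :
    Tendsto (dualMulLeft φ) (CStarAlgebra.approximateUnit A) (𝓝 φ) := by
  have hl := CStarAlgebra.increasingApproximateUnit A
  have h1 := tendsto_dualMulRight (starFunctional φ)
  rw [tendsto_iff_norm_sub_tendsto_zero] at h1 ⊢
  refine squeeze_zero' (.of_forall fun e => norm_nonneg _) ?_ h1
  filter_upwards [hl.eventually_star_eq] with e he
  have h2 : dualMulLeft φ e - φ =
      starFunctional (dualMulRight (starFunctional φ) e - starFunctional φ) := by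
    ext c
    simp [he]
  rw [h2]
  exact norm_starFunctional_le _

end Functionals

end QG

namespace QG

section Duality

theorem exists_vector_of_bounded {E : Type*} [SeminormedAddCommGroup E] [InnerProductSpace ℂ E]
    (L : E →ₗ[ℂ] ℂ) {C : ℝ} (hC : 0 ≤ C) (hL : ∀ x, ‖L x‖ ≤ C * ‖x‖) :
    ∃ ξ : UniformSpace.Completion E, ‖ξ‖ ≤ C ∧
      ∀ x : E, inner ℂ ξ (x : UniformSpace.Completion E) = L x := by
  let f : E →L[ℂ] ℂ := L.mkContinuous C hL
  have hd : DenseRange (UniformSpace.Completion.toComplL : E →L[ℂ] UniformSpace.Completion E) :=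
    UniformSpace.Completion.denseRange_coe
  have hu : IsUniformInducing
      (UniformSpace.Completion.toComplL : E →L[ℂ] UniformSpace.Completion E) :=
    UniformSpace.Completion.isUniformInducing_coe E
  let g : UniformSpace.Completion E →L[ℂ] ℂ := f.extend UniformSpace.Completion.toComplL
  have hg : ∀ x : E, g (x : UniformSpace.Completion E) = L x := fun x =>
    ContinuousLinearMap.extend_eq f hd hu x
  refine ⟨(InnerProductSpace.toDual ℂ _).symm g, ?_, fun x => ?_⟩
  · rw [LinearIsometryEquiv.norm_map]
    refine ContinuousLinearMap.opNorm_le_bound _ hC fun x => ?_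
    induction x using UniformSpace.Completion.induction_on with
    | hp => exact isClosed_le (by fun_prop) (by fun_prop)
    | ih x =>
      rw [hg, UniformSpace.Completion.norm_coe]
      exact hL x
  · rw [InnerProductSpace.toDual_symm_apply, hg]

variable {X E : Type*} [NormedAddCommGroup X] [NormedSpace ℂ X] [NormedAddCommGroup E]
  [NormedSpace ℂ E] [CompleteSpace E]

theorem isClosed_range_inclusionInDoubleDual :
    IsClosed (Set.range (NormedSpace.inclusionInDoubleDual ℂ E)) :=
  (NormedSpace.inclusionInDoubleDualLi (E := E) ℂ).isometry.isUniformInducing.isComplete_range.isClosed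

theorem exists_of_mem_closure_span (G : X →L[ℂ] StrongDual ℂ (StrongDual ℂ E)) (D : Set X)
    (hD : Dense (Submodule.span ℂ D : Set X))
    (hex : ∀ d ∈ D, ∃ y : E, ∀ ψ : StrongDual ℂ E, ψ y = G d ψ) (x : X) :
    ∃ y : E, ∀ ψ : StrongDual ℂ E, ψ y = G x ψ := by
  let J := NormedSpace.inclusionInDoubleDual ℂ E
  have hmem : ∀ x ∈ Submodule.span ℂ D, G x ∈ LinearMap.range J.toLinearMap := by
    intro x hx
    have : Submodule.span ℂ D ≤ (LinearMap.range J.toLinearMap).comap G.toLinearMap := by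
      refine Submodule.span_le.2 fun d hd => ?_
      obtain ⟨y, hy⟩ := hex d hd
      exact ⟨y, ContinuousLinearMap.ext hy⟩
    exact this hx
  have : G x ∈ Set.range J := by
    have h1 : IsClosed (G ⁻¹' Set.range J) :=
      isClosed_range_inclusionInDoubleDual.preimage G.continuous
    exact h1.closure_subset_iff.2 (fun z hz => hmem z hz) (hD x)
  obtain ⟨y, hy⟩ := this
  exact ⟨y, fun ψ => by rw [← hy]; rfl⟩

theorem exists_clm_of_dense (F : StrongDual ℂ E → StrongDual ℂ X) {C : ℝ} (hC : 0 ≤ C)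
    (hadd : ∀ φ ψ, F (φ + ψ) = F φ + F ψ) (hsmul : ∀ (c : ℂ) φ, F (c • φ) = c • F φ)
    (hF : ∀ φ, ‖F φ‖ ≤ C * ‖φ‖) (D : Set X) (hD : Dense (Submodule.span ℂ D : Set X))
    (hex : ∀ d ∈ D, ∃ y : E, ∀ ψ : StrongDual ℂ E, ψ y = F ψ d) :
    ∃ S : X →L[ℂ] E, (∀ ψ : StrongDual ℂ E, ∀ x, ψ (S x) = F ψ x) ∧ ‖S‖ ≤ C := by
  have hb : ∀ x ψ, ‖F ψ x‖ ≤ C * ‖x‖ * ‖ψ‖ := fun x ψ =>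
    ((F ψ).le_of_opNorm_le (hF ψ) x).trans (le_of_eq (by ring))
  let G : X →L[ℂ] StrongDual ℂ (StrongDual ℂ E) :=
    LinearMap.mkContinuous₂ (LinearMap.mk₂ ℂ (fun x ψ => F ψ x) (fun _ _ _ => map_add _ _ _)
      (fun _ _ _ => map_smul _ _ _) (fun _ _ _ => by rw [hadd]; rfl)
      (fun _ _ _ => by rw [hsmul]; rfl)) C hb
  choose s hs using exists_of_mem_closure_span G D hD hex
  have hs' : ∀ x ψ, ψ (s x) = F ψ x := hs
  refine ⟨LinearMap.mkContinuous
    { toFun := s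
      map_add' := fun x y => ?_
      map_smul' := fun c x => ?_ } C fun x => ?_, fun ψ x => hs' x ψ,
    LinearMap.mkContinuous_norm_le _ hC _⟩
  · refine (SeparatingDual.eq_iff_forall_dual_eq (R := ℂ)).2 fun ψ => ?_
    rw [map_add, hs', hs', hs', map_add]
  · refine (SeparatingDual.eq_iff_forall_dual_eq (R := ℂ)).2 fun ψ => ?_
    rw [RingHom.id_apply, map_smul, hs', hs', map_smul]
  · refine NormedSpace.norm_le_dual_bound ℂ _ (by positivity) fun ψ => ?_
    change ‖ψ (s x)‖ ≤ _
    rw [hs']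
    exact hb x ψ

end Duality

section TensorFunctionals

variable {A B : Type*} [NonUnitalCStarAlgebra A] [PartialOrder A] [StarOrderedRing A]
  [NonUnitalCStarAlgebra B] [PartialOrder B] [StarOrderedRing B]

theorem IsPositiveFunctional.exists_cyclic_vector {φ : StrongDual ℂ A}
    (hφ : IsPositiveFunctional φ) :
    ∃ ξ : hφ.toPositiveLinearMap.GNS, ‖ξ‖ ^ 2 ≤ ‖φ‖ ∧
      ∀ a, inner ℂ ξ (hφ.toPositiveLinearMap.gnsNonUnitalStarAlgHom a ξ) = φ a := by
  set f := hφ.toPositiveLinearMap with hf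
  have hn : ∀ x : f.PreGNS, ‖x‖ ^ 2 = ‖φ (star (f.ofPreGNS x) * f.ofPreGNS x)‖ := by
    intro x
    have := congrArg norm (f.preGNS_norm_sq x)
    simpa [hf] using this
  obtain ⟨ξ, hξ, hin⟩ := exists_vector_of_bounded
    (φ.toLinearMap.comp f.ofPreGNS.toLinearMap) (Real.sqrt_nonneg ‖φ‖) (fun x => by
      have h1 : ‖φ (f.ofPreGNS x)‖ ^ 2 ≤ ‖φ‖ * ‖x‖ ^ 2 := by
        rw [hn]
        exact hφ.norm_sq_le _
      have h2 := Real.le_sqrt_of_sq_le h1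
      rwa [Real.sqrt_mul' _ (sq_nonneg _), Real.sqrt_sq (norm_nonneg _)] at h2)
  have hin' : ∀ a : A, inner ℂ ξ ((f.toPreGNS a : f.PreGNS) : f.GNS) = φ a := fun a => hin _
  refine ⟨ξ, ?_, fun a => ?_⟩
  · calc ‖ξ‖ ^ 2 ≤ (√‖φ‖) ^ 2 := pow_le_pow_left₀ (norm_nonneg _) hξ 2
      _ = ‖φ‖ := Real.sq_sqrt (norm_nonneg _)
  · have h1 : f.gnsNonUnitalStarAlgHom a ξ = ((f.toPreGNS a : f.PreGNS) : f.GNS) := by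
      refine ext_inner_left ℂ fun v => ?_
      induction v using UniformSpace.Completion.induction_on with
      | hp => exact isClosed_eq (by fun_prop) (by fun_prop)
      | ih v =>
        rw [← ContinuousLinearMap.adjoint_inner_left, ← ContinuousLinearMap.star_eq_adjoint,
          ← map_star, f.gnsNonUnitalStarAlgHom_apply_coe, ← inner_conj_symm,
          UniformSpace.Completion.inner_coe]
        have h2 := hin' (star a * f.ofPreGNS v)
        rw [show f.leftMulMapPreGNS (star a) v = f.toPreGNS (star a * f.ofPreGNS v) from rfl, h2,
          f.preGNS_inner_def, f.ofPreGNS_toPreGNS]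
        have h3 : star (star a * f.ofPreGNS v) = star (f.ofPreGNS v) * a := by simp
        rw [← h3, map_star]
        rfl
    rw [h1, hin']

/-- The component of an element of `A ⊗ B` on the tensor product of two GNS spaces. -/
def componentCLM (p : (A →ₚ[ℂ] ℂ) × (B →ₚ[ℂ] ℂ)) : MinTensor A B →ₗ[ℂ]
    (HilbertTensor p.1.GNS p.2.GNS →L[ℂ] HilbertTensor p.1.GNS p.2.GNS) where
  toFun t := t.1 p
  map_add' _ _ := rfl
  map_smul' _ _ := rfl

theorem norm_componentCLM_le (p : (A →ₚ[ℂ] ℂ) × (B →ₚ[ℂ] ℂ)) (t : MinTensor A B) :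
    ‖componentCLM p t‖ ≤ ‖t‖ :=
  lp.norm_apply_le_norm ENNReal.top_ne_zero t.1 p

theorem componentCLM_tmul (p : (A →ₚ[ℂ] ℂ) × (B →ₚ[ℂ] ℂ)) (a : A) (b : B) :
    componentCLM p (tmul a b) =
      opTensor (p.1.gnsNonUnitalStarAlgHom a) (p.2.gnsNonUnitalStarAlgHom b) := rfl

theorem inner_opTensor_tmul {E F : Type*} [NormedAddCommGroup E] [InnerProductSpace ℂ E]
    [NormedAddCommGroup F] [InnerProductSpace ℂ F] (S : E →L[ℂ] E) (T : F →L[ℂ] F) (x : E) (y : F) :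
    inner ℂ ((x ⊗ₜ[ℂ] y : E ⊗[ℂ] F) : HilbertTensor E F)
      (opTensor S T ((x ⊗ₜ[ℂ] y : E ⊗[ℂ] F) : HilbertTensor E F)) =
      inner ℂ x (S x) * inner ℂ y (T y) := by
  rw [opTensor_coe, UniformSpace.Completion.inner_coe, TensorProduct.mapL_tmul,
    TensorProduct.inner_tmul]

/-- The vector functional `T ↦ (v|T v)`. -/
def vectorFunctional {E : Type*} [NormedAddCommGroup E] [InnerProductSpace ℂ E] (v : E) :
    (E →L[ℂ] E) →ₗ[ℂ] ℂ where
  toFun T := inner ℂ v (T v)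
  map_add' S T := by rw [add_apply, inner_add_right]
  map_smul' c T := by rw [smul_apply, inner_smul_right]; rfl

theorem norm_vectorFunctional_apply_le {E : Type*} [NormedAddCommGroup E] [InnerProductSpace ℂ E]
    (v : E) (T : E →L[ℂ] E) : ‖vectorFunctional v T‖ ≤ ‖v‖ * ‖v‖ * ‖T‖ :=
  calc ‖inner ℂ v (T v)‖ ≤ ‖v‖ * ‖T v‖ := norm_inner_le_norm _ _
    _ ≤ ‖v‖ * (‖T‖ * ‖v‖) := mul_le_mul_of_nonneg_left (T.le_opNorm v) (norm_nonneg _)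
    _ = ‖v‖ * ‖v‖ * ‖T‖ := by ring

theorem norm_tmul_sq_le {E F : Type*} [NormedAddCommGroup E] [InnerProductSpace ℂ E]
    [NormedAddCommGroup F] [InnerProductSpace ℂ F] {x : E} {y : F} {r s : ℝ}
    (hx : ‖x‖ ^ 2 ≤ r) (hy : ‖y‖ ^ 2 ≤ s) :
    ‖((x ⊗ₜ[ℂ] y : E ⊗[ℂ] F) : HilbertTensor E F)‖ *
      ‖((x ⊗ₜ[ℂ] y : E ⊗[ℂ] F) : HilbertTensor E F)‖ ≤ r * s := by
  rw [UniformSpace.Completion.norm_coe, TensorProduct.norm_tmul]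
  calc _ = ‖x‖ ^ 2 * ‖y‖ ^ 2 := by ring
    _ ≤ _ := mul_le_mul hx hy (sq_nonneg _) ((sq_nonneg _).trans hx)

theorem exists_componentFunctional (p : (A →ₚ[ℂ] ℂ) × (B →ₚ[ℂ] ℂ))
    (v : HilbertTensor p.1.GNS p.2.GNS) :
    ∃ F : StrongDual ℂ (MinTensor A B), (∀ t, F t = vectorFunctional v (componentCLM p t)) ∧
      ‖F‖ ≤ ‖v‖ * ‖v‖ := by
  have hv : 0 ≤ ‖v‖ * ‖v‖ := mul_self_nonneg _
  refine ⟨((vectorFunctional v).comp (componentCLM p)).mkContinuous (‖v‖ * ‖v‖) fun t => ?_,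
    fun t => rfl, LinearMap.mkContinuous_norm_le _ hv _⟩
  exact (norm_vectorFunctional_apply_le v _).trans
    (mul_le_mul_of_nonneg_left (norm_componentCLM_le p t) hv)

theorem exists_gnsTensorFunctional (p : (A →ₚ[ℂ] ℂ) × (B →ₚ[ℂ] ℂ)) (ξ : p.1.GNS) (ζ : p.2.GNS)
    {φ : A → ℂ} {ψ : B → ℂ} {r s : ℝ} (hξ : ‖ξ‖ ^ 2 ≤ r) (hζ : ‖ζ‖ ^ 2 ≤ s)
    (hφ : ∀ a, inner ℂ ξ (p.1.gnsNonUnitalStarAlgHom a ξ) = φ a)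
    (hψ : ∀ b, inner ℂ ζ (p.2.gnsNonUnitalStarAlgHom b ζ) = ψ b) :
    ∃ F : StrongDual ℂ (MinTensor A B), (∀ a b, F (tmul a b) = φ a * ψ b) ∧ ‖F‖ ≤ r * s := by
  obtain ⟨F, hF, hFn⟩ := exists_componentFunctional p
    ((ξ ⊗ₜ[ℂ] ζ : p.1.GNS ⊗[ℂ] p.2.GNS) : HilbertTensor p.1.GNS p.2.GNS)
  refine ⟨F, fun a b => (hF _).trans ?_, hFn.trans (norm_tmul_sq_le hξ hζ)⟩
  rw [componentCLM_tmul, ← hφ, ← hψ]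
  exact inner_opTensor_tmul _ _ _ _

theorem exists_positive_tensorFunctional {φ : StrongDual ℂ A} {ψ : StrongDual ℂ B}
    (hφ : IsPositiveFunctional φ) (hψ : IsPositiveFunctional ψ) :
    ∃ F : StrongDual ℂ (MinTensor A B), (∀ a b, F (tmul a b) = φ a * ψ b) ∧
      ‖F‖ ≤ ‖φ‖ * ‖ψ‖ := by
  obtain ⟨ξ, hξ, hξφ⟩ := hφ.exists_cyclic_vector
  obtain ⟨ζ, hζ, hζψ⟩ := hψ.exists_cyclic_vector
  exact exists_gnsTensorFunctional (hφ.toPositiveLinearMap, hψ.toPositiveLinearMap) ξ ζ hξ hζ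
    hξφ hζψ

theorem minTensor_functional_ext {F G : StrongDual ℂ (MinTensor A B)}
    (hFG : ∀ a b, F (tmul a b) = G (tmul a b)) : F = G :=
  ContinuousLinearMap.ext_on dense_span_tmul (by rintro _ ⟨a, b, rfl⟩; exact hFG a b)

theorem exists_tensorFunctional (φ : StrongDual ℂ A) (ψ : StrongDual ℂ B) :
    ∃ F : StrongDual ℂ (MinTensor A B), (∀ a b, F (tmul a b) = φ a * ψ b) ∧
      ‖F‖ ≤ 64 * ‖φ‖ * ‖ψ‖ := by
  obtain ⟨f, c, hf, hfn, hc, hφ⟩ := exists_positive_decomposition φ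
  obtain ⟨g, d, hg, hgn, hd, hψ⟩ := exists_positive_decomposition ψ
  choose F hF hFn using fun i j => exists_positive_tensorFunctional (hf i) (hg j)
  refine ⟨∑ i, ∑ j, (c i * d j) • F i j, fun a b => ?_, ?_⟩
  · rw [hφ, hψ]
    simp only [sum_apply, smul_apply, hF, smul_eq_mul, Finset.sum_mul_sum]
    exact Finset.sum_congr rfl fun i _ => Finset.sum_congr rfl fun j _ => by ring
  · have hij : ∀ i j, ‖(c i * d j) • F i j‖ ≤ 4 * ‖φ‖ * ‖ψ‖ := by
      intro i j
      rw [norm_smul, norm_mul, hc, hd, one_mul, one_mul]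
      calc ‖F i j‖ ≤ ‖f i‖ * ‖g j‖ := hFn i j
        _ ≤ (2 * ‖φ‖) * (2 * ‖ψ‖) :=
          mul_le_mul (hfn i) (hgn j) (norm_nonneg _) (by positivity)
        _ = _ := by ring
    calc _ ≤ ∑ i : Fin 4, ∑ j : Fin 4, 4 * ‖φ‖ * ‖ψ‖ :=
          norm_sum_le_of_le _ fun i _ => norm_sum_le_of_le _ fun j _ => hij i j
      _ = _ := by simp; ring

/-- The functional `φ ⊗ ψ` on `A ⊗ B`. -/
def tensorFunctional (φ : StrongDual ℂ A) (ψ : StrongDual ℂ B) : StrongDual ℂ (MinTensor A B) :=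
  (exists_tensorFunctional φ ψ).choose

@[simp]
theorem tensorFunctional_tmul (φ : StrongDual ℂ A) (ψ : StrongDual ℂ B) (a : A) (b : B) :
    tensorFunctional φ ψ (tmul a b) = φ a * ψ b :=
  (exists_tensorFunctional φ ψ).choose_spec.1 a b

theorem norm_tensorFunctional_le (φ : StrongDual ℂ A) (ψ : StrongDual ℂ B) :
    ‖tensorFunctional φ ψ‖ ≤ 64 * ‖φ‖ * ‖ψ‖ :=
  (exists_tensorFunctional φ ψ).choose_spec.2

theorem exists_rightSlice (φ : StrongDual ℂ B) : ∃ S : MinTensor A B →L[ℂ] A,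
    (∀ (ψ : StrongDual ℂ A) t, ψ (S t) = tensorFunctional ψ φ t) ∧ ‖S‖ ≤ 64 * ‖φ‖ := by
  refine exists_clm_of_dense (E := A) (fun ψ => tensorFunctional ψ φ) (C := 64 * ‖φ‖) (by positivity) ?_ ?_ ?_ _
    dense_span_tmul ?_
  · exact fun ψ ψ' => minTensor_functional_ext fun a b => by simp [add_mul]
  · exact fun c ψ => minTensor_functional_ext fun a b => by simp [mul_assoc]
  · exact fun ψ => (norm_tensorFunctional_le ψ φ).trans (le_of_eq (by ring))
  · rintro _ ⟨a, b, rfl⟩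
    exact ⟨φ b • a, fun ψ => by simp [mul_comm]⟩

theorem exists_leftSlice (φ : StrongDual ℂ A) : ∃ S : MinTensor A B →L[ℂ] B,
    (∀ (ψ : StrongDual ℂ B) t, ψ (S t) = tensorFunctional φ ψ t) ∧ ‖S‖ ≤ 64 * ‖φ‖ := by
  refine exists_clm_of_dense (E := B) (fun ψ => tensorFunctional φ ψ) (C := 64 * ‖φ‖) (by positivity) ?_ ?_ ?_ _
    dense_span_tmul ?_
  · exact fun ψ ψ' => minTensor_functional_ext fun a b => by simp [mul_add]
  · exact fun c ψ => minTensor_functional_ext fun a b => by simp [mul_left_comm]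
  · exact fun ψ => (norm_tensorFunctional_le φ ψ).trans (le_of_eq (by ring))
  · rintro _ ⟨a, b, rfl⟩
    exact ⟨φ a • b, fun ψ => by simp⟩

/-- The slice map `id ⊗ φ`. -/
def rightSlice (φ : StrongDual ℂ B) : MinTensor A B →L[ℂ] A := (exists_rightSlice φ).choose

/-- The slice map `φ ⊗ id`. -/
def leftSlice (φ : StrongDual ℂ A) : MinTensor A B →L[ℂ] B := (exists_leftSlice φ).choose

theorem apply_rightSlice (ψ : StrongDual ℂ A) (φ : StrongDual ℂ B) (t : MinTensor A B) :
    ψ (rightSlice φ t) = tensorFunctional ψ φ t := (exists_rightSlice φ).choose_spec.1 ψ t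

theorem norm_rightSlice_le (φ : StrongDual ℂ B) :
    ‖(rightSlice φ : MinTensor A B →L[ℂ] A)‖ ≤ 64 * ‖φ‖ := (exists_rightSlice φ).choose_spec.2

theorem apply_leftSlice (φ : StrongDual ℂ A) (ψ : StrongDual ℂ B) (t : MinTensor A B) :
    ψ (leftSlice φ t) = tensorFunctional φ ψ t := (exists_leftSlice φ).choose_spec.1 ψ t

@[simp]
theorem rightSlice_tmul (φ : StrongDual ℂ B) (a : A) (b : B) :
    rightSlice φ (tmul a b) = φ b • a :=
  (SeparatingDual.eq_iff_forall_dual_eq (R := ℂ)).2 fun ψ => by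
    rw [apply_rightSlice, tensorFunctional_tmul, map_smul, smul_eq_mul, mul_comm]

theorem isSlice_rightSlice (φ : StrongDual ℂ B) :
    IsSlice φ (rightSlice φ : MinTensor A B →L[ℂ] A) := rightSlice_tmul φ

theorem minTensor_clm_ext {E : Type*} [NormedAddCommGroup E] [NormedSpace ℂ E]
    {S T : MinTensor A B →L[ℂ] E} (hST : ∀ a b, S (tmul a b) = T (tmul a b)) : S = T :=
  ContinuousLinearMap.ext_on dense_span_tmul (by rintro _ ⟨a, b, rfl⟩; exact hST a b)

theorem IsSlice.eq_rightSlice {φ : StrongDual ℂ B} {S : MinTensor A B →L[ℂ] A}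
    (hS : IsSlice φ S) : S = rightSlice φ :=
  minTensor_clm_ext fun a b => by rw [hS, rightSlice_tmul]

theorem rightSlice_add (φ ψ : StrongDual ℂ B) :
    (rightSlice (φ + ψ) : MinTensor A B →L[ℂ] A) = rightSlice φ + rightSlice ψ :=
  minTensor_clm_ext fun a b => by simp [add_smul]

theorem rightSlice_sub (φ ψ : StrongDual ℂ B) :
    (rightSlice (φ - ψ) : MinTensor A B →L[ℂ] A) = rightSlice φ - rightSlice ψ :=
  minTensor_clm_ext fun a b => by simp [sub_smul]

theorem rightSlice_smul (c : ℂ) (φ : StrongDual ℂ B) :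
    (rightSlice (c • φ) : MinTensor A B →L[ℂ] A) = c • rightSlice φ :=
  minTensor_clm_ext fun a b => by simp [mul_smul]

theorem norm_minTensor_clm_apply_le (S : MinTensor A B →L[ℂ] A) {C : ℝ} (hS : ‖S‖ ≤ C) (t : MinTensor A B) :
    ‖S t‖ ≤ C * ‖t‖ :=
  ContinuousLinearMap.le_of_opNorm_le S hS t

theorem norm_rightSlice_apply_le (φ : StrongDual ℂ B) (t : MinTensor A B) :
    ‖rightSlice φ t‖ ≤ 64 * ‖φ‖ * ‖t‖ :=
  norm_minTensor_clm_apply_le _ (norm_rightSlice_le φ) t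

theorem norm_opTensor_gns_le (a : A) (b : B) (p : (A →ₚ[ℂ] ℂ) × (B →ₚ[ℂ] ℂ)) :
    ‖opTensor (p.1.gnsNonUnitalStarAlgHom a) (p.2.gnsNonUnitalStarAlgHom b)‖ ≤ ‖a‖ * ‖b‖ := by
  refine (norm_opTensor_le _ _).trans ?_
  have h1 := NonUnitalStarAlgHom.norm_apply_le p.1.gnsNonUnitalStarAlgHom a
  have h2 := NonUnitalStarAlgHom.norm_apply_le p.2.gnsNonUnitalStarAlgHom b
  exact mul_le_mul h1 h2 (norm_nonneg _) (norm_nonneg _)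

theorem norm_ambientTmul_apply_le (a : A) (b : B) (p : (A →ₚ[ℂ] ℂ) × (B →ₚ[ℂ] ℂ)) :
    ‖(ambientTmul a b : TensorAmbient A B) p‖ ≤ ‖a‖ * ‖b‖ := norm_opTensor_gns_le a b p

theorem norm_ambientTmul_le (a : A) (b : B) :
    ‖(ambientTmul a b : TensorAmbient A B)‖ ≤ ‖a‖ * ‖b‖ :=
  lp.norm_le_of_forall_le (mul_nonneg (norm_nonneg a) (norm_nonneg b))
    (norm_ambientTmul_apply_le a b)

theorem norm_tmul_le (a : A) (b : B) : ‖tmul a b‖ ≤ ‖a‖ * ‖b‖ :=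
  norm_ambientTmul_le a b

end TensorFunctionals

end QG

namespace QG

section Bilinear

variable {A B : Type*} [NonUnitalCStarAlgebra A] [PartialOrder A] [StarOrderedRing A]
  [NonUnitalCStarAlgebra B] [PartialOrder B] [StarOrderedRing B]

theorem opTensor_apply_ext {E F : Type*} [NormedAddCommGroup E] [InnerProductSpace ℂ E]
    [NormedAddCommGroup F] [InnerProductSpace ℂ F]
    {T U : HilbertTensor E F →L[ℂ] HilbertTensor E F}
    (hTU : ∀ x : E ⊗[ℂ] F, T (x : HilbertTensor E F) = U (x : HilbertTensor E F)) : T = U := by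
  ext x
  induction x using UniformSpace.Completion.induction_on with
  | hp => exact isClosed_eq (ContinuousLinearMap.continuous _) (ContinuousLinearMap.continuous _)
  | ih x => exact hTU x

variable {E F : Type*} [NormedAddCommGroup E] [InnerProductSpace ℂ E]
    [NormedAddCommGroup F] [InnerProductSpace ℂ F]

theorem opTensor_add_left (S S' : E →L[ℂ] E) (T : F →L[ℂ] F) :
    opTensor (S + S') T = opTensor S T + opTensor S' T :=
  opTensor_apply_ext fun x => by
    rw [add_apply, opTensor_coe, opTensor_coe, opTensor_coe, TensorProduct.mapL_add_left, add_apply,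
      UniformSpace.Completion.coe_add]

theorem opTensor_add_right (S : E →L[ℂ] E) (T T' : F →L[ℂ] F) :
    opTensor S (T + T') = opTensor S T + opTensor S T' :=
  opTensor_apply_ext fun x => by
    rw [add_apply, opTensor_coe, opTensor_coe, opTensor_coe, TensorProduct.mapL_add_right, add_apply,
      UniformSpace.Completion.coe_add]

theorem opTensor_smul_left (c : ℂ) (S : E →L[ℂ] E) (T : F →L[ℂ] F) :
    opTensor (c • S) T = c • opTensor S T :=
  opTensor_apply_ext fun x => by
    rw [smul_apply, opTensor_coe, opTensor_coe, TensorProduct.mapL_smul_left, smul_apply,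
      UniformSpace.Completion.coe_smul]

theorem tmul_add_left (a a' : A) (b : B) : tmul (a + a') b = tmul a b + tmul a' b := by
  refine Subtype.ext (lp.ext (funext fun p => ?_))
  change opTensor (p.1.gnsNonUnitalStarAlgHom (a + a')) _ = opTensor _ _ + opTensor _ _
  rw [map_add, opTensor_add_left]

theorem tmul_add_right (a : A) (b b' : B) : tmul a (b + b') = tmul a b + tmul a b' := by
  refine Subtype.ext (lp.ext (funext fun p => ?_))
  change opTensor _ (p.2.gnsNonUnitalStarAlgHom (b + b')) = opTensor _ _ + opTensor _ _
  rw [map_add, opTensor_add_right]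

theorem tmul_smul_left (c : ℂ) (a : A) (b : B) : tmul (c • a) b = c • tmul a b := by
  refine Subtype.ext (lp.ext (funext fun p => ?_))
  exact (congrArg (fun S => opTensor S _) (map_smul p.1.gnsNonUnitalStarAlgHom c a)).trans
    (opTensor_smul_left c _ _)

theorem tmul_sub_right (a : A) (b b' : B) : tmul a (b - b') = tmul a b - tmul a b' := by
  rw [eq_sub_iff_add_eq, ← tmul_add_right, sub_add_cancel]

theorem tmul_sub_left (a a' : A) (b : B) : tmul (a - a') b = tmul a b - tmul a' b := by
  rw [eq_sub_iff_add_eq, ← tmul_add_left, sub_add_cancel]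

attribute [local irreducible] instNonUnitalCStarAlgebraMinTensor

theorem norm_tmul_sub_tmul_le (a a' : A) (b b' : B) : ‖tmul a b - tmul a' b'‖ ≤
    ‖a - a'‖ * ‖b - b'‖ + ‖a - a'‖ * ‖b'‖ + ‖a'‖ * ‖b - b'‖ := by
  have h : tmul a b - tmul a' b' =
      tmul (a - a') (b - b') + tmul (a - a') b' + tmul a' (b - b') := by
    simp only [tmul_sub_left, tmul_sub_right]
    abel
  rw [h]
  exact norm_add₃_le.trans
    (add_le_add (add_le_add (norm_tmul_le _ _) (norm_tmul_le _ _)) (norm_tmul_le _ _))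

theorem tendsto_tmul {ι : Type*} {l : Filter ι} {f : ι → A} {g : ι → B} {a : A} {b : B}
    (hf : Tendsto f l (𝓝 a)) (hg : Tendsto g l (𝓝 b)) :
    Tendsto (fun i => tmul (f i) (g i)) l (𝓝 (tmul a b)) := by
  rw [tendsto_iff_norm_sub_tendsto_zero] at hf hg ⊢
  refine squeeze_zero (fun _ => norm_nonneg _) (fun i => norm_tmul_sub_tmul_le _ _ _ _) ?_
  simpa using ((hf.mul hg).add (hf.mul_const ‖b‖)).add (hg.const_mul ‖a‖)

theorem rightSlice_mul_tmul (φ : StrongDual ℂ B) (t : MinTensor A B) (x : A) (b : B) :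
    rightSlice φ (t * tmul x b) = rightSlice (dualMulRight φ b) t * x := by
  have : (rightSlice φ).comp ((ContinuousLinearMap.mul ℂ (MinTensor A B)).flip (tmul x b)) =
      ((ContinuousLinearMap.mul ℂ A).flip x).comp (rightSlice (dualMulRight φ b)) :=
    minTensor_clm_ext fun a c => by
      change rightSlice φ (tmul a c * tmul x b) = rightSlice (dualMulRight φ b) (tmul a c) * x
      rw [tmul_mul, rightSlice_tmul, rightSlice_tmul, dualMulRight_apply, smul_mul_assoc]
  exact congrArg (fun f => f t) this

theorem rightSlice_tmul_mul (φ : StrongDual ℂ B) (t : MinTensor A B) (x : A) (b : B) :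
    rightSlice φ (tmul x b * t) = x * rightSlice (dualMulLeft φ b) t := by
  have : (rightSlice φ).comp (ContinuousLinearMap.mul ℂ (MinTensor A B) (tmul x b)) =
      (ContinuousLinearMap.mul ℂ A x).comp (rightSlice (dualMulLeft φ b)) :=
    minTensor_clm_ext fun a c => by
      change rightSlice φ (tmul x b * tmul a c) = x * rightSlice (dualMulLeft φ b) (tmul a c)
      rw [tmul_mul, rightSlice_tmul, rightSlice_tmul, dualMulLeft_apply, mul_smul_comm]
  exact congrArg (fun f => f t) this

theorem rightSlice_tmulOne_fst (φ : StrongDual ℂ B) (x : A) (t : MinTensor A B) :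
    rightSlice φ ((tmulOne B x).fst t) = x * rightSlice φ t := by
  have : (rightSlice φ).comp (tmulOne B x).fst =
      (ContinuousLinearMap.mul ℂ A x).comp (rightSlice φ) :=
    minTensor_clm_ext fun a c => by
      change rightSlice φ ((tmulOne B x).fst (tmul a c)) = x * rightSlice φ (tmul a c)
      rw [tmulOne_fst, rightSlice_tmul, rightSlice_tmul, mul_smul_comm]
  exact congrArg (fun f => f t) this

theorem rightSlice_star (φ : StrongDual ℂ B) (t : MinTensor A B) :
    rightSlice (starFunctional φ) (star t) = star (rightSlice φ t) := by
  have h : IsClosed {t : MinTensor A B |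
      rightSlice (starFunctional φ) (star t) = star (rightSlice φ t)} :=
    isClosed_eq (by fun_prop) (by fun_prop)
  refine h.closure_subset_iff.2 (fun t ht => ?_) (dense_span_tmul t)
  induction ht using Submodule.span_induction with
  | mem t ht =>
    obtain ⟨a, b, rfl⟩ := ht
    simp only [Set.mem_ofPred_eq]
    rw [star_tmul, rightSlice_tmul, rightSlice_tmul, star_smul, starFunctional_apply, star_star]
    rfl
  | zero => simp
  | add s t _ _ hs ht =>
    simp only [Set.mem_ofPred_eq] at *
    rw [star_add, map_add, map_add, star_add, hs, ht]
  | smul c t _ ht =>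
    simp only [Set.mem_ofPred_eq] at *
    rw [star_smul, map_smul, map_smul, star_smul, ht]

open scoped MatrixOrder in
theorem sum_posSemidef_nonneg {n : ℕ} {M : Matrix (Fin n) (Fin n) ℂ} (hM : M.PosSemidef)
    (a : Fin n → A) : 0 ≤ ∑ i, ∑ j, M i j • (star (a i) * a j) := by
  obtain ⟨N, rfl⟩ := CStarAlgebra.nonneg_iff_eq_star_mul_self.mp hM.nonneg
  have : ∑ i, ∑ j, (star N * N) i j • (star (a i) * a j) =
      ∑ k, star (∑ i, N k i • a i) * ∑ j, N k j • a j := by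
    simp only [Matrix.mul_apply, Matrix.star_apply, star_sum, Finset.sum_mul_sum, Finset.sum_smul,
      star_smul, smul_mul_smul_comm]
    rw [Finset.sum_comm_cycle]
  rw [this]
  exact Finset.sum_nonneg fun k _ => star_mul_self_nonneg _

theorem IsPositiveFunctional.map_star {φ : StrongDual ℂ B} (hφ : IsPositiveFunctional φ) (b : B) :
    φ (star b) = star (φ b) := by
  exact StarHomClass.map_star hφ.toPositiveLinearMap b

theorem IsPositiveFunctional.posSemidef_gram {φ : StrongDual ℂ B} (hφ : IsPositiveFunctional φ)
    {n : ℕ} (b : Fin n → B) :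
    (Matrix.of fun i j => (‖φ‖ : ℂ) * φ (star (b i) * b j) - star (φ (b i)) * φ (b j)).PosSemidef := by
  refine .of_dotProduct_mulVec_nonneg (Matrix.IsHermitian.ext fun i j => ?_) fun x => ?_
  · have h1 : star (φ (star (b j) * b i)) = φ (star (b i) * b j) := by
      rw [← hφ.map_star, star_mul, star_star]
    have h2 : star ((‖φ‖ : ℝ) : ℂ) = ‖φ‖ := Complex.conj_ofReal _
    simp only [Matrix.of_apply, star_sub, star_mul', star_star, h1, h2]
    ring
  · set c : B := ∑ j, x j • b j with hc
    have h0 : φ (star c * c) = ∑ i, ∑ j, star (x i) * x j * φ (star (b i) * b j) := by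
      rw [hc, star_sum, Finset.sum_mul_sum, map_sum]
      refine Finset.sum_congr rfl fun i _ => ?_
      rw [map_sum]
      refine Finset.sum_congr rfl fun j _ => ?_
      rw [star_smul, smul_mul_smul_comm, map_smul, smul_eq_mul]
    have h0' : star (φ c) * φ c = ∑ i, ∑ j, star (x i) * x j * (star (φ (b i)) * φ (b j)) := by
      rw [hc, map_sum, star_sum, Finset.sum_mul_sum]
      refine Finset.sum_congr rfl fun i _ => Finset.sum_congr rfl fun j _ => ?_
      rw [map_smul, map_smul, smul_eq_mul, smul_eq_mul, star_mul']
      ring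
    have h1 : star x ⬝ᵥ (Matrix.of fun i j => (‖φ‖ : ℂ) * φ (star (b i) * b j) -
        star (φ (b i)) * φ (b j)).mulVec x = (‖φ‖ : ℂ) * φ (star c * c) - star (φ c) * φ c := by
      rw [h0, h0']
      simp only [dotProduct, Matrix.mulVec, Matrix.of_apply, Finset.mul_sum, Pi.star_apply]
      rw [← Finset.sum_sub_distrib]
      refine Finset.sum_congr rfl fun i _ => ?_
      rw [← Finset.sum_sub_distrib]
      refine Finset.sum_congr rfl fun j _ => ?_
      ring
    rw [h1, hφ.apply_eq_re (star_mul_self_nonneg c)]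
    have h2 := hφ.norm_sq_le c
    rw [hφ.norm_apply_eq_re (star_mul_self_nonneg c)] at h2
    have h3 : star (φ c) * φ c = ((‖φ c‖ ^ 2 : ℝ) : ℂ) := by
      rw [← Complex.normSq_eq_norm_sq, Complex.normSq_eq_conj_mul_self]
      rfl
    rw [h3, ← Complex.ofReal_mul, ← Complex.ofReal_sub]
    exact_mod_cast sub_nonneg.2 h2

/-- The Kadison–Schwarz inequality for slice maps. -/
theorem rightSlice_kadison {φ : StrongDual ℂ B} (hφ : IsPositiveFunctional φ)
    (t : MinTensor A B) :
    star (rightSlice φ t) * rightSlice φ t ≤ (‖φ‖ : ℂ) • rightSlice φ (star t * t) := by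
  have h : IsClosed {t : MinTensor A B |
      star (rightSlice φ t) * rightSlice φ t ≤ (‖φ‖ : ℂ) • rightSlice φ (star t * t)} :=
    isClosed_le (by fun_prop) (by fun_prop)
  refine h.closure_subset_iff.2 (fun t ht => ?_) (dense_span_tmul t)
  obtain ⟨n, c, g, rfl⟩ := Submodule.mem_span_set'.1 ht
  choose a b hab using fun i => (g i).2
  have ht : ∑ i, c i • (g i : MinTensor A B) = ∑ i, tmul (c i • a i) (b i) :=
    Finset.sum_congr rfl fun i _ => by rw [hab, tmul_smul_left]
  rw [ht]
  simp only [Set.mem_ofPred_eq]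
  rw [← sub_nonneg]
  refine (sum_posSemidef_nonneg (hφ.posSemidef_gram b) fun i => c i • a i).trans_eq ?_
  rw [star_sum, Finset.sum_mul_sum, map_sum, map_sum, star_sum, Finset.sum_mul_sum,
    Finset.smul_sum, ← Finset.sum_sub_distrib]
  refine Finset.sum_congr rfl fun i _ => ?_
  rw [map_sum, Finset.smul_sum, ← Finset.sum_sub_distrib]
  refine Finset.sum_congr rfl fun j _ => ?_
  rw [star_tmul, tmul_mul, rightSlice_tmul, rightSlice_tmul, rightSlice_tmul, Matrix.of_apply,
    sub_smul, mul_smul, star_smul (φ (b i)), smul_mul_smul_comm]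

end Bilinear

end QG

namespace QG

section MultiplierSlices

theorem eq_of_forall_mul_right_eq {A : Type*} [NonUnitalCStarAlgebra A] {a b : A}
    (hab : ∀ x, a * x = b * x) : a = b := by
  rw [← sub_eq_zero, ← CStarRing.mul_star_self_eq_zero_iff, sub_mul, hab, sub_self]

theorem eq_of_forall_mul_left_eq {A : Type*} [NonUnitalCStarAlgebra A] {a b : A}
    (hab : ∀ x, x * a = x * b) : a = b := by
  rw [← sub_eq_zero, ← CStarRing.star_mul_self_eq_zero_iff, mul_sub, hab, sub_self]

theorem norm_le_of_forall_mul_right {A : Type*} [NonUnitalCStarAlgebra A] {a : A} {C : ℝ}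
    (hC : 0 ≤ C) (ha : ∀ x, ‖a * x‖ ≤ C * ‖x‖) : ‖a‖ ≤ C := by
  rcases eq_or_ne a 0 with rfl | h0
  · simpa using hC
  · have := ha (star a)
    rw [CStarRing.norm_self_mul_star, norm_star] at this
    exact le_of_mul_le_mul_right this (norm_pos_iff.2 h0)

theorem fst_mul {A : Type*} [NonUnitalCStarAlgebra A] (m : 𝓜(ℂ, A)) (s t : A) :
    m.fst (s * t) = m.fst s * t :=
  eq_of_forall_mul_left_eq fun x => by
    rw [← m.central, ← mul_assoc, ← mul_assoc, m.central]

theorem coe_fst_apply {A : Type*} [NonUnitalCStarAlgebra A] (s t : A) :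
    (s : 𝓜(ℂ, A)).fst t = s * t := rfl

theorem exists_tendsto_of_dist_le {ι X Y : Type*} [MetricSpace X] [MetricSpace Y]
    [CompleteSpace Y] {l : Filter ι} [l.NeBot] {f : ι → X} {g : ι → Y} {x : X} {K : ℝ}
    (hf : Tendsto f l (𝓝 x)) (hfg : ∀ i j, dist (g i) (g j) ≤ K * dist (f i) (f j)) :
    ∃ y, Tendsto g l (𝓝 y) := by
  have hc : Cauchy (map g l) := by
    rw [cauchy_map_iff, Metric.uniformity_eq_comap_nhds_zero, tendsto_comap_iff]
    refine ⟨inferInstance, ?_⟩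
    have h1 : Tendsto (fun p : ι × ι => K * dist (f p.1) (f p.2)) (l ×ˢ l) (𝓝 0) := by
      have h2 : Tendsto (fun p : ι × ι => dist (f p.1) (f p.2)) (l ×ˢ l) (𝓝 (dist x x)) :=
        (hf.comp tendsto_fst).dist (hf.comp tendsto_snd)
      simpa using h2.const_mul K
    exact squeeze_zero (fun p => dist_nonneg) (fun p => hfg p.1 p.2) h1
  exact CompleteSpace.complete hc

variable {A B : Type*} [NonUnitalCStarAlgebra A] [PartialOrder A] [StarOrderedRing A]
  [NonUnitalCStarAlgebra B] [PartialOrder B] [StarOrderedRing B]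

attribute [local irreducible] instNonUnitalCStarAlgebraMinTensor

instance approximateUnit_neBot : (CStarAlgebra.approximateUnit B).NeBot :=
  (CStarAlgebra.increasingApproximateUnit B).neBot

theorem tendsto_multiplier_tmul {ι : Type*} {l : Filter ι} (φ : StrongDual ℂ B)
    (m : 𝓜(ℂ, MinTensor A B)) {f : ι → A} {g : ι → B} {a : A} {b : B}
    (hf : Tendsto f l (𝓝 a)) (hg : Tendsto g l (𝓝 b)) :
    Tendsto (fun i => rightSlice φ (m.fst (tmul (f i) (g i)))) l
      (𝓝 (rightSlice φ (m.fst (tmul a b)))) :=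
  (((rightSlice φ).continuous.comp m.fst.continuous).tendsto _).comp (tendsto_tmul hf hg)

theorem norm_rightSlice_fst_le (φ : StrongDual ℂ B) (m : 𝓜(ℂ, MinTensor A B)) (x : A) (b : B) :
    ‖rightSlice φ (m.fst (tmul x b))‖ ≤ 64 * ‖φ‖ * (‖m‖ * (‖x‖ * ‖b‖)) := by
  refine (norm_rightSlice_apply_le φ _).trans (mul_le_mul_of_nonneg_left ?_ (by positivity))
  refine (m.fst.le_opNorm _).trans ?_
  rw [DoubleCentralizer.norm_fst]
  exact mul_le_mul_of_nonneg_left (norm_tmul_le x b) (norm_nonneg _)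

theorem rightSlice_fst_tmul_mul (φ : StrongDual ℂ B) (m : 𝓜(ℂ, MinTensor A B)) (x : A) (b c : B) :
    rightSlice φ (m.fst (tmul x (b * c))) = rightSlice (dualMulRight φ c) (m.fst (tmul x b)) := by
  have hl := CStarAlgebra.increasingApproximateUnit A
  have h1 := tendsto_multiplier_tmul φ m (hl.tendsto_mul_left x)
    (tendsto_const_nhds (x := b * c))
  have h2 := hl.tendsto_mul_left (rightSlice (dualMulRight φ c) (m.fst (tmul x b)))
  refine tendsto_nhds_unique h1 (h2.congr fun u => ?_)
  rw [← tmul_mul, fst_mul, rightSlice_mul_tmul]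

theorem norm_rightSlice_fst_le' (φ : StrongDual ℂ B) (m : 𝓜(ℂ, MinTensor A B)) (x : A) (b : B) :
    ‖rightSlice φ (m.fst (tmul x b))‖ ≤ 64 * ‖m‖ * ‖dualMulRight φ b‖ * ‖x‖ := by
  have hl := CStarAlgebra.increasingApproximateUnit B
  have h1 := (tendsto_multiplier_tmul φ m (tendsto_const_nhds (x := x))
    (hl.tendsto_mul_right b)).norm
  refine le_of_tendsto h1 ?_
  filter_upwards [hl.eventually_norm] with e he
  rw [rightSlice_fst_tmul_mul]
  refine (norm_rightSlice_fst_le _ m x e).trans ?_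
  calc _ = 64 * ‖dualMulRight φ b‖ * ‖m‖ * ‖x‖ * ‖e‖ := by ring
    _ ≤ 64 * ‖dualMulRight φ b‖ * ‖m‖ * ‖x‖ * 1 := by gcongr
    _ = _ := by ring

theorem tendsto_rightSlice_mul_tmul (φ : StrongDual ℂ B) (t : MinTensor A B) (x : A) :
    Tendsto (fun e => rightSlice φ (t * tmul x e)) (CStarAlgebra.approximateUnit B)
      (𝓝 (rightSlice φ t * x)) := by
  have h := tendsto_dualMulRight φ
  simp only [rightSlice_mul_tmul]
  refine Tendsto.mul_const x ?_
  rw [tendsto_iff_norm_sub_tendsto_zero] at h ⊢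
  refine squeeze_zero (fun _ => norm_nonneg _) (fun e => ?_)
    (by simpa using (h.const_mul 64).mul_const ‖t‖)
  rw [← sub_apply, ← rightSlice_sub]
  exact norm_rightSlice_apply_le _ t

theorem rightSlice_mul_eq (φ : StrongDual ℂ B) {m : 𝓜(ℂ, MinTensor A B)} {t : MinTensor A B} {b : B}
    (ht : (t : 𝓜(ℂ, MinTensor A B)) = m * oneTmul A b) (x : A) :
    rightSlice φ t * x = rightSlice φ (m.fst (tmul x b)) := by
  have hl := CStarAlgebra.increasingApproximateUnit B
  have h1 := tendsto_multiplier_tmul φ m (tendsto_const_nhds (x := x)) (hl.tendsto_mul_left b)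
  refine tendsto_nhds_unique (tendsto_rightSlice_mul_tmul φ t x) (h1.congr fun e => ?_)
  rw [← coe_fst_apply t (tmul x e), ht]
  change _ = rightSlice φ (m.fst ((oneTmul A b).fst (tmul x e)))
  rw [oneTmul_fst]

theorem exists_isMultiplierSlice (φ : StrongDual ℂ B) (m : 𝓜(ℂ, MinTensor A B))
    (hm : ∀ b, ∃ t : MinTensor A B, (t : 𝓜(ℂ, MinTensor A B)) = m * oneTmul A b) :
    ∃ c : A, IsMultiplierSlice φ m (c : 𝓜(ℂ, A)) := by
  choose t ht using hm
  have key := fun b x => rightSlice_mul_eq φ (ht b) x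
  obtain ⟨c, hc⟩ := exists_tendsto_of_dist_le (g := fun b => rightSlice φ (t b)) (K := 64 * ‖m‖)
    (tendsto_dualMulRight φ) fun b b' => by
      rw [dist_eq_norm, dist_eq_norm]
      refine norm_le_of_forall_mul_right (by positivity) fun x => ?_
      have h1 : dualMulRight φ b - dualMulRight φ b' = dualMulRight φ (b - b') := by
        ext c; simp [mul_sub]
      rw [sub_mul, key, key, h1, ← map_sub, ← map_sub, ← tmul_sub_right]
      exact norm_rightSlice_fst_le' φ m x (b - b')
  refine ⟨c, rightSlice φ, isSlice_rightSlice φ, fun x => ?_⟩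
  refine (hc.mul_const x).congr fun e => ?_
  exact key e x

end MultiplierSlices

section Convolution

variable {A : Type*} [NonUnitalCStarAlgebra A] [PartialOrder A] [StarOrderedRing A]
  {δ : A →⋆ₙₐ[ℂ] 𝓜(ℂ, MinTensor A A)}

attribute [local irreducible] instNonUnitalCStarAlgebraMinTensor

theorem isConv_iff {φ : StrongDual ℂ A} {a c : A} : IsConv δ φ a c ↔
    ∀ x, Tendsto (fun e => rightSlice φ ((δ a).fst (tmul x e))) (CStarAlgebra.approximateUnit A)
      (𝓝 (c * x)) := by
  constructor
  · rintro ⟨S, hS, h1⟩ x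
    rw [hS.eq_rightSlice] at h1
    exact h1 x
  · exact fun h1 => ⟨_, isSlice_rightSlice φ, h1⟩

theorem IsConv.unique {φ : StrongDual ℂ A} {a c c' : A} (hc : IsConv δ φ a c)
    (hc' : IsConv δ φ a c') : c = c' :=
  eq_of_forall_mul_right_eq fun x => tendsto_nhds_unique (isConv_iff.1 hc x) (isConv_iff.1 hc' x)

theorem existsUnique_isConv (hδ : IsProper δ) (φ : StrongDual ℂ A) (a : A) :
    ∃! c, IsConv δ φ a c := by
  obtain ⟨c, hc⟩ := exists_isMultiplierSlice φ (δ a) fun b => (hδ a b).1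
  exact ⟨c, hc, fun c' hc' => hc'.unique hc⟩

theorem isConv_conv (hδ : IsProper δ) (φ : StrongDual ℂ A) (a : A) :
    IsConv δ φ a (conv δ φ a) :=
  Classical.epsilon_spec (existsUnique_isConv hδ φ a).exists

theorem IsConv.conv_eq {φ : StrongDual ℂ A} {a c : A} (hc : IsConv δ φ a c) : conv δ φ a = c :=
  (Classical.epsilon_spec (p := IsConv δ φ a) ⟨c, hc⟩ : IsConv δ φ a (conv δ φ a)).unique hc

theorem tendsto_conv (hδ : IsProper δ) (φ : StrongDual ℂ A) (a x : A) :
    Tendsto (fun e => rightSlice φ ((δ a).fst (tmul x e))) (CStarAlgebra.approximateUnit A)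
      (𝓝 (conv δ φ a * x)) :=
  isConv_iff.1 (isConv_conv hδ φ a) x

theorem conv_add_left (hδ : IsProper δ) (φ ψ : StrongDual ℂ A) (a : A) :
    conv δ (φ + ψ) a = conv δ φ a + conv δ ψ a :=
  IsConv.conv_eq <| isConv_iff.2 fun x => by
    rw [add_mul, rightSlice_add]
    exact (tendsto_conv hδ φ a x).add (tendsto_conv hδ ψ a x)

theorem conv_smul_left (hδ : IsProper δ) (c : ℂ) (φ : StrongDual ℂ A) (a : A) :
    conv δ (c • φ) a = c • conv δ φ a :=
  IsConv.conv_eq <| isConv_iff.2 fun x => by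
    rw [smul_mul_assoc, rightSlice_smul]
    exact (tendsto_conv hδ φ a x).const_smul c

theorem conv_add_right (hδ : IsProper δ) (φ : StrongDual ℂ A) (a b : A) :
    conv δ φ (a + b) = conv δ φ a + conv δ φ b :=
  IsConv.conv_eq <| isConv_iff.2 fun x => by
    simp only [add_mul, map_add, DoubleCentralizer.add_fst, add_apply]
    exact (tendsto_conv hδ φ a x).add (tendsto_conv hδ φ b x)

theorem conv_smul_right (hδ : IsProper δ) (φ : StrongDual ℂ A) (c : ℂ) (a : A) :
    conv δ φ (c • a) = c • conv δ φ a :=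
  IsConv.conv_eq <| isConv_iff.2 fun x => by
    simp only [smul_mul_assoc, map_smul, DoubleCentralizer.smul_fst, smul_apply]
    exact (tendsto_conv hδ φ a x).const_smul c

theorem norm_conv_le (hδ : IsProper δ) (φ : StrongDual ℂ A) (a : A) :
    ‖conv δ φ a‖ ≤ 64 * ‖δ a‖ * ‖φ‖ := by
  have hl := CStarAlgebra.increasingApproximateUnit A
  refine norm_le_of_forall_mul_right (by positivity) fun x => ?_
  refine le_of_tendsto (tendsto_conv hδ φ a x).norm ?_
  filter_upwards [hl.eventually_norm] with e he
  refine (norm_rightSlice_fst_le _ _ x e).trans ?_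
  calc _ = 64 * ‖φ‖ * ‖δ a‖ * ‖x‖ * ‖e‖ := by ring
    _ ≤ 64 * ‖φ‖ * ‖δ a‖ * ‖x‖ * 1 := by gcongr
    _ = _ := by ring

theorem tendsto_conv_left (hδ : IsProper δ) {ι : Type*} {l : Filter ι} {f : ι → StrongDual ℂ A}
    {φ : StrongDual ℂ A} (hf : Tendsto f l (𝓝 φ)) (a : A) :
    Tendsto (fun i => conv δ (f i) a) l (𝓝 (conv δ φ a)) := by
  rw [tendsto_iff_norm_sub_tendsto_zero] at hf ⊢
  refine squeeze_zero (fun _ => norm_nonneg _) (fun i => ?_)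
    (by simpa using hf.const_mul (64 * ‖δ a‖))
  have : conv δ (f i) a = conv δ (f i - φ) a + conv δ φ a := by
    rw [← conv_add_left hδ, sub_add_cancel]
  rw [this, add_sub_cancel_right]
  exact norm_conv_le hδ _ a

theorem rightSlice_snd_tmul (hδ : IsProper δ) (φ : StrongDual ℂ A) (a x b : A) :
    rightSlice φ ((δ a).snd (tmul x b)) = x * conv δ (dualMulLeft φ b) a := by
  have hl := CStarAlgebra.increasingApproximateUnit A
  refine eq_of_forall_mul_right_eq fun y => ?_
  have h1 := (tendsto_conv hδ (dualMulLeft φ b) a y).const_mul x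
  rw [mul_assoc]
  refine tendsto_nhds_unique (tendsto_rightSlice_mul_tmul φ _ y) (h1.congr fun e => ?_)
  rw [(δ a).central, rightSlice_tmul_mul]

theorem star_conv (hδ : IsProper δ) (φ : StrongDual ℂ A) (a : A) :
    star (conv δ φ a) = conv δ (starFunctional φ) (star a) := by
  have hl := CStarAlgebra.increasingApproximateUnit A
  refine (IsConv.conv_eq <| isConv_iff.2 fun x => ?_).symm
  have h1 := ((tendsto_conv_left hδ (tendsto_dualMulLeft φ) a).const_mul (star x)).star
  rw [star_mul, star_star] at h1
  refine h1.congr' ?_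
  filter_upwards [hl.eventually_star_eq] with e he
  rw [← rightSlice_snd_tmul hδ, map_star, DoubleCentralizer.star_fst, rightSlice_star, star_tmul, he]

theorem conv_kadison (hδ : IsProper δ) {φ : StrongDual ℂ A} (hφ : IsPositiveFunctional φ) (a : A) :
    star (conv δ φ a) * conv δ φ a ≤ (‖φ‖ : ℂ) • conv δ φ (star a * a) := by
  have hl := CStarAlgebra.increasingApproximateUnit A
  have key : ∀ x, star x * (star (conv δ φ a) * conv δ φ a) * x ≤
      star x * ((‖φ‖ : ℂ) • conv δ φ (star a * a)) * x := by
    intro x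
    have h1 := tendsto_conv hδ φ a x
    have h2 := h1.star.mul h1
    have h3 : Tendsto (fun e => rightSlice φ (star ((δ a).fst (tmul x e)) * (δ a).fst (tmul x e)))
        (CStarAlgebra.approximateUnit A) (𝓝 (star x * (conv δ φ (star a * a) * x))) := by
      have h4 := (tendsto_conv hδ φ (star a * a) x).const_mul (star x)
      have h5 : Tendsto (fun e => star x * rightSlice (dualMulLeft φ e - φ)
          ((δ (star a * a)).fst (tmul x e))) (CStarAlgebra.approximateUnit A) (𝓝 0) := by
        have h6 := tendsto_dualMulLeft φ
        rw [tendsto_iff_norm_sub_tendsto_zero] at h6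
        rw [tendsto_zero_iff_norm_tendsto_zero]
        have h10 := (h6.const_mul (64 * ‖δ (star a * a)‖ * ‖x‖)).const_mul ‖x‖
        rw [mul_zero, mul_zero] at h10
        refine squeeze_zero' (.of_forall fun _ => norm_nonneg _) ?_ h10
        filter_upwards [hl.eventually_norm] with e he
        refine (norm_mul_le _ _).trans ?_
        rw [norm_star]
        refine mul_le_mul_of_nonneg_left ?_ (norm_nonneg _)
        refine (norm_rightSlice_fst_le _ _ x e).trans ?_
        calc _ = 64 * ‖dualMulLeft φ e - φ‖ * ‖δ (star a * a)‖ * ‖x‖ * ‖e‖ := by ring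
          _ ≤ 64 * ‖dualMulLeft φ e - φ‖ * ‖δ (star a * a)‖ * ‖x‖ * 1 := by gcongr
          _ = _ := by ring
      have h7 := h5.add h4
      rw [zero_add] at h7
      refine h7.congr' ?_
      filter_upwards [hl.eventually_star_eq] with e he
      have h8 : star ((δ a).fst (tmul x e)) * (δ a).fst (tmul x e) =
          tmul (star x) e * (δ (star a * a)).fst (tmul x e) := by
        have h9 : star ((δ a).fst (tmul x e)) = (star (δ a)).snd (tmul (star x) e) := by
          rw [DoubleCentralizer.star_snd, star_tmul, star_star, he]
        rw [h9, (star (δ a)).central, map_mul, map_star]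
        rfl
      rw [h8, rightSlice_tmul_mul, rightSlice_sub, sub_apply, mul_sub, sub_add_cancel]
    have h4 := le_of_tendsto_of_tendsto' h2 (h3.const_smul (‖φ‖ : ℂ)) fun e =>
      rightSlice_kadison hφ _
    simpa only [star_mul, mul_assoc, smul_mul_assoc, mul_smul_comm] using h4
  have h1 : ∀ z : A, Tendsto (fun e => star e * z * e) (CStarAlgebra.approximateUnit A) (𝓝 z) := by
    intro z
    have h2 : Tendsto (fun e => e * z * e) (CStarAlgebra.approximateUnit A) (𝓝 z) := by
      rw [tendsto_iff_norm_sub_tendsto_zero]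
      have h3 := tendsto_iff_norm_sub_tendsto_zero.1 (hl.tendsto_mul_right z)
      have h4 := tendsto_iff_norm_sub_tendsto_zero.1 (hl.tendsto_mul_left z)
      refine squeeze_zero' (.of_forall fun _ => norm_nonneg _) ?_ (by simpa using h3.add h4)
      filter_upwards [hl.eventually_norm] with e he
      have : e * z * e - z = (e * z - z) * e + (z * e - z) := by rw [sub_mul]; abel
      rw [this]
      refine (norm_add_le _ _).trans (add_le_add_left ((norm_mul_le _ _).trans ?_) _)
      exact mul_le_of_le_one_right (norm_nonneg _) he
    refine h2.congr' ?_
    filter_upwards [hl.eventually_star_eq] with e he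
    rw [he]
  exact le_of_tendsto_of_tendsto' (h1 _) (h1 _) fun e => key e

theorem exists_leftSlice_conv (hδ : IsProper δ) (ω : StrongDual ℂ A) (a b : A) :
    ∃ w : A, ∀ φ : StrongDual ℂ A, φ w = ω (b * conv δ φ a) := by
  obtain ⟨t, ht⟩ := (hδ a b).2
  refine ⟨leftSlice ω t, fun φ => ?_⟩
  rw [apply_leftSlice, ← apply_rightSlice]
  congr 1
  refine eq_of_forall_mul_right_eq fun x => ?_
  have h1 := (tendsto_conv hδ φ a x).const_mul b
  rw [mul_assoc]
  refine tendsto_nhds_unique (tendsto_rightSlice_mul_tmul φ t x) (h1.congr fun e => ?_)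
  rw [← coe_fst_apply t (tmul x e), ht]
  change _ = rightSlice φ ((tmulOne A b).fst ((δ a).fst (tmul x e)))
  rw [rightSlice_tmulOne_fst]

end Convolution

end QG

namespace QG

section WeightGNS

variable {A : Type*} [NonUnitalCStarAlgebra A] [PartialOrder A] [StarOrderedRing A]
  {h : CStarWeight A}

theorem norm_eta_sq (a : h.nIdeal) : ‖h.eta a‖ ^ 2 = (h (star (a : A) * a)).toReal := by
  have h1 := h.inner_eta a a
  rw [h.ext_apply _ (star_mul_self_nonneg _) a.2, inner_self_eq_norm_sq_to_K] at h1
  rw [RCLike.ofReal_eq_complex_ofReal] at h1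
  exact_mod_cast h1

theorem denseRange_eta : DenseRange h.eta :=
  (UniformSpace.Completion.denseRange_coe (α := h.PreGNS)).comp
    h.toPreGNS.surjective.denseRange (UniformSpace.Completion.continuous_coe _)

theorem norm_toPreGNS (a : h.nIdeal) : ‖h.toPreGNS a‖ = ‖h.eta a‖ :=
  (UniformSpace.Completion.norm_coe (h.toPreGNS a)).symm

theorem clm_ext_eta {E : Type*} [NormedAddCommGroup E] [NormedSpace ℂ E] {S T : h.GNS →L[ℂ] E}
    (hST : ∀ a, S (h.eta a) = T (h.eta a)) : S = T :=
  ContinuousLinearMap.ext fun x =>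
    congrFun (denseRange_eta.equalizer S.continuous T.continuous (funext hST)) x

theorem exists_operator_of_bounded (L : h.nIdeal →ₗ[ℂ] h.nIdeal) {C : ℝ} (hC : 0 ≤ C)
    (hL : ∀ a, ‖h.eta (L a)‖ ≤ C * ‖h.eta a‖) :
    ∃ T : h.GNS →L[ℂ] h.GNS, ‖T‖ ≤ C ∧ ∀ a, T (h.eta a) = h.eta (L a) := by
  let L' : h.PreGNS →ₗ[ℂ] h.PreGNS :=
    (h.toPreGNS.toLinearMap.comp L).comp h.toPreGNS.symm.toLinearMap
  let M : h.PreGNS →L[ℂ] h.PreGNS := L'.mkContinuous C fun x => by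
    have h1 := hL (h.toPreGNS.symm x)
    rwa [← norm_toPreGNS, ← norm_toPreGNS, LinearEquiv.apply_symm_apply] at h1
  have hM : ∀ a, M.completion (h.eta a) = h.eta (L a) := fun a =>
    ContinuousLinearMap.completion_apply_coe M (h.toPreGNS a)
  refine ⟨M.completion, ContinuousLinearMap.opNorm_le_bound _ hC fun x => ?_, hM⟩
  induction x using denseRange_eta.induction_on with
  | hp => exact isClosed_le (by fun_prop) (by fun_prop)
  | ih a => rw [hM]; exact hL a

end WeightGNS

section ConvolutionOperators

variable {A : Type*} [NonUnitalCStarAlgebra A] [PartialOrder A] [StarOrderedRing A]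
  {δ : A →⋆ₙₐ[ℂ] 𝓜(ℂ, MinTensor A A)} {h : CStarWeight A}

theorem weight_conv_le (hδ : IsProper δ) (hinv : h.IsRightInvariant δ) {φ : StrongDual ℂ A}
    (hφ : IsPositiveFunctional φ) {a : A} (ha : a ∈ h.nIdeal) :
    h (star (conv δ φ a) * conv δ φ a) ≤
      ENNReal.ofReal ‖φ‖ * (ENNReal.ofReal ‖φ‖ * h (star a * a)) := by
  have h1 := conv_kadison hδ hφ a
  have h2 : 0 ≤ (‖φ‖ : ℂ) • conv δ φ (star a * a) := (star_mul_self_nonneg _).trans h1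
  refine (h.mono (star_mul_self_nonneg _) h1).trans_eq ?_
  rcases eq_or_ne φ 0 with rfl | h0
  · simp [h.map_zero]
  · have h3 : 0 ≤ conv δ φ (star a * a) := by
      have := CStarWeight.nonneg_smul (inv_nonneg.2 (norm_nonneg φ)) h2
      rwa [smul_smul, ← Complex.ofReal_mul, inv_mul_cancel₀ (norm_ne_zero_iff.2 h0),
        Complex.ofReal_one, one_smul] at this
    rw [h.map_smul _ _ (norm_nonneg _) h3, hinv _ (star_mul_self_nonneg _) ha φ hφ]

theorem conv_mem_nIdeal (hδ : IsProper δ) (hinv : h.IsRightInvariant δ) (φ : StrongDual ℂ A)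
    {a : A} (ha : a ∈ h.nIdeal) : conv δ φ a ∈ h.nIdeal := by
  induction φ using functional_induction with
  | hpos φ hφ =>
    exact (weight_conv_le hδ hinv hφ ha).trans_lt (ENNReal.mul_lt_top ENNReal.ofReal_lt_top
      (ENNReal.mul_lt_top ENNReal.ofReal_lt_top ha))
  | hadd f g hf hg => rw [conv_add_left hδ]; exact Submodule.add_mem _ hf hg
  | hsmul c f hf => rw [conv_smul_left hδ]; exact Submodule.smul_mem _ _ hf

/-- The map `a ↦ φ * a` on `𝔑_h`. -/
def convLinear (hδ : IsProper δ) (hinv : h.IsRightInvariant δ) (φ : StrongDual ℂ A) :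
    h.nIdeal →ₗ[ℂ] h.nIdeal where
  toFun a := ⟨conv δ φ a, conv_mem_nIdeal hδ hinv φ a.2⟩
  map_add' a b := Subtype.ext (conv_add_right hδ φ a b)
  map_smul' c a := Subtype.ext (conv_smul_right hδ φ c a)

theorem norm_eta_convLinear_le_of_positive (hδ : IsProper δ) (hinv : h.IsRightInvariant δ)
    {φ : StrongDual ℂ A} (hφ : IsPositiveFunctional φ) (a : h.nIdeal) :
    ‖h.eta (convLinear hδ hinv φ a)‖ ≤ ‖φ‖ * ‖h.eta a‖ := by
  refine le_of_sq_le_sq ?_ (by positivity)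
  rw [norm_eta_sq, mul_pow, norm_eta_sq]
  have h1 := weight_conv_le hδ hinv hφ a.2
  have h2 := ENNReal.toReal_mono (ENNReal.mul_lt_top ENNReal.ofReal_lt_top
      (ENNReal.mul_lt_top ENNReal.ofReal_lt_top a.2)).ne h1
  rw [ENNReal.toReal_mul, ENNReal.toReal_mul, ENNReal.toReal_ofReal (norm_nonneg _)] at h2
  refine h2.trans_eq ?_
  ring

theorem norm_eta_convLinear_le (hδ : IsProper δ) (hinv : h.IsRightInvariant δ)
    (φ : StrongDual ℂ A) (a : h.nIdeal) :
    ‖h.eta (convLinear hδ hinv φ a)‖ ≤ 8 * ‖φ‖ * ‖h.eta a‖ := by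
  obtain ⟨f, c, hf, hfn, hc, hφ⟩ := exists_positive_decomposition φ
  have h1 : convLinear hδ hinv φ a = ∑ i, c i • convLinear hδ hinv (f i) a := by
    apply Subtype.ext
    rw [hφ, Fin.sum_univ_four, Fin.sum_univ_four]
    simp only [convLinear, conv_add_left hδ, conv_smul_left hδ, LinearMap.coe_mk, AddHom.coe_mk,
      Submodule.coe_add, Submodule.coe_smul]
  rw [h1, map_sum]
  refine (norm_sum_le_of_le _ (f := fun i => h.eta (c i • convLinear hδ hinv (f i) a))
    (n := fun _ => 2 * ‖φ‖ * ‖h.eta a‖) fun i _ => ?_).trans_eq ?_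
  · rw [map_smul, norm_smul, hc, one_mul]
    exact (norm_eta_convLinear_le_of_positive hδ hinv (hf i) a).trans
      (mul_le_mul_of_nonneg_right (hfn i) (norm_nonneg _))
  · simp
    ring

theorem IsConvOp.unique {φ : StrongDual ℂ A} {S T : h.GNS →L[ℂ] h.GNS} (hS : IsConvOp δ h φ S)
    (hT : IsConvOp δ h φ T) : S = T :=
  clm_ext_eta fun a => (hS a).choose_spec.trans (hT a).choose_spec.symm

theorem exists_isConvOp (hδ : IsProper δ) (hinv : h.IsRightInvariant δ) (φ : StrongDual ℂ A) :
    ∃ T, IsConvOp δ h φ T ∧ ‖T‖ ≤ 8 * ‖φ‖ := by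
  obtain ⟨T, hTn, hT⟩ := exists_operator_of_bounded (convLinear hδ hinv φ) (by positivity)
    (norm_eta_convLinear_le hδ hinv φ)
  exact ⟨T, fun a => ⟨conv_mem_nIdeal hδ hinv φ a.2, hT a⟩, hTn⟩

theorem existsUnique_isConvOp (hδ : IsProper δ) (hinv : h.IsRightInvariant δ)
    (φ : StrongDual ℂ A) : ∃! T, IsConvOp δ h φ T := by
  obtain ⟨T, hT, -⟩ := exists_isConvOp hδ hinv φ
  exact ⟨T, hT, fun S hS => hS.unique hT⟩

theorem isConvOp_convOp (hδ : IsProper δ) (hinv : h.IsRightInvariant δ) (φ : StrongDual ℂ A) :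
    IsConvOp δ h φ (convOp δ h φ) :=
  Classical.epsilon_spec (existsUnique_isConvOp hδ hinv φ).exists

theorem convOp_eta (hδ : IsProper δ) (hinv : h.IsRightInvariant δ) (φ : StrongDual ℂ A)
    (a : h.nIdeal) :
    convOp δ h φ (h.eta a) = h.eta ⟨conv δ φ a, conv_mem_nIdeal hδ hinv φ a.2⟩ :=
  (isConvOp_convOp hδ hinv φ a).choose_spec

theorem norm_convOp_le (hδ : IsProper δ) (hinv : h.IsRightInvariant δ) (φ : StrongDual ℂ A) :
    ‖convOp δ h φ‖ ≤ 8 * ‖φ‖ := by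
  obtain ⟨T, hT, hTn⟩ := exists_isConvOp hδ hinv φ
  rwa [(isConvOp_convOp hδ hinv φ).unique hT]

theorem convOp_add (hδ : IsProper δ) (hinv : h.IsRightInvariant δ) (φ ψ : StrongDual ℂ A) :
    convOp δ h (φ + ψ) = convOp δ h φ + convOp δ h ψ :=
  clm_ext_eta fun a => by
    rw [add_apply, convOp_eta hδ hinv, convOp_eta hδ hinv, convOp_eta hδ hinv, ← map_add]
    congr 1
    exact Subtype.ext (conv_add_left hδ φ ψ a)

theorem convOp_smul (hδ : IsProper δ) (hinv : h.IsRightInvariant δ) (c : ℂ) (φ : StrongDual ℂ A) :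
    convOp δ h (c • φ) = c • convOp δ h φ :=
  clm_ext_eta fun a => by
    rw [smul_apply, convOp_eta hδ hinv, convOp_eta hδ hinv, ← map_smul]
    congr 1
    exact Subtype.ext (conv_smul_left hδ c φ a)

end ConvolutionOperators

end QG

namespace QG

section LowerSemicontinuity

variable {A : Type*} [NonUnitalCStarAlgebra A] [PartialOrder A] [StarOrderedRing A]

/-- The element `f = k (k + ε)⁻¹`. -/
theorem exists_resolvent_factor {k : A} (hk : 0 ≤ k) {ε : ℝ} (hε : 0 < ε) :
    ∃ f : A, 0 ≤ f ∧ ‖f‖ ≤ 1 ∧ f * k = k * f ∧ f * k + ε • f = k := by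
  have hks := IsSelfAdjoint.of_nonneg hk
  have hq : ∀ t ∈ quasispectrum ℝ k, 0 ≤ t := fun t ht => quasispectrum_nonneg_of_nonneg k hk t ht
  have hc : ContinuousOn (fun t : ℝ => t / (t + ε)) (quasispectrum ℝ k) :=
    continuousOn_id.div (by fun_prop) fun t ht => (add_pos_of_nonneg_of_pos (hq t ht) hε).ne'
  have hid : cfcₙ (fun t : ℝ => t) k = k := cfcₙ_id' ℝ k
  have h1 : cfcₙ (fun t : ℝ => t / (t + ε) * t) k = cfcₙ (fun t : ℝ => t / (t + ε)) k * k := by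
    rw [cfcₙ_mul (fun t : ℝ => t / (t + ε)) (fun t => t) k hc (by simp) (by fun_prop) (by simp),
      hid]
  have h2 : cfcₙ (fun t : ℝ => t / (t + ε) * t) k = k * cfcₙ (fun t : ℝ => t / (t + ε)) k := by
    simp only [mul_comm _ (_ : ℝ)]
    rw [cfcₙ_mul (fun t : ℝ => t) (fun t : ℝ => t / (t + ε)) k (by fun_prop) (by simp) hc (by simp),
      hid]
  refine ⟨cfcₙ (fun t : ℝ => t / (t + ε)) k, cfcₙ_nonneg fun t ht => ?_,
    norm_cfcₙ_le fun t ht => ?_, ?_, ?_⟩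
  · exact div_nonneg (hq t ht) (add_nonneg (hq t ht) hε.le)
  · have := hq t ht
    rw [Real.norm_of_nonneg (by positivity)]
    exact div_le_one_of_le₀ (by linarith) (by positivity)
  · rw [← h1, ← h2]
  · rw [← h1, ← cfcₙ_smul ε (fun t : ℝ => t / (t + ε)) k hc (by simp),
      ← cfcₙ_add (a := k) (fun t : ℝ => t / (t + ε) * t) (fun t : ℝ => ε • (t / (t + ε)))
        (hc.mul continuousOn_id) (by simp)
        (hc.const_smul ε) (by simp)]
    conv_rhs => rw [← hid]
    refine cfcₙ_congr fun t ht => ?_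
    have : t + ε ≠ 0 := (add_pos_of_nonneg_of_pos (hq t ht) hε).ne'
    simp only [smul_eq_mul]
    field_simp

/-- Compression of a positive element `a` that almost lies below `k` yields an element that lies
below `k` and is close to `a`. -/
theorem exists_compression {a k p : A} (ha : 0 ≤ a) (hk : 0 ≤ k) (hp : 0 ≤ p) {ε : ℝ} (hε : 0 < ε)
    (hd : ‖a - (k - p)‖ ≤ ε) :
    ∃ b : A, 0 ≤ b ∧ b ≤ k ∧ ‖a - b‖ ≤ 2 * √(6 * ε * ‖a‖) := by
  obtain ⟨f, hf, hfn, hfk, hfε⟩ := exists_resolvent_factor hk hε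
  have hfs : star f = f := (IsSelfAdjoint.of_nonneg hf).star_eq
  set d := a - (k - p) with hdd
  have hds : IsSelfAdjoint d :=
    (IsSelfAdjoint.of_nonneg ha).sub ((IsSelfAdjoint.of_nonneg hk).sub (.of_nonneg hp))
  have hconj : ∀ x : A, 0 ≤ x → 0 ≤ f * x * f := fun x hx => by
    have := star_left_conjugate_nonneg hx f
    rwa [hfs] at this
  have had : a = k - p + d := by rw [hdd]; abel
  refine ⟨f * a * f, hconj a ha, ?_, ?_⟩
  · have h1 : f * d * f ≤ ε • (f * f) := by
      have h2 := CStarAlgebra.star_left_conjugate_le_norm_smul (a := f) (b := d) hds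
      rw [hfs] at h2
      refine h2.trans (smul_le_smul_of_nonneg_right hd ?_)
      have := star_mul_self_nonneg f
      rwa [hfs] at this
    calc f * a * f = f * k * f - f * p * f + f * d * f := by
          rw [had]; simp only [mul_add, mul_sub, add_mul, sub_mul]
      _ ≤ f * k * f - 0 + ε • (f * f) := by
          gcongr
          exact hconj p hp
      _ = (f * k + ε • f) * f := by rw [sub_zero, add_mul, smul_mul_assoc]
      _ = k - ε • f := by rw [hfε, ← hfk, eq_sub_iff_add_eq, hfε]
      _ ≤ k := sub_le_self _ (smul_nonneg hε.le hf)
  · set s := CFC.sqrt a with hs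
    have hss : s * s = a := CFC.sqrt_mul_sqrt_self a ha
    have hsa : star s = s := (IsSelfAdjoint.of_nonneg (CFC.sqrt_nonneg a)).star_eq
    set y := s - f * s with hy
    have hyy : y * star y = a - f * a - a * f + f * a * f := by
      rw [hy, star_sub, star_mul, hfs, hsa, ← hss]
      simp only [mul_sub, sub_mul, mul_assoc]
      abel
    have hp' : 0 ≤ p - f * p - p * f + f * p * f := by
      obtain ⟨q, rfl⟩ := CStarAlgebra.nonneg_iff_eq_star_mul_self.1 hp
      have := star_mul_self_nonneg (q - q * f)
      rw [star_sub, star_mul, hfs] at this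
      refine this.trans_eq ?_
      simp only [mul_sub, sub_mul, mul_assoc]
      abel
    have hk' : k - f * k - k * f + f * k * f = ε • (f - f * f) := by
      have h1 : k - f * k = ε • f := by rw [sub_eq_iff_eq_add', hfε]
      have h2 : k * f - f * k * f = ε • (f * f) := by rw [← sub_mul, h1, smul_mul_assoc]
      rw [smul_sub, ← h1, ← h2]
      abel
    have h1 : y * star y ≤ ε • (f - f * f) + (d - f * d - d * f + f * d * f) := by
      rw [hyy, ← hk', ← sub_nonneg]
      refine hp'.trans_eq ?_
      rw [had]
      simp only [mul_add, mul_sub, add_mul, sub_mul]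
      abel
    have hff : ‖f * f‖ ≤ 1 := (norm_mul_le _ _).trans (mul_le_one₀ hfn (norm_nonneg _) hfn)
    have hfd : ∀ x : A, ‖f * x‖ ≤ ‖x‖ := fun x =>
      (norm_mul_le _ _).trans (mul_le_of_le_one_left (norm_nonneg _) hfn)
    have hdf : ∀ x : A, ‖x * f‖ ≤ ‖x‖ := fun x =>
      (norm_mul_le _ _).trans (mul_le_of_le_one_right (norm_nonneg _) hfn)
    have h2 : ‖y‖ ^ 2 ≤ 6 * ε := by
      rw [sq, ← CStarRing.norm_self_mul_star]
      refine (CStarAlgebra.norm_le_norm_of_nonneg_of_le (mul_star_self_nonneg y) h1).trans ?_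
      have e1 : ‖ε • (f - f * f)‖ ≤ 2 * ε := by
        rw [norm_smul, Real.norm_of_nonneg hε.le]
        have := norm_sub_le f (f * f)
        nlinarith
      have e2 : ‖d - f * d - d * f + f * d * f‖ ≤ 4 * ε := by
        have n1 := norm_add_le (d - f * d - d * f) (f * d * f)
        have n2 := norm_sub_le (d - f * d) (d * f)
        have n3 := norm_sub_le d (f * d)
        have n4 := hfd d
        have n5 := hdf d
        have n6 := hdf (f * d)
        linarith
      have := norm_add_le (ε • (f - f * f)) (d - f * d - d * f + f * d * f)
      linarith
    have h3 : ‖s‖ ^ 2 = ‖a‖ := by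
      rw [sq, ← CStarRing.norm_self_mul_star, hsa, hss]
    have h4 : ‖a - f * a‖ ≤ √(6 * ε * ‖a‖) := by
      have h5 : a - f * a = y * s := by rw [hy, sub_mul, mul_assoc, hss]
      rw [h5]
      refine Real.le_sqrt_of_sq_le (((pow_le_pow_left₀ (norm_nonneg _) (norm_mul_le _ _) 2)).trans ?_)
      rw [mul_pow, h3]
      exact mul_le_mul_of_nonneg_right h2 (norm_nonneg _)
    have h6 : ‖a - a * f‖ = ‖a - f * a‖ := by
      rw [← norm_star, star_sub, star_mul, hfs, (IsSelfAdjoint.of_nonneg ha).star_eq]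
    have h7 : a - f * a * f = (a - f * a) + f * (a - a * f) := by
      rw [mul_sub, mul_assoc]; abel
    rw [h7]
    have := norm_add_le (a - f * a) (f * (a - a * f))
    have := hfd (a - a * f)
    linarith

variable {h : CStarWeight A}

theorem mem_of_mem_closure_sub (hlsc : h.IsLowerSemicontinuous) {c : ℝ} (hc : 0 ≤ c) {a : A}
    (ha : 0 ≤ a)
    (hmem : a ∈ closure {x | ∃ k p, 0 ≤ k ∧ h k ≤ ENNReal.ofReal c ∧ 0 ≤ p ∧ x = k - p}) :
    h a ≤ ENNReal.ofReal c := by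
  have : a ∈ closure {x : A | 0 ≤ x ∧ h x ≤ ENNReal.ofReal c} := by
    rw [Metric.mem_closure_iff]
    intro r hr
    obtain ⟨ε, hε, hεr⟩ : ∃ ε : ℝ, 0 < ε ∧ 2 * √(6 * ε * ‖a‖) < r := by
      have hcont : Tendsto (fun ε : ℝ => 2 * √(6 * ε * ‖a‖)) (𝓝[>] 0) (𝓝 0) := by
        have : Continuous fun ε : ℝ => 2 * √(6 * ε * ‖a‖) := by fun_prop
        have := this.tendsto 0
        simp only [mul_zero, zero_mul, Real.sqrt_zero] at this
        exact this.mono_left nhdsWithin_le_nhds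
      obtain ⟨ε, h1, h2⟩ := ((hcont.eventually_lt_const hr).and self_mem_nhdsWithin).exists
      exact ⟨ε, h2, h1⟩
    obtain ⟨_, ⟨k, p, hk, hkc, hp, rfl⟩, hx⟩ := Metric.mem_closure_iff.1 hmem ε hε
    rw [dist_eq_norm] at hx
    obtain ⟨b, hb, hbk, hab⟩ := exists_compression ha hk hp hε hx.le
    exact ⟨b, ⟨hb, (h.mono hb hbk).trans hkc⟩, by rw [dist_eq_norm]; exact hab.trans_lt hεr⟩
  exact ((hlsc c hc).closure_subset this).2

/-- A lower semicontinuous weight is the supremum of the positive functionals it dominates. -/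
theorem exists_functional_le_weight (hlsc : h.IsLowerSemicontinuous) {a : A} (ha : 0 ≤ a) {c : ℝ}
    (hc : 0 < c) (hac : ENNReal.ofReal c < h a) :
    ∃ ω : StrongDual ℂ A, IsPositiveFunctional ω ∧ c < (ω a).re ∧
      ∀ x, 0 ≤ x → h x < ∞ → (ω x).re ≤ (h x).toReal := by
  set s : Set A := {x | ∃ k p, 0 ≤ k ∧ h k ≤ ENNReal.ofReal c ∧ 0 ≤ p ∧ x = k - p} with hs
  have hconv : Convex ℝ s := by
    rintro _ ⟨k, p, hk, hkc, hp, rfl⟩ _ ⟨k', p', hk', hkc', hp', rfl⟩ u v hu hv huv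
    refine ⟨u • k + v • k', u • p + v • p', add_nonneg (smul_nonneg hu hk) (smul_nonneg hv hk'), ?_,
      add_nonneg (smul_nonneg hu hp) (smul_nonneg hv hp'), by rw [smul_sub, smul_sub]; abel⟩
    rw [h.map_add _ _ (smul_nonneg hu hk) (smul_nonneg hv hk'), ← Complex.coe_smul,
      ← Complex.coe_smul, h.map_smul _ _ hu hk, h.map_smul _ _ hv hk']
    calc _ ≤ ENNReal.ofReal u * ENNReal.ofReal c + ENNReal.ofReal v * ENNReal.ofReal c := by gcongr
      _ = ENNReal.ofReal c := by
        rw [← add_mul, ← ENNReal.ofReal_add hu hv, huv, ENNReal.ofReal_one, one_mul]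
  have hnot : a ∉ closure s := fun hmem =>
    hac.not_ge (mem_of_mem_closure_sub hlsc hc.le ha hmem)
  obtain ⟨f, u, hfu, hua⟩ := RCLike.geometric_hahn_banach_closed_point (𝕜 := ℂ) hconv.closure
    isClosed_closure hnot
  have hfs : ∀ k p, 0 ≤ k → h k ≤ ENNReal.ofReal c → 0 ≤ p → (f k).re - (f p).re < u := by
    intro k p hk hkc hp
    have := hfu (k - p) (subset_closure ⟨k, p, hk, hkc, hp, rfl⟩)
    rwa [map_sub, map_sub] at this
  have hu : 0 < u := by
    have := hfs 0 0 le_rfl (by rw [h.map_zero]; exact zero_le) le_rfl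
    simpa using this
  have hreal : ∀ (r : ℝ) (x : A), (f ((r : ℂ) • x)).re = r * (f x).re := by
    intro r x
    rw [map_smul, smul_eq_mul, Complex.re_ofReal_mul]
  have hpos : ∀ p, 0 ≤ p → 0 ≤ (f p).re := by
    intro p hp
    by_contra! hneg
    have h1 := hfs 0 (((u / -(f p).re : ℝ) : ℂ) • p) le_rfl (by rw [h.map_zero]; exact zero_le)
      (CStarWeight.nonneg_smul (div_nonneg hu.le (by linarith)) hp)
    rw [hreal, map_zero, Complex.zero_re, div_neg, neg_mul, div_mul_cancel₀ _ hneg.ne] at h1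
    simp at h1
  have hfk : ∀ k, 0 ≤ k → h k ≤ ENNReal.ofReal c → (f k).re ≤ u := by
    intro k hk hkc
    have := hfs k 0 hk hkc le_rfl
    rw [map_zero, Complex.zero_re, sub_zero] at this
    exact this.le
  have hcu : 0 ≤ c / u := (div_pos hc hu).le
  refine ⟨((c / u : ℝ) : ℂ) • selfAdjointPart f, fun x hx => ?_, ?_, fun x hx hxfin => ?_⟩
  · rw [smul_apply, selfAdjointPart_apply f (.of_nonneg hx), smul_eq_mul, ← Complex.ofReal_mul]
    exact_mod_cast mul_nonneg hcu (hpos x hx)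
  · rw [smul_apply, selfAdjointPart_apply f (.of_nonneg ha), smul_eq_mul, ← Complex.ofReal_mul,
      Complex.ofReal_re, div_mul_eq_mul_div, lt_div_iff₀ hu]
    exact mul_lt_mul_of_pos_left hua hc
  · rw [smul_apply, selfAdjointPart_apply f (.of_nonneg hx), smul_eq_mul, ← Complex.ofReal_mul,
      Complex.ofReal_re]
    have key : ∀ r : ℝ, 0 ≤ r → r * (h x).toReal ≤ c → r * (f x).re ≤ u := by
      intro r hr hrc
      rw [← hreal]
      refine hfk _ (CStarWeight.nonneg_smul hr hx) ?_
      rw [h.map_smul _ _ hr hx, ← ENNReal.ofReal_toReal hxfin.ne, ← ENNReal.ofReal_mul hr]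
      exact ENNReal.ofReal_le_ofReal hrc
    rcases (ENNReal.toReal_nonneg (a := h x)).eq_or_lt with h0 | h0
    · rw [← h0]
      have hx0 : (f x).re = 0 := by
        refine le_antisymm ?_ (hpos x hx)
        by_contra! hlt
        have := key (2 * u / (f x).re) (by positivity) (by rw [← h0, mul_zero]; exact hc.le)
        rw [div_mul_cancel₀ _ hlt.ne'] at this
        linarith
      rw [hx0, mul_zero]
    · have h1 := key (c / (h x).toReal) (by positivity) (by rw [div_mul_cancel₀ _ h0.ne'])
      rw [div_mul_eq_mul_div, div_le_iff₀ h0] at h1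
      rw [div_mul_eq_mul_div, div_le_iff₀ hu]
      linarith

end LowerSemicontinuity

end QG

namespace QG

section MatrixElements

variable {A : Type*} [NonUnitalCStarAlgebra A] [PartialOrder A] [StarOrderedRing A]
  {δ : A →⋆ₙₐ[ℂ] 𝓜(ℂ, MinTensor A A)} {h : CStarWeight A}

/-- `ω` is a positive functional dominated by the weight `h`. -/
structure IsDominated (h : CStarWeight A) (ω : StrongDual ℂ A) : Prop where
  positive : IsPositiveFunctional ω
  le : ∀ x, 0 ≤ x → h x < ∞ → (ω x).re ≤ (h x).toReal

theorem IsDominated.norm_apply_le {ω : StrongDual ℂ A} (hω : IsDominated h ω) (a b : h.nIdeal) :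
    ‖ω (star (b : A) * a)‖ ≤ ‖h.eta b‖ * ‖h.eta a‖ := by
  have hn : ∀ c : h.nIdeal, ‖ω (star (c : A) * c)‖ ≤ ‖h.eta c‖ ^ 2 := fun c => by
    rw [norm_eta_sq, hω.positive.norm_apply_eq_re (star_mul_self_nonneg _)]
    exact hω.le _ (star_mul_self_nonneg _) c.2
  refine le_of_sq_le_sq ?_ (by positivity)
  rw [mul_pow]
  exact (hω.positive.cauchy_schwarz _ _).trans
    (mul_le_mul (hn b) (hn a) (norm_nonneg _) (sq_nonneg _))

/-- `x ∈ H` represents the functional `η(a) ↦ ω(b⋆a)`. -/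
def Represents (h : CStarWeight A) (ω : StrongDual ℂ A) (b : h.nIdeal) (x : h.GNS) : Prop :=
  ∀ a : h.nIdeal, inner ℂ x (h.eta a) = ω (star (b : A) * a)

theorem IsDominated.exists_represents {ω : StrongDual ℂ A} (hω : IsDominated h ω) (b : h.nIdeal) :
    ∃ x : h.GNS, Represents h ω b x ∧ ‖x‖ ≤ ‖h.eta b‖ := by
  obtain ⟨x, hx, hin⟩ := exists_vector_of_bounded (E := h.PreGNS)
    ((ω.toLinearMap.comp (LinearMap.mulLeft ℂ (star (b : A)))).comp
      (h.nIdeal.subtype.comp h.toPreGNS.symm.toLinearMap)) (norm_nonneg (h.eta b)) fun y => by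
      have := hω.norm_apply_le (h.toPreGNS.symm y) b
      rw [← norm_toPreGNS (h.toPreGNS.symm y), LinearEquiv.apply_symm_apply] at this
      exact this
  exact ⟨x, fun a => hin (h.toPreGNS a), hx⟩

theorem dense_span_represents (hlsc : h.IsLowerSemicontinuous) :
    Dense (Submodule.span ℂ {x : h.GNS | ∃ ω b, IsDominated h ω ∧ Represents h ω b x} :
      Set h.GNS) := by
  rw [Submodule.dense_iff_topologicalClosure_eq_top, Submodule.topologicalClosure_eq_top_iff,
    Submodule.eq_bot_iff]
  intro z hz
  have hz0 : ∀ x : h.GNS, (∃ ω b, IsDominated h ω ∧ Represents h ω b x) → inner ℂ x z = 0 :=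
    fun x hx => (Submodule.mem_orthogonal _ z).1 hz x (Submodule.subset_span hx)
  have key : ∀ a : h.nIdeal, ‖h.eta a‖ ≤ ‖h.eta a - z‖ := by
    intro a
    by_contra! hlt
    have hpos : 0 < ‖h.eta a‖ := (norm_nonneg _).trans_lt hlt
    obtain ⟨c, hc1, hc2⟩ := exists_between (mul_lt_mul_of_pos_left hlt hpos)
    have hc : 0 < c := lt_of_le_of_lt (by positivity) hc1
    have hac : ENNReal.ofReal c < h (star (a : A) * a) := by
      rw [ENNReal.ofReal_lt_iff_lt_toReal hc.le (ne_of_lt a.2), ← norm_eta_sq, sq]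
      exact hc2
    obtain ⟨ω, hω, hωa, hωle⟩ := exists_functional_le_weight hlsc (star_mul_self_nonneg _) hc hac
    obtain ⟨x, hx, hxn⟩ := IsDominated.exists_represents ⟨hω, hωle⟩ a
    have h1 : (ω (star (a : A) * a)).re ≤ ‖h.eta a‖ * ‖h.eta a - z‖ := by
      rw [← hx a, ← sub_zero (inner ℂ x (h.eta a)), ← hz0 x ⟨ω, a, ⟨hω, hωle⟩, hx⟩,
        ← inner_sub_right]
      exact (Complex.re_le_norm _).trans ((norm_inner_le_norm _ _).trans
        (mul_le_mul_of_nonneg_right hxn (norm_nonneg _)))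
    linarith
  have hz1 : ‖z‖ ≤ ‖z - z‖ := by
    refine denseRange_eta.induction_on (p := fun y => ‖y‖ ≤ ‖y - z‖) z
      (isClosed_le (by fun_prop) (by fun_prop)) key
  simpa using hz1

/-- The functional `φ ↦ (x|W_φ y)` on `A*`. -/
def matrixFunctional (hδ : IsProper δ) (hinv : h.IsRightInvariant δ) (x y : h.GNS) :
    StrongDual ℂ (StrongDual ℂ A) :=
  LinearMap.mkContinuous
    { toFun := fun φ => inner ℂ x (convOp δ h φ y)
      map_add' := fun φ ψ => by rw [convOp_add hδ hinv, add_apply, inner_add_right]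
      map_smul' := fun c φ => by
        rw [convOp_smul hδ hinv, smul_apply, inner_smul_right]; rfl }
    (8 * ‖x‖ * ‖y‖) fun φ => by
      refine (norm_inner_le_norm x (convOp δ h φ y)).trans ?_
      calc ‖x‖ * ‖convOp δ h φ y‖ ≤ ‖x‖ * (8 * ‖φ‖ * ‖y‖) :=
            mul_le_mul_of_nonneg_left ((convOp δ h φ).le_of_opNorm_le (norm_convOp_le hδ hinv φ) y)
              (norm_nonneg _)
        _ = 8 * ‖x‖ * ‖y‖ * ‖φ‖ := by ring

theorem matrixFunctional_apply (hδ : IsProper δ) (hinv : h.IsRightInvariant δ) (x y : h.GNS)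
    (φ : StrongDual ℂ A) : matrixFunctional hδ hinv x y φ = inner ℂ x (convOp δ h φ y) := rfl

theorem norm_matrixFunctional_le (hδ : IsProper δ) (hinv : h.IsRightInvariant δ) (x y : h.GNS) :
    ‖matrixFunctional hδ hinv x y‖ ≤ 8 * ‖x‖ * ‖y‖ :=
  LinearMap.mkContinuous_norm_le _ (by positivity) _

/-- The continuous linear map `y ↦ (φ ↦ (x|W_φ y))`. -/
def matrixFunctionalRight (hδ : IsProper δ) (hinv : h.IsRightInvariant δ) (x : h.GNS) :
    h.GNS →L[ℂ] StrongDual ℂ (StrongDual ℂ A) :=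
  LinearMap.mkContinuous
    { toFun := matrixFunctional hδ hinv x
      map_add' := fun y z => by
        ext φ
        rw [add_apply, matrixFunctional_apply, matrixFunctional_apply, matrixFunctional_apply,
          map_add, inner_add_right]
      map_smul' := fun c y => by
        ext φ
        rw [RingHom.id_apply, smul_apply, matrixFunctional_apply, matrixFunctional_apply, map_smul,
          inner_smul_right]
        rfl }
    (8 * ‖x‖) fun y => norm_matrixFunctional_le hδ hinv x y

/-- The continuous conjugate linear map `x ↦ (φ ↦ (x|W_φ y))`. -/
def matrixFunctionalLeft (hδ : IsProper δ) (hinv : h.IsRightInvariant δ) (y : h.GNS) :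
    h.GNS →L⋆[ℂ] StrongDual ℂ (StrongDual ℂ A) :=
  LinearMap.mkContinuous
    { toFun := fun x => matrixFunctional hδ hinv x y
      map_add' := fun x z => by
        ext φ
        rw [add_apply, matrixFunctional_apply, matrixFunctional_apply, matrixFunctional_apply,
          inner_add_left]
      map_smul' := fun c x => by
        ext φ
        rw [smul_apply, matrixFunctional_apply, matrixFunctional_apply, inner_smul_left]
        rfl }
    (8 * ‖y‖) fun x => (norm_matrixFunctional_le hδ hinv x y).trans (le_of_eq (by ring))

theorem exists_isMatrixElement_of_represents (hδ : IsProper δ) (hinv : h.IsRightInvariant δ)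
    {ω : StrongDual ℂ A} {b : h.nIdeal} {x : h.GNS} (hx : Represents h ω b x) (y : h.GNS) :
    ∃ w, IsMatrixElement δ h x y w := by
  refine exists_of_mem_closure_span (matrixFunctionalRight hδ hinv x) (Set.range h.eta)
    (denseRange_eta.mono Submodule.subset_span) ?_ y
  rintro _ ⟨a, rfl⟩
  obtain ⟨w, hw⟩ := exists_leftSlice_conv hδ ω a (star (b : A))
  refine ⟨w, fun φ => ?_⟩
  change _ = inner ℂ x (convOp δ h φ (h.eta a))
  rw [hw, convOp_eta hδ hinv, hx]

theorem exists_isMatrixElement (hδ : IsProper δ) (hinv : h.IsRightInvariant δ)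
    (hlsc : h.IsLowerSemicontinuous) (x y : h.GNS) : ∃ w, IsMatrixElement δ h x y w := by
  have hcl : IsClosed {x : h.GNS | ∃ w, IsMatrixElement δ h x y w} := by
    have h1 : IsClosed (matrixFunctionalLeft hδ hinv y ⁻¹'
        Set.range (NormedSpace.inclusionInDoubleDual ℂ A)) :=
      isClosed_range_inclusionInDoubleDual.preimage (ContinuousLinearMap.continuous _)
    convert h1 using 1
    ext x
    exact exists_congr fun w =>
      ⟨fun hw => ContinuousLinearMap.ext hw, fun hw φ => congrArg (fun F => F φ) hw⟩
  refine hcl.closure_subset_iff.2 (fun x hx => ?_) (dense_span_represents hlsc x)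
  induction hx using Submodule.span_induction with
  | mem x hx =>
    obtain ⟨ω, b, -, hx⟩ := hx
    exact exists_isMatrixElement_of_represents hδ hinv hx y
  | zero => exact ⟨0, fun φ => by rw [map_zero, inner_zero_left]⟩
  | add x z _ _ h1 h2 =>
    obtain ⟨u, hu⟩ := h1
    obtain ⟨v, hv⟩ := h2
    exact ⟨u + v, fun φ => by rw [map_add, hu, hv, inner_add_left]⟩
  | smul c x _ h1 =>
    obtain ⟨u, hu⟩ := h1
    exact ⟨starRingEnd ℂ c • u, fun φ => by rw [map_smul, hu, inner_smul_left, smul_eq_mul]⟩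

theorem existsUnique_isMatrixElement (hδ : IsProper δ) (hinv : h.IsRightInvariant δ)
    (hlsc : h.IsLowerSemicontinuous) (x y : h.GNS) : ∃! w, IsMatrixElement δ h x y w := by
  obtain ⟨w, hw⟩ := exists_isMatrixElement hδ hinv hlsc x y
  exact ⟨w, hw, fun v hv =>
    (SeparatingDual.eq_iff_forall_dual_eq (R := ℂ)).2 fun φ => (hv φ).trans (hw φ).symm⟩

theorem apply_matrixElement (hδ : IsProper δ) (hinv : h.IsRightInvariant δ)
    (hlsc : h.IsLowerSemicontinuous) (x y : h.GNS) (φ : StrongDual ℂ A) :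
    φ (matrixElement δ h x y) = inner ℂ x (convOp δ h φ y) :=
  (Classical.epsilon_spec (exists_isMatrixElement hδ hinv hlsc x y) :
    IsMatrixElement δ h x y (matrixElement δ h x y)) φ

end MatrixElements

end QG

namespace QG

section Annihilators

theorem exists_dual_eq_zero_of_notMem {E : Type*} [AddCommGroup E] [Module ℂ E] [Module ℝ E]
    [IsScalarTower ℝ ℂ E] [TopologicalSpace E] [IsTopologicalAddGroup E] [ContinuousSMul ℂ E]
    [LocallyConvexSpace ℝ E] {S : Submodule ℂ E} (hS : IsClosed (S : Set E)) {x : E}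
    (hx : x ∉ S) : ∃ f : StrongDual ℂ E, (∀ a ∈ S, f a = 0) ∧ f x ≠ 0 := by
  have hconv : Convex ℝ (S : Set E) := (S.restrictScalars ℝ).convex
  obtain ⟨f, u, hf, hu⟩ := RCLike.geometric_hahn_banach_closed_point (𝕜 := ℂ) hconv hS hx
  have h0 : ∀ a ∈ S, f a = 0 := by
    intro a ha
    by_contra hne
    have h1 := hf (((u / ‖f a‖ ^ 2 : ℝ) : ℂ) • (starRingEnd ℂ (f a)) • a)
      (S.smul_mem _ (S.smul_mem _ ha))
    have h2 : starRingEnd ℂ (f a) * f a = ((‖f a‖ ^ 2 : ℝ) : ℂ) := by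
      rw [mul_comm, Complex.mul_conj, Complex.normSq_eq_norm_sq]
    rw [f.map_smul, f.map_smul, smul_eq_mul, smul_eq_mul, h2, ← Complex.ofReal_mul,
      div_mul_cancel₀ _ (pow_ne_zero 2 (norm_ne_zero_iff.2 hne))] at h1
    exact lt_irrefl _ h1
  refine ⟨f, h0, fun hfx => ?_⟩
  have h1 := hf 0 S.zero_mem
  rw [map_zero] at h1
  rw [hfx] at hu
  exact lt_asymm h1 hu

/-- A subspace of the dual space that separates the points is weak* dense. -/
theorem dense_toWeakDual_image {E : Type*} [NormedAddCommGroup E] [NormedSpace ℂ E]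
    (D : Submodule ℂ (StrongDual ℂ E)) (hD : ∀ a : E, (∀ φ ∈ D, φ a = 0) → a = 0) :
    Dense (StrongDual.toWeakDual '' (D : Set (StrongDual ℂ E))) := by
  let S : Submodule ℂ (WeakBilin (topDualPairing ℂ E)) :=
    D.map (StrongDual.toWeakDual (𝕜 := ℂ) (E := E)).toLinearMap
  have key : Dense (S : Set (WeakBilin (topDualPairing ℂ E))) := by
    rw [Submodule.dense_iff_topologicalClosure_eq_top, Submodule.eq_top_iff']
    intro x
    by_contra hx
    obtain ⟨f, hf, hfx⟩ :=
      exists_dual_eq_zero_of_notMem (E := WeakBilin (topDualPairing ℂ E))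
        S.isClosed_topologicalClosure hx
    obtain ⟨a, rfl⟩ := LinearMap.dualEmbedding_surjective (topDualPairing ℂ E) f
    have ha : a = 0 := hD a fun φ hφ =>
      hf (StrongDual.toWeakDual φ) (S.le_topologicalClosure ⟨φ, hφ, rfl⟩)
    exact hfx (by rw [ha, map_zero]; rfl)
  exact key

theorem eq_of_dense_toWeakDual {E : Type*} [NormedAddCommGroup E] [NormedSpace ℂ E]
    {D : Set (StrongDual ℂ E)} (hD : Dense (StrongDual.toWeakDual '' D)) {a b : E}
    (hab : ∀ φ ∈ D, φ a = φ b) : a = b := by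
  have h1 : (fun φ : WeakDual ℂ E => φ a) = fun φ => φ b := by
    refine Continuous.ext_on hD (WeakDual.eval_continuous a) (WeakDual.eval_continuous b) ?_
    rintro _ ⟨φ, hφ, rfl⟩
    exact hab φ hφ
  exact (SeparatingDual.eq_iff_forall_dual_eq (R := ℂ)).2 fun φ =>
    congrFun h1 (StrongDual.toWeakDual φ)

end Annihilators

section GaussianConvolution

open MeasureTheory

variable {E : Type*} [NormedAddCommGroup E] [NormedSpace ℂ E]

theorem norm_cexp_neg_sub_sq_le (t : ℝ) {z : ℂ} {M : ℝ} (hz : ‖z‖ ≤ M) :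
    ‖Complex.exp (-((t : ℂ) - z) ^ 2)‖ ≤
      Real.exp (M ^ 2 + 2 * M ^ 2) * Real.exp (-(1 / 2) * t ^ 2) := by
  rw [Complex.norm_exp, ← Real.exp_add, Real.exp_le_exp]
  have h1 : (-((t : ℂ) - z) ^ 2).re = -(t - z.re) ^ 2 + z.im ^ 2 := by
    simp [sq]
    ring
  have h2 : z.re ^ 2 + z.im ^ 2 ≤ M ^ 2 := by
    have := pow_le_pow_left₀ (norm_nonneg z) hz 2
    rwa [← Complex.normSq_eq_norm_sq, Complex.normSq_apply, ← sq, ← sq] at this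
  rw [h1]
  nlinarith [sq_nonneg (t - 2 * z.re), sq_nonneg z.re, sq_nonneg z.im]

theorem norm_mul_cexp_neg_sub_sq_le (t : ℝ) {z : ℂ} {M : ℝ} (hz : ‖z‖ ≤ M) :
    ‖2 * ((t : ℂ) - z) * Complex.exp (-((t : ℂ) - z) ^ 2)‖ ≤
      2 * Real.exp (2 * M + 10 * M ^ 2 + 10) * Real.exp (-(1 / 4) * t ^ 2) := by
  have h0 : ‖(t : ℂ) - z‖ ≤ |t| + M :=
    (norm_sub_le _ _).trans (add_le_add (by simp) hz)
  have h1 : |t| + M ≤ Real.exp (|t| + M) := by linarith [Real.add_one_le_exp (|t| + M)]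
  rw [norm_mul, norm_mul, mul_assoc, mul_assoc]
  refine mul_le_mul (by simp) ?_ (by positivity) (by norm_num)
  refine (mul_le_mul (h0.trans h1) (norm_cexp_neg_sub_sq_le t hz) (by positivity)
    (by positivity)).trans ?_
  rw [← Real.exp_add, ← Real.exp_add, ← Real.exp_add, Real.exp_le_exp]
  have hM : 0 ≤ M := (norm_nonneg z).trans hz
  nlinarith [sq_abs t, sq_nonneg (|t| - 2), sq_nonneg M]

theorem integrable_gaussian_smul {u : ℝ → E} (hu : Continuous u) {C : ℝ} (hC : ∀ t, ‖u t‖ ≤ C)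
    (z : ℂ) : Integrable fun t : ℝ => Complex.exp (-((t : ℂ) - z) ^ 2) • u t := by
  refine Integrable.mono' (((integrable_exp_neg_mul_sq (b := 1 / 2) (by norm_num)).const_mul
    (Real.exp (‖z‖ ^ 2 + 2 * ‖z‖ ^ 2))).mul_const C) (by fun_prop) (.of_forall fun t => ?_)
  rw [norm_smul]
  exact mul_le_mul (norm_cexp_neg_sub_sq_le t le_rfl) (hC t) (norm_nonneg _) (by positivity)

theorem differentiable_gaussian_convolution {u : ℝ → E} (hu : Continuous u) {C : ℝ}
    (hC : ∀ t, ‖u t‖ ≤ C) :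
    Differentiable ℂ fun z : ℂ => ∫ t : ℝ, Complex.exp (-((t : ℂ) - z) ^ 2) • u t := by
  intro z₀
  refine (hasDerivAt_integral_of_dominated_loc_of_deriv_le (𝕜 := ℂ) (μ := volume)
    (F' := fun z (t : ℝ) => (2 * ((t : ℂ) - z) * Complex.exp (-((t : ℂ) - z) ^ 2)) • u t)
    (bound := fun t => 2 * Real.exp (2 * (‖z₀‖ + 1) + 10 * (‖z₀‖ + 1) ^ 2 + 10) *
      Real.exp (-(1 / 4) * t ^ 2) * C)
    (Metric.ball_mem_nhds z₀ one_pos) (.of_forall fun z => by fun_prop)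
    (integrable_gaussian_smul hu hC z₀) (by fun_prop) (.of_forall fun t z hz => ?_)
    (((integrable_exp_neg_mul_sq (by norm_num)).const_mul _).mul_const C)
    (.of_forall fun t z _ => ?_)).2.differentiableAt
  · rw [norm_smul]
    refine mul_le_mul (norm_mul_cexp_neg_sub_sq_le t ?_) (hC t) (norm_nonneg _) (by positivity)
    have := norm_sub_norm_le z z₀
    rw [mem_ball_iff_norm] at hz
    linarith
  · refine HasDerivAt.smul_const ?_ (u t)
    have h1 : HasDerivAt (fun z : ℂ => (t : ℂ) - z) (-1) z := (hasDerivAt_id z).const_sub _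
    refine (h1.pow 2).neg.cexp.congr_deriv ?_
    simp
    ring

end GaussianConvolution

section OneParameterGroups

open MeasureTheory

variable {A : Type*} [NonUnitalCStarAlgebra A] {τ : ℝ → A ≃⋆ₐ[ℂ] A}

/-- A ⋆-automorphism as a bounded linear map. -/
def automorphismCLM (α : A ≃⋆ₐ[ℂ] A) : A →L[ℂ] A :=
  LinearMap.mkContinuous
    { toFun := α
      map_add' := map_add α
      map_smul' := map_smul α } 1
    fun a => (NonUnitalStarAlgHom.norm_apply_le α a).trans_eq (one_mul _).symm

@[simp]
theorem automorphismCLM_apply (α : A ≃⋆ₐ[ℂ] A) (a : A) : automorphismCLM α a = α a := rfl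

theorem norm_automorphism_apply_le (α : A ≃⋆ₐ[ℂ] A) (a : A) : ‖α a‖ ≤ ‖a‖ :=
  NonUnitalStarAlgHom.norm_apply_le α a

theorem IsOneParameterGroup.continuous (hτ : IsOneParameterGroup τ) (a : A) :
    Continuous fun t => τ t a := by
  refine continuous_iff_continuousAt.2 fun s => ?_
  have h1 : Tendsto (fun t : ℝ => t - s) (𝓝 s) (𝓝 0) := by
    have : Continuous fun t : ℝ => t - s := by fun_prop
    simpa using this.tendsto s
  have h2 := ((automorphismCLM (τ s)).continuous.tendsto a).comp ((hτ.tendsto a).comp h1)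
  refine h2.congr fun t => ?_
  rw [Function.comp_apply, Function.comp_apply, automorphismCLM_apply, ← hτ.map_add,
    add_sub_cancel]

/-- The Gaussian mean `∫ exp(-t²) τ_{εt}(a) dt`. -/
def smear (τ : ℝ → A ≃⋆ₐ[ℂ] A) (ε : ℝ) (a : A) : A :=
  ∫ t : ℝ, Complex.exp (-(t : ℂ) ^ 2) • τ (ε * t) a

theorem IsOneParameterGroup.integrable_smear (hτ : IsOneParameterGroup τ) (ε : ℝ) (a : A) :
    Integrable fun t : ℝ => Complex.exp (-(t : ℂ) ^ 2) • τ (ε * t) a := by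
  simpa using integrable_gaussian_smul (u := fun t => τ (ε * t) a)
    ((hτ.continuous a).comp (by fun_prop)) (fun t => norm_automorphism_apply_le _ a) 0

theorem IsOneParameterGroup.apply_smear (hτ : IsOneParameterGroup τ) (ε : ℝ) (a : A)
    (φ : StrongDual ℂ A) :
    φ (smear τ ε a) = ∫ t : ℝ, Complex.exp (-(t : ℂ) ^ 2) • φ (τ (ε * t) a) := by
  rw [smear, ← ContinuousLinearMap.integral_comp_comm φ (hτ.integrable_smear ε a)]
  simp only [map_smul]

theorem IsOneParameterGroup.isAnalyticValue_smear (hτ : IsOneParameterGroup τ) {ε : ℝ}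
    (hε : 0 < ε) (s : ℝ) (a : A) : ∃ b, IsAnalyticValue τ s (smear τ ε a) b := by
  have hd := differentiable_gaussian_convolution (u := fun t => τ (ε * t) a)
    ((hτ.continuous a).comp (by fun_prop)) (fun t => norm_automorphism_apply_le _ a)
  have hF := hd.comp (differentiable_id.div_const (ε : ℂ))
  refine ⟨_, _, hF.continuous.continuousOn, hF.differentiableOn, fun r => ?_, rfl⟩
  have h1 : τ r (smear τ ε a) = ∫ t : ℝ, Complex.exp (-(t : ℂ) ^ 2) • τ (ε * t + r) a := by
    rw [smear, ← automorphismCLM_apply,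
      ← ContinuousLinearMap.integral_comp_comm _ (hτ.integrable_smear ε a)]
    simp only [map_smul, automorphismCLM_apply, ← hτ.map_add, add_comm]
  rw [h1, ← integral_sub_right_eq_self _ (r / ε)]
  refine integral_congr_ae (.of_forall fun t => ?_)
  have h2 : ε * (t - r / ε) + r = ε * t := by field_simp; ring
  simp only [h2]
  push_cast
  rfl

theorem IsOneParameterGroup.tendsto_smear (hτ : IsOneParameterGroup τ) (a : A) :
    Tendsto (fun ε => smear τ ε a) (𝓝[>] 0)
      (𝓝 ((∫ t : ℝ, Complex.exp (-(t : ℂ) ^ 2)) • a)) := by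
  rw [← integral_smul_const]
  refine tendsto_integral_filter_of_dominated_convergence
    (fun t => ‖Complex.exp (-(t : ℂ) ^ 2)‖ * ‖a‖)
    (.of_forall fun ε => (hτ.integrable_smear ε a).aestronglyMeasurable)
    (.of_forall fun ε => .of_forall fun t => ?_) ?_ (.of_forall fun t => ?_)
  · rw [norm_smul]
    exact mul_le_mul_of_nonneg_left (norm_automorphism_apply_le _ a) (norm_nonneg _)
  · have := integrable_cexp_neg_mul_sq (b := 1) (by simp)
    simp only [neg_mul, one_mul] at this
    exact this.norm.mul_const _
  · refine Tendsto.const_smul ?_ _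
    have h1 : Tendsto (fun ε : ℝ => ε * t) (𝓝[>] 0) (𝓝 0) := by
      have : Continuous fun ε : ℝ => ε * t := by fun_prop
      simpa using (this.tendsto 0).mono_left nhdsWithin_le_nhds
    exact (hτ.tendsto a).comp h1

end OneParameterGroups

end QG

namespace QG

section Antipode

variable {A : Type*} [NonUnitalCStarAlgebra A] {κ : A →ₗ.[ℂ] A} {R : A →ₗ[ℂ] A}
  {τ : ℝ → A ≃⋆ₐ[ℂ] A}

theorem IsCompAntipode.apply_of_mem_graph {φ ψ : StrongDual ℂ A} (hφψ : IsCompAntipode κ φ ψ)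
    {a c : A} (hac : (a, c) ∈ κ.graph) : ψ a = φ c := by
  obtain ⟨y, rfl, rfl⟩ := (LinearPMap.mem_graph_iff κ).1 hac
  exact hφψ y

theorem IsCompAntipode.of_graph {φ ψ : StrongDual ℂ A}
    (hφψ : ∀ a c, (a, c) ∈ κ.graph → ψ a = φ c) : IsCompAntipode κ φ ψ :=
  fun a => hφψ _ _ (κ.mem_graph a)

theorem IsCompAntipode.unique (hdense : Dense (κ.domain : Set A)) {φ ψ ψ' : StrongDual ℂ A}
    (hψ : IsCompAntipode κ φ ψ) (hψ' : IsCompAntipode κ φ ψ') : ψ = ψ' :=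
  DFunLike.coe_injective <| Continuous.ext_on hdense ψ.continuous ψ'.continuous fun a ha =>
    (hψ ⟨a, ha⟩).trans (hψ' ⟨a, ha⟩).symm

variable (κ) in
/-- The space of all `φ ∈ A*` with `φ ∘ κ ∈ A*`. -/
def compAntipodeDomain : Submodule ℂ (StrongDual ℂ A) where
  carrier := {φ | ∃ ψ, IsCompAntipode κ φ ψ}
  zero_mem' := ⟨0, fun _ => rfl⟩
  add_mem' := by
    rintro φ φ' ⟨ψ, hψ⟩ ⟨ψ', hψ'⟩
    exact ⟨ψ + ψ', fun a => congrArg₂ (· + ·) (hψ a) (hψ' a)⟩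
  smul_mem' := by
    rintro c φ ⟨ψ, hψ⟩
    exact ⟨c • ψ, fun a => congrArg (c • ·) (hψ a)⟩

/-- As `κ` is closed, there are weak* densely many `φ ∈ A*` with `φ ∘ κ ∈ A*`. -/
theorem dense_compAntipodeDomain (hclosed : κ.IsClosed) :
    Dense (StrongDual.toWeakDual '' (compAntipodeDomain κ : Set (StrongDual ℂ A))) := by
  refine dense_toWeakDual_image _ fun a ha => ?_
  by_contra hne
  have hmem : ((0, a) : A × A) ∉ κ.graph := fun h0 => hne (κ.graph_fst_eq_zero_snd h0 rfl)
  obtain ⟨f, hf, hfa⟩ := exists_dual_eq_zero_of_notMem hclosed hmem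
  refine hfa (ha (f.comp (ContinuousLinearMap.inr ℂ A A))
    ⟨-f.comp (ContinuousLinearMap.inl ℂ A A), .of_graph fun x c hxc => ?_⟩)
  have h1 : f (x, 0) + f (0, c) = 0 := by
    rw [← map_add, Prod.mk_add_mk, add_zero, zero_add]
    exact hf _ hxc
  exact (eq_neg_of_add_eq_zero_right h1).symm

theorem IsPolarDecomposition.mem_graph (hpolar : IsPolarDecomposition κ R τ) (t : ℝ) {a c : A}
    (hac : (a, c) ∈ κ.graph) : (τ t a, τ t c) ∈ κ.graph := by
  rw [hpolar.graph] at hac ⊢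
  obtain ⟨b, ⟨F, hc, hd, hF, hb⟩, rfl⟩ := hac
  refine ⟨τ t b, ⟨fun z => automorphismCLM (τ t) (F z),
    (automorphismCLM (τ t)).continuous.comp_continuousOn hc,
    (automorphismCLM (τ t)).differentiable.comp_differentiableOn hd, fun s => ?_, ?_⟩, ?_⟩
  · beta_reduce
    rw [automorphismCLM_apply, hF, ← hpolar.group.map_add, ← hpolar.group.map_add, add_comm]
  · beta_reduce
    rw [automorphismCLM_apply, hb]
  · exact (hpolar.commute t b).symm

theorem IsPolarDecomposition.isCompAntipode (hpolar : IsPolarDecomposition κ R τ) (t : ℝ)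
    {φ ψ : StrongDual ℂ A} (hφψ : IsCompAntipode κ φ ψ) :
    IsCompAntipode κ (φ.comp (automorphismCLM (τ t))) (ψ.comp (automorphismCLM (τ t))) :=
  .of_graph fun _ _ hac => hφψ.apply_of_mem_graph (hpolar.mem_graph t hac)

theorem IsPolarDecomposition.exists_smear_mem_graph (hpolar : IsPolarDecomposition κ R τ) {ε : ℝ}
    (hε : 0 < ε) (a : A) : ∃ c, (smear τ ε a, c) ∈ κ.graph := by
  obtain ⟨b, hb⟩ := hpolar.group.isAnalyticValue_smear hε (1 / 2) a
  exact ⟨R b, (hpolar.graph _ _).2 ⟨b, hb, rfl⟩⟩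

/-- If `φ(v) = (φ ∘ κ)(w)` for all `φ` in a weak* dense set that is invariant under `τ`, then
`κ(w) = v`. -/
theorem IsPolarDecomposition.mem_graph_of_dense (hpolar : IsPolarDecomposition κ R τ)
    (hclosed : κ.IsClosed) (hdense : Dense (κ.domain : Set A)) {D : Set (StrongDual ℂ A)}
    (hD : Dense (StrongDual.toWeakDual '' D))
    (hτ : ∀ φ ∈ D, ∀ t : ℝ, ∃ φ' ∈ D, ∀ a, φ' a = φ (τ t a)) {w v : A}
    (hwv : ∀ φ ∈ D, ∃ ψ : StrongDual ℂ A, IsCompAntipode κ φ ψ ∧ ψ w = φ v) :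
    (w, v) ∈ κ.graph := by
  have hsmear : ∀ ε : ℝ, 0 < ε → (smear τ ε w, smear τ ε v) ∈ κ.graph := by
    intro ε hε
    obtain ⟨c, hc⟩ := hpolar.exists_smear_mem_graph hε w
    suffices c = smear τ ε v by rwa [← this]
    refine eq_of_dense_toWeakDual hD fun φ hφ => ?_
    obtain ⟨ψ, hψ, -⟩ := hwv φ hφ
    rw [← hψ.apply_of_mem_graph hc, hpolar.group.apply_smear, hpolar.group.apply_smear]
    refine MeasureTheory.integral_congr_ae (.of_forall fun t => ?_)
    obtain ⟨φ', hφ', hφ'τ⟩ := hτ φ hφ (ε * t)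
    obtain ⟨ψ', hψ', hψ'w⟩ := hwv φ' hφ'
    obtain rfl : φ' = φ.comp (automorphismCLM (τ (ε * t))) := ContinuousLinearMap.ext hφ'τ
    obtain rfl := hψ'.unique hdense (hpolar.isCompAntipode (ε * t) hψ)
    exact congrArg _ hψ'w
  set c : ℂ := ∫ t : ℝ, Complex.exp (-(t : ℂ) ^ 2) with hc
  have hc0 : c ≠ 0 := by
    have := integral_gaussian_complex (b := 1) (by simp)
    simp only [neg_mul, one_mul] at this
    rw [hc, this]
    simp [Complex.cpow_eq_zero_iff, Real.pi_ne_zero]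
  have hlim : (c • w, c • v) ∈ κ.graph := by
    have hcl : IsClosed (κ.graph : Set (A × A)) := hclosed
    refine hcl.mem_of_tendsto
      ((hpolar.group.tendsto_smear w).prodMk_nhds (hpolar.group.tendsto_smear v)) ?_
    filter_upwards [self_mem_nhdsWithin] with ε hε using hsmear ε hε
  simpa [smul_smul, hc0] using κ.graph.smul_mem c⁻¹ hlim

end Antipode

section StrongRightInvariance

variable {A : Type*} [NonUnitalCStarAlgebra A] [PartialOrder A] [StarOrderedRing A]
  {δ : A →⋆ₙₐ[ℂ] 𝓜(ℂ, MinTensor A A)} {h : CStarWeight A} {κ : A →ₗ.[ℂ] A} {R : A →ₗ[ℂ] A}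
  {τ : ℝ → A ≃⋆ₐ[ℂ] A}

theorem starFunctional_starFunctional (φ : StrongDual ℂ A) :
    starFunctional (starFunctional φ) = φ := by
  ext a
  simp [starFunctional_apply]

theorem eq_adjoint_iff_inner_eta {S T : h.GNS →L[ℂ] h.GNS} :
    S = T.adjoint ↔ ∀ a b : h.nIdeal,
      inner ℂ (S (h.eta a)) (h.eta b) = inner ℂ (h.eta a) (T (h.eta b)) := by
  rw [ContinuousLinearMap.eq_adjoint_iff]
  refine ⟨fun H a b => H _ _, fun H x y => ?_⟩
  refine (denseRange_eta (h := h)).induction_on₂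
    (p := fun x y => inner ℂ (S x) y = inner ℂ x (T y)) ?_ H x y
  exact isClosed_eq (by fun_prop) (by fun_prop)

theorem ext_conv_star_mul (hδ : IsProper δ) (hinv : h.IsRightInvariant δ) (φ : StrongDual ℂ A)
    (a b : h.nIdeal) : ∃ hm : conv δ φ (star (a : A)) * b ∈ h.mSpan,
      h.ext ⟨_, hm⟩ = inner ℂ (convOp δ h (starFunctional φ) (h.eta a)) (h.eta b) := by
  have h1 : conv δ φ (star (a : A)) = star (conv δ (starFunctional φ) (a : A)) := by
    rw [star_conv hδ, starFunctional_starFunctional]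
  rw [convOp_eta hδ hinv, h.inner_eta]
  exact ⟨h1 ▸ h.star_mul_mem (conv_mem_nIdeal hδ hinv _ a.2) b.2,
    congrArg h.ext (Subtype.ext (congrArg (· * (b : A)) h1))⟩

theorem ext_star_mul_conv (hδ : IsProper δ) (hinv : h.IsRightInvariant δ) (ψ : StrongDual ℂ A)
    (a b : h.nIdeal) : ∃ hm : star (a : A) * conv δ ψ b ∈ h.mSpan,
      h.ext ⟨_, hm⟩ = inner ℂ (h.eta a) (convOp δ h ψ (h.eta b)) := by
  rw [convOp_eta hδ hinv, h.inner_eta]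
  exact ⟨h.star_mul_mem a.2 (conv_mem_nIdeal hδ hinv _ b.2), rfl⟩

theorem strongRightInvariance_iff (hδ : IsProper δ) (hinv : h.IsRightInvariant δ) :
    StrongRightInvariance δ h κ ↔ ∀ φ ψ : StrongDual ℂ A, IsCompAntipode κ φ ψ →
      convOp δ h (starFunctional φ) = (convOp δ h ψ).adjoint := by
  refine forall₃_congr fun φ ψ _ => ?_
  rw [eq_adjoint_iff_inner_eta]
  constructor
  · intro H a b
    obtain ⟨h₁, h₂, he⟩ := H a a.2 b b.2
    obtain ⟨_, e₁⟩ := ext_conv_star_mul hδ hinv φ a b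
    obtain ⟨_, e₂⟩ := ext_star_mul_conv hδ hinv ψ a b
    exact e₁.symm.trans (he.trans e₂)
  · intro H a ha b hb
    obtain ⟨h₁, e₁⟩ := ext_conv_star_mul hδ hinv φ ⟨a, ha⟩ ⟨b, hb⟩
    obtain ⟨h₂, e₂⟩ := ext_star_mul_conv hδ hinv ψ ⟨a, ha⟩ ⟨b, hb⟩
    exact ⟨h₁, h₂, e₁.trans ((H _ _).trans e₂.symm)⟩

theorem apply_star_matrixElement (hδ : IsProper δ) (hinv : h.IsRightInvariant δ)
    (hlsc : h.IsLowerSemicontinuous) (x y : h.GNS) (φ : StrongDual ℂ A) :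
    φ (star (matrixElement δ h y x)) = inner ℂ (convOp δ h (starFunctional φ) x) y := by
  rw [← inner_conj_symm, ← apply_matrixElement hδ hinv hlsc, starFunctional_apply,
    Complex.conj_conj]

theorem convOp_eq_adjoint_iff (hδ : IsProper δ) (hinv : h.IsRightInvariant δ)
    (hlsc : h.IsLowerSemicontinuous) (φ ψ : StrongDual ℂ A) :
    convOp δ h (starFunctional φ) = (convOp δ h ψ).adjoint ↔
      ∀ x y, ψ (matrixElement δ h x y) = φ (star (matrixElement δ h y x)) := by
  rw [ContinuousLinearMap.eq_adjoint_iff]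
  refine forall₂_congr fun x y => ?_
  rw [apply_star_matrixElement hδ hinv hlsc, apply_matrixElement hδ hinv hlsc, eq_comm]

end StrongRightInvariance

end QG

end

theorem mainTheorem8 {A : Type*} [NonUnitalCStarAlgebra A] [PartialOrder A] [StarOrderedRing A]
    [TopologicalSpace.SeparableSpace A]
    (δ : A →⋆ₙₐ[ℂ] 𝓜(ℂ, QG.MinTensor A A)) (hδ : QG.IsCStarBialgebra δ)
    (hproper : QG.IsProper δ) (hcanc : QG.HasCancellation δ)
    (h : QG.CStarWeight A) (hfaithful : h.IsFaithful) (hfinite : h.IsLocallyFinite)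
    (hlsc : h.IsLowerSemicontinuous) (hinv : h.IsRightInvariant δ)
    (κ : A →ₗ.[ℂ] A) (hclosed : κ.IsClosed) (hdense : Dense (κ.domain : Set A))
    (R : A →ₗ[ℂ] A) (τ : ℝ → A ≃⋆ₐ[ℂ] A) (hpolar : QG.IsPolarDecomposition κ R τ)
    (hrel : h.IsRelativelyInvariant τ) :
    -- the convolution products `φ * a`, the operators `W_φ` and the elements `W(x, y)` are
    -- well defined
    (∀ (φ : StrongDual ℂ A) (a : A), ∃! c, QG.IsConv δ φ a c) ∧
    (∀ φ : StrongDual ℂ A, ∃! T, QG.IsConvOp δ h φ T) ∧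
    (∀ x y : h.GNS, ∃! w, QG.IsMatrixElement δ h x y w) ∧
    List.TFAE [
      -- 1. strong right invariance
      QG.StrongRightInvariance δ h κ,
      -- 2. `W_{φ*} = (W_{φ ∘ κ})*` for all `φ ∈ A*` with `φ ∘ κ ∈ A*`
      ∀ φ ψ : StrongDual ℂ A, QG.IsCompAntipode κ φ ψ →
        QG.convOp δ h (QG.starFunctional φ) = (QG.convOp δ h ψ).adjoint,
      -- 3. the same for all `φ` in a weak* dense set that is invariant under `φ ↦ φ ∘ τ_t`
      ∃ D : Set (StrongDual ℂ A), Dense (StrongDual.toWeakDual '' D) ∧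
        (∀ φ ∈ D, ∀ t : ℝ, ∃ φ' ∈ D, ∀ a, φ' a = φ (τ t a)) ∧
        (∀ φ ∈ D, ∃ ψ : StrongDual ℂ A, QG.IsCompAntipode κ φ ψ ∧
          QG.convOp δ h (QG.starFunctional φ) = (QG.convOp δ h ψ).adjoint),
      -- 4. `W(x, y)` is in the domain of `κ` and `κ(W(x, y)) = W(y, x)*`
      ∀ x y : h.GNS, ∃ hx : QG.matrixElement δ h x y ∈ κ.domain,
        κ ⟨QG.matrixElement δ h x y, hx⟩ = star (QG.matrixElement δ h y x)] := by
  refine ⟨QG.existsUnique_isConv hproper, QG.existsUnique_isConvOp hproper hinv,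
    QG.existsUnique_isMatrixElement hproper hinv hlsc, ?_⟩
  tfae_have 1 ↔ 2 := QG.strongRightInvariance_iff hproper hinv
  tfae_have 2 → 3 := by
    intro H
    refine ⟨QG.compAntipodeDomain κ, QG.dense_compAntipodeDomain hclosed, ?_, ?_⟩
    · rintro φ ⟨ψ, hψ⟩ t
      exact ⟨_, ⟨_, hpolar.isCompAntipode t hψ⟩, fun _ => rfl⟩
    · rintro φ ⟨ψ, hψ⟩
      exact ⟨ψ, hψ, H φ ψ hψ⟩
  tfae_have 3 → 4 := by
    rintro ⟨D, hD, hτ, hW⟩ x y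
    have hmem : (QG.matrixElement δ h x y, star (QG.matrixElement δ h y x)) ∈ κ.graph := by
      refine hpolar.mem_graph_of_dense hclosed hdense hD hτ fun φ hφ => ?_
      obtain ⟨ψ, hψ, hadj⟩ := hW φ hφ
      exact ⟨ψ, hψ, (QG.convOp_eq_adjoint_iff hproper hinv hlsc φ ψ).1 hadj x y⟩
    have hx := LinearPMap.mem_domain_of_mem_graph hmem
    exact ⟨hx, κ.mem_graph_snd_inj (κ.mem_graph ⟨_, hx⟩) hmem rfl⟩
  tfae_have 4 → 2 := by
    intro H φ ψ hψ
    refine (QG.convOp_eq_adjoint_iff hproper hinv hlsc φ ψ).2 fun x y => ?_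
    obtain ⟨hx, hκ⟩ := H x y
    rw [← hκ]
    exact hψ ⟨_, hx⟩
  tfae_finish
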